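/- Let $d\ge 1$, $h=1/c\in(0,1)$, $z=(t,x)\in\mathbb R^{1,d}$, $\langle z\rangle=(1+t^2+|x|^2)^{1/2}$, and let $\mathbb M=\overline{\mathbb R^{1,d}}$ be the radial compactification of $\mathbb R^{1,d}$. Let $g=\{g(c)\}_{c>1}$ be a family of Lorentzian metrics on $\mathbb R^{1,d}$, $$g(c)=-c^2dt^2+dx^2+\alpha\,dt^2+\sum_j \frac{w_j}{c}\,dt\,dx_j+\frac1{c^2}\sum_{j,l}k_{jl}\,dx_j\,dx_l,\qquad k_{jl}=k_{lj},$$ with $\alpha,w_j,k_{jl}\in C^\infty([0,1)_{h};\langle z\rangle^{-1}C^\infty(\mathbb M;\mathbb R))$. Fix a sign $\sigma=\pm1$ and let $$p=-g^{-1}(\zeta,\zeta)+2\sigma\tau,\qquad \zeta=\tau\,dt+\xi\cdot dx,$$ which represents the principal symbol of the conjugated Klein–Gordon operator $P_\pm=e^{\mp ic^2t}Pe^{\pm ic^2t}$, where $P=\square_g-c^2+{}$(lower-order terms that do not contribute) and $\pm$ is the sign of $\sigma$. **Phase space.** Let $X$ be the manifold with corners obtained from $\mathbb M\times\overline{\mathbb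 R^{1+d}}\times[0,1)_h$, the second factor being the radial compactification in the natural frequencies $(\tau_\natural,\xi_\natural)=(h^2\tau,h\xi)$, by blowing up $\{h=0,\ \tau_\natural=0,\ \xi_\natural=0\}$ parabolically ($h$ and $\xi_\natural$ have weight $1$, $\tau_\natural$ has weight $2$). Its boundary hypersurfaces are $\mathrm{bf}$ (over $\partial\mathbb M$), $\mathrm{df}$ (fiber infinity), $\mathrm{pf}$ (the front face of the blowup) and $\natural\mathrm f$ (the lift of $\{h=0\}$). Let $\rho_{\mathrm{df}},\rho_{\mathrm{bf}},\rho_{\natural\mathrm f}$ be any boundary-defining functions of the respective faces. A p-submanifold of a manifold with corners is a subset that near each of its points is given, in suitable local coordinates of the manifold with corners, by the vanishing of some of the coordinates. **Dynamics.** Let $\mathsf p$ and $\mathsf H_p$ be the smooth extensions to $X$ of $$\rho_{\mathrm{df}}^2\rho_{\natural\mathrm f}^2\,p\quad\text{and}\quad \tfrac12\rho_{\mathrm{df}}\rho_{\mathrm{bf}}^{-1}\rho_{\natural\mathrm f}H_p,\qquad H_p=\partial_\zeta p\cdot\partial_z-\partial_zp\cdot\partial_\zeta .$$ Let $\Sigma=\{\mathsf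 p=0\}\cap(\mathrm{df}\cup\mathrm{bf}\cup\natural\mathrm f)\cap\mathrm{cl}_X\{\sigma\tau_\natural>-1\}$ be the good part of the characteristic set, let $\mathcal R$ be the set of points of $\Sigma$ at which the smooth vector field $\mathsf H_p$ vanishes, and for $\varsigma=\pm1$ let $\mathcal R_\varsigma$ be the closure in $X$ of the set of points of $\mathrm{bf}$ with $h\in(0,1)$, frequencies $\tau_\natural=\sigma(\sqrt{1+|\xi_\natural|^2}-1)$, $\xi_\natural\in\mathbb R^d$, and base point the endpoint on $\partial\mathbb M$ of the ray $\varsigma\,\mathbb R^+\,(h\sqrt{1+|\xi_\natural|^2},\,-\sigma\xi_\natural)$. For a vector field $V$ on $X$ and $R\subset S\subset X$, say that $R$ is a *sink* for $V$ on $S$ if every $q_0\in R$ has, for each neighborhood $O$ of $q_0$, a neighborhood $O'$ and constants $C$, $\kappa>0$ such that the integral curve of $V$ from any $q\in O'\cap S$ exists for all times $s\ge0$, stays in $S\cap O$, and converges to a point of $R$ with distance to it at most $Ce^{-\kappa s}$. A *source* for $V$ is a sink for $-V$. **Claim.** The smooth extensions $\mathsf p$ and $\mathsf H_p$ exist, and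 the following hold. 1. $\mathcal R=\mathcal R_-\cup\mathcal R_+$, and $\mathcal R_-$ and $\mathcal R_+$ are disjoint and connected. 2. $\mathcal R_\pm\subset\mathrm{bf}$, and each of $\mathcal R_\pm$ is a smooth p-submanifold of $X$ and of $\Sigma\cap\mathrm{bf}$. 3. $\mathcal R_\sigma$ is a sink and $\mathcal R_{-\sigma}$ is a source for $\mathsf H_p$, both on $\Sigma$ and on $\{\mathsf p=0\}$. That is, for $P_+$ the sink is $\mathcal R_+$ and the source is $\mathcal R_-$, and for $P_-$ the roles are exchanged. -/

import Mathlib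

open Set Filter
open scoped Topology ContDiff

noncomputable section

namespace NonrelKG

/-! ### Smooth functions, boundary-defining functions and p-submanifolds

All manifolds with corners below are given as subsets of a Euclidean space, cut out by finitely many
equations and inequalities with independent differentials; their smooth functions are the restrictions of
smooth functions on open neighbourhoods. -/

section General

variable {E : Type*} [NormedAddCommGroup E] [NormedSpace ℝ E]

/-- `f` restricted to `X` is the restriction of a smooth map on an open neighbourhood of `X`. -/
def SmoothOnSet {G : Type*} [NormedAddCommGroup G] [NormedSpace ℝ G] (X : Set E) (f : E → G) : Prop :=
  ∃ (U : Set E) (f' : E → G), IsOpen U ∧ X ⊆ U ∧ ContDiffOn ℝ ∞ f' U ∧ EqOn f f' X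

/-- `ρ` is a boundary-defining function of the face `{ρ₀ = 0}` of `X`, where `ρ₀` is one of them: any two
boundary-defining functions of a face differ by a smooth positive factor. -/
def IsBoundaryDefining (X : Set E) (ρ₀ ρ : E → ℝ) : Prop :=
  ∃ u : E → ℝ, SmoothOnSet X u ∧ (∀ q ∈ X, 0 < u q) ∧ ∀ q ∈ X, ρ q = u q * ρ₀ q

/-- `Y` is a p-submanifold of the embedded manifold with corners `X`: near each point of `Y` there are
smooth coordinates of the ambient space in which `X` is given by the vanishing of some coordinates and the
nonnegativity of others, and `Y ⊆ X` by the vanishing of a further subset of the coordinates. -/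
def IsPSubmanifold (X Y : Set E) : Prop :=
  Y ⊆ X ∧ ∀ q ∈ Y, ∃ (N : ℕ) (Φ : OpenPartialHomeomorph E (Fin N → ℝ)) (I J K : Set (Fin N)),
    q ∈ Φ.source ∧ ContDiffOn ℝ ∞ Φ Φ.source ∧ ContDiffOn ℝ ∞ Φ.symm Φ.target ∧
    (∀ u ∈ Φ.source, u ∈ X ↔ (∀ i ∈ I, Φ u i = 0) ∧ ∀ j ∈ J, 0 ≤ Φ u j) ∧
    (∀ u ∈ Φ.source, u ∈ Y ↔ u ∈ X ∧ ∀ k ∈ K, Φ u k = 0)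

/-- `R` is a (nondegenerate) sink for the flow of `V` on the invariant set `S`: near each point `q₀` of `R`,
all trajectories in `S` that start close enough to `q₀` exist for all positive times, stay in `S` and in a
prescribed neighbourhood of `q₀`, and converge to a point of `R`, exponentially with a locally uniform
rate. -/
def IsSink (V : E → E) (S R : Set E) : Prop :=
  ∀ q₀ ∈ R, ∀ O ∈ 𝓝 q₀, ∃ O' ∈ 𝓝 q₀, ∃ C κ : ℝ, 0 < κ ∧ ∀ q ∈ O' ∩ S,
    ∃ γ : ℝ → E, γ 0 = q ∧
      (∀ s : ℝ, 0 ≤ s → γ s ∈ S ∩ O ∧ HasDerivWithinAt γ (V (γ s)) (Ici 0) s) ∧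
      ∃ q₁ ∈ R, ∀ s : ℝ, 0 ≤ s → dist (γ s) q₁ ≤ C * Real.exp (-κ * s)

/-- A source is a sink of the reversed flow. -/
def IsSource (V : E → E) (S R : Set E) : Prop :=
  IsSink (fun q => -V q) S R

end General

/-! ### The compactified phase space -/

/-- Vectors of `ℝ^{1,d}`, also used for covectors; the entry `0` is the time (or `τ`) entry. -/
abbrev Spacetime (d : ℕ) := EuclideanSpace ℝ (Fin (d + 1))

/-- The space in which the radial compactification of spacetime lives. -/
abbrev BaseAmbient (d : ℕ) := ℝ × Spacetime d

/-- The space in which the compactified phase space lives; the first factor is for the spacetime variables,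
the second one, with entries `(r, a, y₀, θ, b)`, for the frequencies and `h`. -/
abbrev Ambient (d : ℕ) := BaseAmbient d × (ℝ × ℝ × ℝ × ℝ × EuclideanSpace ℝ (Fin d))

variable {d : ℕ}

/-- The Japanese bracket `⟨z⟩`. -/
def bracket (z : Spacetime d) : ℝ := Real.sqrt (1 + ‖z‖ ^ 2)

/-- The embedding `z ↦ (1, z) / ⟨z⟩` of `ℝ^{1,d}` into its radial compactification, the closed upper
hemisphere. -/
def baseEmbed (z : Spacetime d) : BaseAmbient d := ((bracket z)⁻¹, (bracket z)⁻¹ • z)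

/-- The radial compactification `𝕄` of `ℝ^{1,d}`: a closed hemisphere. -/
def baseSpace (d : ℕ) : Set (BaseAmbient d) := {m | 0 ≤ m.1 ∧ m.1 ^ 2 + ‖m.2‖ ^ 2 = 1}

/-- Defines spacetime infinity `bf`. -/
def bfFun (q : Ambient d) : ℝ := q.1.1
/-- The direction at spacetime infinity. -/
def dirFun (q : Ambient d) : Spacetime d := q.1.2
/-- The radial variable of the blowup, which defines `pf`. -/
def pfFun (q : Ambient d) : ℝ := q.2.1
/-- Defines the face `♮f`; the product of `nfFun` and `pfFun` is `h`. -/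
def nfFun (q : Ambient d) : ℝ := q.2.2.1
/-- Defines fiber infinity `df`. -/
def dfFun (q : Ambient d) : ℝ := q.2.2.2.1
/-- The rescaled time frequency on the blowup. -/
def timeFun (q : Ambient d) : ℝ := q.2.2.2.2.1
/-- The rescaled spatial frequency on the blowup. -/
def spaceFun (q : Ambient d) : EuclideanSpace ℝ (Fin d) := q.2.2.2.2.2

/-- The resolved natural phase space over `h ∈ [0, 1)`. The natural frequencies `(h²τ, hξ)` are radially
compactified to the hemisphere of points `(y₀, y_τ, y_ξ)` of norm one with `y₀ ≥ 0`, where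
`(y_τ, y_ξ) = y₀ (h²τ, hξ)`; then `{h = 0, y_τ = 0, y_ξ = 0}`, the zero section over `h = 0`, is blown up
parabolically: `h = r a`, `y_ξ = r b`, `y_τ = r² θ` with `r ≥ 0`, `a ≥ 0` and
`a⁴ + |b|⁴ + θ² = 1`. -/
def phaseSpace (d : ℕ) : Set (Ambient d) :=
  {q | q.1 ∈ baseSpace d ∧ 0 ≤ pfFun q ∧ 0 ≤ nfFun q ∧ 0 ≤ dfFun q ∧ pfFun q * nfFun q < 1 ∧
    nfFun q ^ 4 + ‖spaceFun q‖ ^ 4 + timeFun q ^ 2 = 1 ∧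
    dfFun q ^ 2 + ‖pfFun q • spaceFun q‖ ^ 2 + (pfFun q ^ 2 * timeFun q) ^ 2 = 1}

/-- The face over spacetime infinity. -/
def bf (d : ℕ) : Set (Ambient d) := {q ∈ phaseSpace d | bfFun q = 0}
/-- The face over fiber infinity. -/
def df (d : ℕ) : Set (Ambient d) := {q ∈ phaseSpace d | dfFun q = 0}
/-- The natural face. -/
def nf (d : ℕ) : Set (Ambient d) := {q ∈ phaseSpace d | nfFun q = 0}

/-- The spatial part of a (co)vector. -/
def spatial (ζ : Spacetime d) : EuclideanSpace ℝ (Fin d) := WithLp.toLp 2 fun j => ζ j.succ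

/-- The (co)vector with time entry `τ` and spatial part `ξ`. -/
def spacetimeVec (τ : ℝ) (ξ : EuclideanSpace ℝ (Fin d)) : Spacetime d :=
  WithLp.toLp 2 (Fin.cons τ fun j => ξ j)

/-- The natural frequencies `(h²τ, hξ)`. -/
def natFreq (h : ℝ) (ζ : Spacetime d) : Spacetime d := spacetimeVec (h ^ 2 * ζ 0) (h • spatial ζ)

/-- The radial variable `(h⁴ + |y_ξ|⁴ + y_τ²)^{1/4}` of the blowup, with `y` the compactified natural
frequency of `ζ`. -/
def blowupRadius (h : ℝ) (ζ : Spacetime d) : ℝ :=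
  Real.sqrt (Real.sqrt (h ^ 4 + ‖spatial (baseEmbed (natFreq h ζ)).2‖ ^ 4
    + (baseEmbed (natFreq h ζ)).2 0 ^ 2))

/-- The inclusion of `T^*ℝ^{1,d} × (0, 1)_h` as the interior of the phase space. -/
def phaseEmbed (h : ℝ) (z ζ : Spacetime d) : Ambient d :=
  (baseEmbed z,
    (blowupRadius h ζ,
     h / blowupRadius h ζ,
     (baseEmbed (natFreq h ζ)).1,
     (baseEmbed (natFreq h ζ)).2 0 / blowupRadius h ζ ^ 2,
     (blowupRadius h ζ)⁻¹ • spatial (baseEmbed (natFreq h ζ)).2))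

/-! ### The metric and the symbol -/

/-- `a ∈ C^∞([0,1)_h; S_cl^{-1}(ℝ^{1,d}; ℝ))`, that is `a = ⟨z⟩⁻¹ G` with `G` smooth on `[0,1) × 𝕄`. -/
def IsClassicalFamily (a : ℝ → Spacetime d → ℝ) : Prop :=
  ∃ G : ℝ × BaseAmbient d → ℝ, SmoothOnSet (Ico (0 : ℝ) 1 ×ˢ baseSpace d) G ∧
    ∀ h ∈ Ico (0 : ℝ) 1, ∀ z, a h z = (bracket z)⁻¹ * G (h, baseEmbed z)

/-- The matrix of `g = -c² dt² + dx² + α dt² + ∑ (wⱼ/c) dt dxⱼ + c⁻² ∑ kⱼₗ dxⱼ dxₗ` at the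
point `z`, where `c = 1/h` and `dt dxⱼ` is the symmetric product. -/
def metricMatrix (α : ℝ → Spacetime d → ℝ) (w : Fin d → ℝ → Spacetime d → ℝ)
    (k : Fin d → Fin d → ℝ → Spacetime d → ℝ) (h : ℝ) (z : Spacetime d) :
    Matrix (Fin (d + 1)) (Fin (d + 1)) ℝ :=
  Matrix.of (Fin.cons
    (Fin.cons (-(1 / h) ^ 2 + α h z) fun j => h * w j h z / 2)
    fun i => Fin.cons (h * w i h z / 2) fun j => (if i = j then 1 else 0) + h ^ 2 * k i j h z)

/-- A symmetric matrix of signature `(-, +, …, +)`. -/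
def IsLorentzian (A : Matrix (Fin (d + 1)) (Fin (d + 1)) ℝ) : Prop :=
  ∃ Q : Matrix (Fin (d + 1)) (Fin (d + 1)) ℝ, IsUnit Q.det ∧
    Q.transpose * A * Q = Matrix.diagonal (Fin.cons (-1) fun _ => 1)

/-- The symbol `p = -g⁻¹(ζ, ζ) + 2στ` of the conjugated operator `P_±`, with `σ = ±1`, for the metric with
matrix `g h z`. -/
def symbol (g : ℝ → Spacetime d → Matrix (Fin (d + 1)) (Fin (d + 1)) ℝ) (σ h : ℝ)
    (z ζ : Spacetime d) : ℝ :=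
  -(∑ i, ∑ j, (g h z)⁻¹ i j * ζ i * ζ j) + 2 * σ * ζ 0

/-- The Hamiltonian vector field `(∂_ζ p, -∂_z p)`. -/
def hamiltonianField (p : Spacetime d → Spacetime d → ℝ) (z ζ : Spacetime d) :
    Spacetime d × Spacetime d :=
  (gradient (fun ζ' => p z ζ') ζ, -gradient (fun z' => p z' ζ) z)

/-- `P` is the smooth function on the phase space that is `ρ_df² ρ_nf² p` in the interior; as the interior
is dense, there is at most one. -/
def IsRescaledSymbol (p : ℝ → Spacetime d → Spacetime d → ℝ) (ρdf ρnf P : Ambient d → ℝ) : Prop :=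
  SmoothOnSet (phaseSpace d) P ∧ ∀ h ∈ Ioo (0 : ℝ) 1, ∀ z ζ : Spacetime d,
    P (phaseEmbed h z ζ) = ρdf (phaseEmbed h z ζ) ^ 2 * ρnf (phaseEmbed h z ζ) ^ 2 * p h z ζ

/-- `V` is the smooth vector field on the phase space that is the pushforward of
`2⁻¹ ρ_df ρ_bf⁻¹ ρ_nf H_p` in the interior; as the interior is dense, there is at most one. -/
def IsRescaledHamiltonian (p : ℝ → Spacetime d → Spacetime d → ℝ) (ρdf ρbf ρnf : Ambient d → ℝ)
    (V : Ambient d → Ambient d) : Prop :=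
  SmoothOnSet (phaseSpace d) V ∧ ∀ h ∈ Ioo (0 : ℝ) 1, ∀ z ζ : Spacetime d,
    V (phaseEmbed h z ζ) =
      (2⁻¹ * ρdf (phaseEmbed h z ζ) * (ρbf (phaseEmbed h z ζ))⁻¹ * ρnf (phaseEmbed h z ζ)) •
        fderiv ℝ (fun v : Spacetime d × Spacetime d => phaseEmbed h v.1 v.2) (z, ζ)
          (hamiltonianField (p h) z ζ)

/-- The zero set of the rescaled symbol in the phase space. -/
def zeroSet (P : Ambient d → ℝ) : Set (Ambient d) := {q ∈ phaseSpace d | P q = 0}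

/-- The characteristic set: the part of the zero set of the rescaled symbol in `df ∪ bf ∪ ♮f`. -/
def charSet (P : Ambient d → ℝ) : Set (Ambient d) := zeroSet P ∩ (df d ∪ bf d ∪ nf d)

/-- The good component `Σ`: the part of the characteristic set in the closure of `{σ h²τ > -1}`. -/
def goodSheet (σ : ℝ) (P : Ambient d → ℝ) : Set (Ambient d) :=
  charSet P ∩ closure {q | ∃ h ∈ Ioo (0 : ℝ) 1, ∃ z ζ : Spacetime d,
    q = phaseEmbed h z ζ ∧ -1 < σ * natFreq h ζ 0}

/-- The radial set: the set of zeros in `Σ` of the rescaled Hamiltonian vector field. -/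
def radialSet (σ : ℝ) (P : Ambient d → ℝ) (V : Ambient d → Ambient d) : Set (Ambient d) :=
  {q ∈ goodSheet σ P | V q = 0}

/-- The set `R_ς`, for `ς = ±1`: the closure in the phase space of the set of points over `h ∈ (0, 1)` in
`bf` and outside `df` with natural frequencies `(σ (√(1 + |ξ|²) - 1), ξ)` and base direction
`ς ℝ⁺ (h √(1 + |ξ|²), -σ ξ)`. -/
def radialComponent (σ ς : ℝ) : Set (Ambient d) :=
  phaseSpace d ∩ closure {q | ∃ h ∈ Ioo (0 : ℝ) 1, ∃ ξ : EuclideanSpace ℝ (Fin d), ∃ ζ : Spacetime d,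
    natFreq h ζ = spacetimeVec (σ * (Real.sqrt (1 + ‖ξ‖ ^ 2) - 1)) ξ ∧
    q.2 = (phaseEmbed h 0 ζ).2 ∧
    bfFun q = 0 ∧ ‖dirFun q‖ = 1 ∧
    ∃ l : ℝ, 0 < l ∧ dirFun q = (ς * l) • spacetimeVec (h * Real.sqrt (1 + ‖ξ‖ ^ 2)) (-σ • ξ)}

end NonrelKG

end

open NonrelKG

/-! Notation: m = `bfFun`, n = `dirFun`, and r, a, y, θ, b = `pfFun`, `nfFun`, `dfFun`, `timeFun`,
`spaceFun`, so that h = ra. E = `energyFun` and v = `flatVelocity`.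

Rescaling the time component by h turns the metric into η + h²mK with K smooth up to the boundary,
so its inverse is η + h²mN (`exists_inverse_metric`). In natural frequencies the symbol and the
velocity therefore differ from their Minkowski counterparts only by terms that vanish where h = 0 or
m = 0. This gives explicit smooth extensions `resSymbol` and `resField`, identified in the interior
by `resSymbol_phaseEmbed` and `resField_phaseEmbed`.

The force is O(⟨z⟩⁻²), so even after division by the defining function of bf the frequency part of
the field carries a factor m. Over bf the frequencies are frozen and the direction obeys n' = v -
⟨v, n⟩n on the unit sphere, with v the flat velocity; this flow contracts to v/|v| and expands from
-v/|v|. On the good sheet v is σ times a positive multiple of (h√(1+|ξ|²), -σξ), which is why the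
sink is R_σ (`flatVelocity_eq`). Everything rests on v ≠ 0 up to all faces (`flatVelocity_ne_zero`),
in particular at the front face of the parabolic blowup. Away from bf a zero of the field would be a
zero of the whole velocity: at ♮f the same lemma excludes it, at df the nondegeneracy of the metric
does (`mem_radialLocus_of_resField_eq_zero`).

So the radial set is the locus m = 0, n = ±v/|v| on the flat mass shell. The closures R_± fill this
locus because each of its points can be perturbed along the mass shell into h > 0 and finite
frequencies (`tendsto_radialInterior`). They are connected as closures of images of (0, 1) × ℝ^d,
and they are p-submanifolds because the differentials of the equations are independent
(`faceFun_alignFun_independent`).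

For the dynamics off bf the Lyapunov function is Λ = Km² + |v - ⟨v, n⟩n|². Up to the positive factor
from the boundary-defining functions, m and the misalignment v - ⟨v, n⟩n both decay near R_σ with
rates close to ⟨v, n⟩, up to errors that a large K absorbs (`lyapunov_decay`). The speed is O(√Λ),
so trajectories converge exponentially (`isSink_of_lyapunov`). Phase space, zero set and faces are
invariant because their defining functions solve linear equations along the flow (`trajectory_mem`).
-/

namespace NonrelKG

/-! ### Coordinates built from functions with independent differentials. -/

section Charts

variable {E : Type*} [NormedAddCommGroup E] [NormedSpace ℝ E] [FiniteDimensional ℝ E]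

/-- A continuously differentiable map with invertible differential at `q` restricts to a diffeomorphism
near `q`. -/
theorem exists_chart_of_equiv {F : Type*} [NormedAddCommGroup F] [NormedSpace ℝ F]
    {f : E → F} {U : Set E} (hU : IsOpen U) (hf : ContDiffOn ℝ ∞ f U) {q : E} (hq : q ∈ U)
    (L : E ≃L[ℝ] F) (hL : HasFDerivAt f (L : E →L[ℝ] F) q) :
    ∃ Φ : OpenPartialHomeomorph E F, q ∈ Φ.source ∧ Φ.source ⊆ U ∧ (Φ : E → F) = f ∧
      ContDiffOn ℝ ∞ Φ Φ.source ∧ ContDiffOn ℝ ∞ Φ.symm Φ.target := by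
  have : CompleteSpace E := FiniteDimensional.complete ℝ E
  have hfq : ContDiffAt ℝ ∞ f q := hf.contDiffAt (hU.mem_nhds hq)
  have hn : (∞ : WithTop ℕ∞) ≠ 0 := by simp
  have hcont : ContinuousOn (fderiv ℝ f) U := hf.continuousOn_fderiv_of_isOpen hU (by simp)
  set R : Set (E →L[ℝ] F) := range ((↑) : (E ≃L[ℝ] F) → E →L[ℝ] F) with hR
  have hRo : IsOpen R := ContinuousLinearEquiv.isOpen
  -- Shrinking to the points with invertible differential makes the inverse smooth on the whole
  -- target and not only at the image of `q`.
  have hW : IsOpen (U ∩ fderiv ℝ f ⁻¹' R) := hcont.isOpen_inter_preimage hU hRo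
  set Φ := (hfq.toOpenPartialHomeomorph f hL hn).restrOpen _ hW with hΦ
  have hsrc : Φ.source = (hfq.toOpenPartialHomeomorph f hL hn).source ∩ (U ∩ fderiv ℝ f ⁻¹' R) :=
    OpenPartialHomeomorph.restrOpen_source _ _ _
  have hcoe : (Φ : E → F) = f := by
    rw [hΦ]; rfl
  refine ⟨Φ, ?_, ?_, hcoe, ?_, ?_⟩
  · rw [hsrc]
    exact ⟨ContDiffAt.mem_toOpenPartialHomeomorph_source hfq hL hn, hq, L, hL.fderiv.symm⟩
  · rw [hsrc]; exact fun x hx => hx.2.1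
  · rw [hcoe]; refine hf.mono ?_
    rw [hsrc]; exact fun x hx => hx.2.1
  · intro y hy
    have hx : Φ.symm y ∈ Φ.source := Φ.map_target hy
    rw [hsrc] at hx
    obtain ⟨-, hxU, L', hL'⟩ := hx
    have hfx : ContDiffAt ℝ ∞ f (Φ.symm y) := hf.contDiffAt (hU.mem_nhds hxU)
    refine (Φ.contDiffAt_symm (f₀' := L') hy ?_ ?_).contDiffWithinAt
    · rw [hcoe, hL']; exact (hfx.differentiableAt (by simp)).hasFDerivAt
    · rw [hcoe]; exact hfx

/-- Functions with linearly independent differentials are part of a coordinate system. -/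
theorem exists_chart_of_linearIndependent {ι : Type*} [Fintype ι] {f : ι → E → ℝ} {U : Set E}
    (hU : IsOpen U) (hf : ∀ i, ContDiffOn ℝ ∞ (f i) U) {q : E} (hq : q ∈ U)
    (hli : LinearIndependent ℝ fun i => fderiv ℝ (f i) q) :
    ∃ (N : ℕ) (Φ : OpenPartialHomeomorph E (Fin N → ℝ)) (e : ι → Fin N), q ∈ Φ.source ∧
      Φ.source ⊆ U ∧ ContDiffOn ℝ ∞ Φ Φ.source ∧ ContDiffOn ℝ ∞ Φ.symm Φ.target ∧
      ∀ u i, Φ u (e i) = f i u := by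
  classical
  -- The differentials extend to a basis of the dual space. The added basis vectors are linear
  -- functionals and serve themselves as the missing coordinates.
  obtain ⟨κ, b, hb⟩ : ∃ (κ : Type _) (b : Module.Basis (ι ⊕ κ) ℝ (E →L[ℝ] ℝ)),
      ∀ i, b (Sum.inl i) = fderiv ℝ (f i) q :=
    ⟨_, Module.Basis.sumExtend hli, fun i => by
      simp [Module.Basis.sumExtend]; rfl⟩
  have : Fintype (ι ⊕ κ) := FiniteDimensional.fintypeBasisIndex b
  let n : (ι ⊕ κ) ≃ Fin (Fintype.card (ι ⊕ κ)) := Fintype.equivFin (ι ⊕ κ)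
  let g : (ι ⊕ κ) → E → ℝ := Sum.elim f fun k x => b (Sum.inr k) x
  have hg : ∀ j, ContDiffOn ℝ ∞ (g j) U := by
    rintro (i | k)
    · exact hf i
    · exact (b (Sum.inr k)).contDiff.contDiffOn
  have hg' : ∀ j, HasFDerivAt (g j) (b j) q := by
    rintro (i | k)
    · rw [hb]
      exact (((hf i).contDiffAt (hU.mem_nhds hq)).differentiableAt (by simp)).hasFDerivAt
    · exact (b (Sum.inr k)).hasFDerivAt
  let F : E → Fin (Fintype.card (ι ⊕ κ)) → ℝ := fun x j => g (n.symm j) x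
  let L₀ : E →L[ℝ] (Fin (Fintype.card (ι ⊕ κ)) → ℝ) := ContinuousLinearMap.pi fun j => b (n.symm j)
  have hL₀ : Function.Injective L₀ := by
    rw [injective_iff_map_eq_zero]
    intro x hx
    have h1 : ∀ j, b j x = 0 := fun j => by
      have := congrFun hx (n j); simpa [L₀] using this
    have h2 : ∀ φ : E →L[ℝ] ℝ, φ x = 0 := fun φ => by
      rw [← b.sum_repr φ, sum_apply]
      simp [h1]
    by_contra hne
    obtain ⟨φ, -, hφ⟩ := exists_dual_vector ℝ x (norm_ne_zero_iff.2 hne)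
    rw [h2 φ] at hφ
    exact hne (norm_eq_zero.mp (by simpa using hφ.symm))
  have hdim : Module.finrank ℝ E = Module.finrank ℝ (Fin (Fintype.card (ι ⊕ κ)) → ℝ) := by
    rw [Module.finrank_fin_fun, ← Module.finrank_eq_card_basis b]
    have e1 : (E →ₗ[ℝ] ℝ) ≃ₗ[ℝ] (E →L[ℝ] ℝ) := LinearMap.toContinuousLinearMap
    rw [← e1.finrank_eq]
    exact (Subspace.dual_finrank_eq (K := ℝ) (V := E)).symm
  let L : E ≃L[ℝ] (Fin (Fintype.card (ι ⊕ κ)) → ℝ) :=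
    (LinearEquiv.ofInjectiveOfFinrankEq L₀.toLinearMap hL₀ hdim).toContinuousLinearEquiv
  have hL : (L : E →L[ℝ] (Fin (Fintype.card (ι ⊕ κ)) → ℝ)) = L₀ := by ext x : 1; rfl
  obtain ⟨Φ, h1, h2, h3, h4, h5⟩ := exists_chart_of_equiv (f := F) hU
    (contDiffOn_pi.2 fun j => hg _) hq L (by
      rw [hL]; exact hasFDerivAt_pi.2 fun j => hg' _)
  exact ⟨_, Φ, fun i => n (Sum.inl i), h1, h2, h4, h5, fun u i => by
    rw [h3]; simp [F, g]⟩

/-- A criterion for p-submanifolds: `X` and `Y` are locally given by equations and inequalities such that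
the differentials of those functions that vanish at the point are independent. -/
theorem isPSubmanifold_of_local {X Y : Set E} (hYX : Y ⊆ X)
    (h : ∀ q ∈ Y, ∃ (ι : Type) (_ : Fintype ι) (f : ι → E → ℝ) (I J K : Set ι) (U : Set E),
      IsOpen U ∧ q ∈ U ∧ (∀ i, ContDiffOn ℝ ∞ (f i) U) ∧
      (∀ u ∈ U, u ∈ X ↔ (∀ i ∈ I, f i u = 0) ∧ ∀ j ∈ J, 0 ≤ f j u) ∧
      (∀ u ∈ U, u ∈ Y ↔ u ∈ X ∧ ∀ k ∈ K, f k u = 0) ∧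
      ∀ c : ι → ℝ, (∀ i, c i * f i q = 0) → ∑ i, c i • fderiv ℝ (f i) q = 0 → ∀ i, c i = 0) :
    IsPSubmanifold X Y := by
  classical
  refine ⟨hYX, fun q hqY => ?_⟩
  obtain ⟨ι, _, f, I, J, K, U, hU, hqU, hf, hX, hY, hind⟩ := h q hqY
  have hqX := hYX hqY
  let A := {i : ι // f i q = 0}
  have hli : LinearIndependent ℝ fun i : A => fderiv ℝ (f i) q := by
    rw [Fintype.linearIndependent_iff]
    intro c hc i
    -- Extension of `c` by zero to the functions that do not vanish at `q`; this is exactly the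
    -- shape that the hypothesis on `c` allows.
    have := hind (fun j => if hj : f j q = 0 then c ⟨j, hj⟩ else 0) (fun j => by
      by_cases hj : f j q = 0 <;> simp [hj]) (by
        rw [← hc, ← Finset.sum_subset (Finset.subset_univ (Finset.univ.filter fun j => f j q = 0)),
          Finset.sum_subtype (p := fun j => f j q = 0) _ (by simp)]
        · exact Finset.sum_congr rfl fun j _ => by simp [j.2]
        · intro j _ hj
          simp only [Finset.mem_filter, Finset.mem_univ, true_and] at hj
          simp [hj]) i
    simpa [i.2] using this
  -- An inequality that is strict at `q` holds automatically nearby, so only the functions vanishing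
  -- at `q` have to become coordinates.
  have hU₁ : ∃ U₁ : Set E, IsOpen U₁ ∧ q ∈ U₁ ∧ U₁ ⊆ U ∧ ∀ u ∈ U₁, ∀ j, 0 < f j q → 0 < f j u := by
    have : ∀ᶠ u in 𝓝 q, u ∈ U ∧ ∀ j, 0 < f j q → 0 < f j u := by
      refine Filter.Eventually.and (hU.mem_nhds hqU) (Filter.eventually_all.2 fun j => ?_)
      by_cases hj : 0 < f j q
      · have := ((hf j).continuousOn.continuousAt (hU.mem_nhds hqU)).eventually (lt_mem_nhds hj)
        filter_upwards [this] with u hu _ using hu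
      · exact Filter.Eventually.of_forall fun u hu => absurd hu hj
    obtain ⟨U₁, h1, h2, h3⟩ := mem_nhds_iff.1 this
    exact ⟨U₁, h2, h3, fun u hu => (h1 hu).1, fun u hu => (h1 hu).2⟩
  obtain ⟨U₁, hU₁, hqU₁, hU₁U, hpos⟩ := hU₁
  obtain ⟨N, Φ, e, h1, h2, h3, h4, h5⟩ := exists_chart_of_linearIndependent (ι := A)
    (f := fun i => f i) hU₁ (fun i => (hf i).mono hU₁U) hqU₁ hli
  refine ⟨N, Φ, e '' {i | i.1 ∈ I}, e '' {i | i.1 ∈ J}, e '' {i | i.1 ∈ K}, h1, h3, h4, ?_, ?_⟩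
  · intro u hu
    rw [hX u (hU₁U (h2 hu))]
    simp only [forall_mem_image, mem_ofPred_eq, h5]
    refine and_congr ⟨fun H i hi => H _ hi, fun H i hi => H (x := ⟨i, ?_⟩) hi⟩
      ⟨fun H i hi => H _ hi, fun H j hj => ?_⟩
    · exact ((hX q hqU).1 hqX).1 i hi
    · rcases (((hX q hqU).1 hqX).2 j hj).eq_or_lt with h0 | h0
      · exact H (x := ⟨j, h0.symm⟩) hj
      · exact (hpos u (h2 hu) j h0).le
  · intro u hu
    rw [hY u (hU₁U (h2 hu))]
    simp only [forall_mem_image, mem_ofPred_eq, h5]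
    refine and_congr Iff.rfl ⟨fun H i hi => H _ hi, fun H i hi => H (x := ⟨i, ?_⟩) hi⟩
    exact ((hY q hqU).1 hqY).2 i hi

end Charts

/-! ### Trajectories and a Lyapunov criterion for sinks. -/

section Flows

variable {E : Type*} [NormedAddCommGroup E] [NormedSpace ℝ E]

/-- Bounded Lipschitz vector fields are complete. -/
theorem exists_forward_trajectory [CompleteSpace E] {W : E → E} {K : NNReal} (hK : LipschitzWith K W)
    {L : ℝ} (hL : ∀ x, ‖W x‖ ≤ L) (x : E) :
    ∃ γ : ℝ → E, γ 0 = x ∧ ∀ t, 0 ≤ t → HasDerivWithinAt γ (W (γ t)) (Ici 0) t := by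
  have hL0 : 0 ≤ L := (norm_nonneg _).trans (hL x)
  have hex : ∀ n : ℕ, ∃ γ : ℝ → E, γ 0 = x ∧
      ∀ t ∈ Icc (0 : ℝ) n, HasDerivWithinAt γ (W (γ t)) (Icc 0 n) t := fun n => by
    -- A curve of speed at most `L` stays within distance `L * n` up to time `n`, so one Picard step
    -- covers all of `[0, n]`.
    have h : IsPicardLindelof (fun _ => W) (tmin := 0) (tmax := (n : ℝ))
        ⟨0, le_rfl, Nat.cast_nonneg n⟩ x (⟨L * n, by positivity⟩ : NNReal) 0 ⟨L, hL0⟩ K :=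
      IsPicardLindelof.of_time_independent (fun y _ => hL y) hK.lipschitzOnWith
        (by simp only [sub_zero, max_eq_left (Nat.cast_nonneg n), NNReal.coe_zero]; exact le_rfl)
    exact h.exists_eq_forall_mem_Icc_hasDerivWithinAt₀
  choose α hα0 hα using hex
  have huniq : ∀ m n : ℕ, m ≤ n → EqOn (α m) (α n) (Icc 0 m) := fun m n hmn => by
    have hc : (m : ℝ) ≤ n := Nat.cast_le.2 hmn
    have hsub : Icc (0 : ℝ) m ⊆ Icc 0 n := Icc_subset_Icc_right hc
    have key : ∀ k : ℕ, m ≤ k → ∀ t ∈ Ico (0 : ℝ) m,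
        HasDerivWithinAt (α k) (W (α k t)) (Ici t) t := fun k hk t ht => by
      have htk : t < k := ht.2.trans_le (Nat.cast_le.2 hk)
      refine (hα k t ⟨ht.1, htk.le⟩).mono_of_mem_nhdsWithin ?_
      filter_upwards [Icc_mem_nhdsGE htk] with s hs using ⟨ht.1.trans hs.1, hs.2⟩
    refine ODE_solution_unique (v := fun _ => W) (fun _ => hK) ?_ (key m le_rfl) ?_ (key n hmn)
      ((hα0 m).trans (hα0 n).symm)
    · exact HasDerivWithinAt.continuousOn (hα m)
    · exact (HasDerivWithinAt.continuousOn (hα n)).mono hsub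
  -- The `+ 1` puts `t` strictly below the right end of the interval of the chosen solution, so that
  -- right derivatives can be read off there.
  let γ : ℝ → E := fun t => α (⌈t⌉₊ + 1) t
  have hγ : ∀ n : ℕ, EqOn γ (α n) (Icc 0 n) := fun n t ht => by
    have hle : ⌈t⌉₊ ≤ n := Nat.ceil_le.2 ht.2
    have ht1 : t ∈ Icc (0 : ℝ) ⌈t⌉₊ := ⟨ht.1, Nat.le_ceil t⟩
    exact (huniq _ _ (Nat.le_succ ⌈t⌉₊) ht1).symm.trans (huniq _ _ hle ht1)
  refine ⟨γ, (hγ 0 (by simp)).trans (hα0 0), fun t ht => ?_⟩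
  set n := ⌈t⌉₊ + 1
  have htn : t < n := (Nat.le_ceil t).trans_lt (by simp [n])
  have h1 := (hα n t ⟨ht, htn.le⟩).congr_of_mem (hγ n) ⟨ht, htn.le⟩
  rw [← hγ n ⟨ht, htn.le⟩] at h1
  refine h1.mono_of_mem_nhdsWithin ?_
  filter_upwards [self_mem_nhdsWithin, mem_nhdsWithin_of_mem_nhds (Iio_mem_nhds htn)] with s hs hs'
  exact ⟨hs, hs'.le⟩

/-- A solution of a linear scalar equation is a positive multiple of its initial value. -/
theorem exists_pos_eq_mul_of_hasDerivWithinAt {G c : ℝ → ℝ} {T : ℝ} (hT : 0 ≤ T)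
    (hc : ContinuousOn c (Icc 0 T))
    (hG : ∀ t ∈ Icc 0 T, HasDerivWithinAt G (c t * G t) (Icc 0 T) t) :
    ∃ e : ℝ, 0 < e ∧ G T = e * G 0 := by
  -- Integrating factor: `G * exp (-Λ)` is constant.
  let Λ : ℝ → ℝ := fun t => ∫ s in (0 : ℝ)..t, c s
  have hΛ : ∀ t ∈ Icc 0 T, HasDerivWithinAt Λ (c t) (Icc 0 T) t := fun t ht => by
    have : Fact (t ∈ Icc 0 T) := ⟨ht⟩
    refine intervalIntegral.integral_hasDerivWithinAt_right ?_
      (hc.stronglyMeasurableAtFilter_nhdsWithin measurableSet_Icc t) (hc t ht)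
    refine (hc.mono ?_).intervalIntegrable
    rw [uIcc_of_le ht.1]; exact Icc_subset_Icc_right ht.2
  have hd : ∀ t ∈ Icc 0 T,
      HasDerivWithinAt (fun t => G t * Real.exp (-Λ t)) 0 (Icc 0 T) t := fun t ht => by
    have := (hG t ht).mul (hΛ t ht).neg.exp
    refine this.congr_deriv ?_
    simp only [Pi.neg_apply]; ring
  have hconst := constant_of_has_deriv_right_zero (HasDerivWithinAt.continuousOn hd)
    (fun t ht => (hd t (Ico_subset_Icc_self ht)).mono_of_mem_nhdsWithin (by
      filter_upwards [Icc_mem_nhdsGE ht.2] with s hs using ⟨ht.1.trans hs.1, hs.2⟩)) T ⟨hT, le_rfl⟩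
  refine ⟨Real.exp (Λ T), Real.exp_pos _, ?_⟩
  have h0 : Λ 0 = 0 := by simp [Λ]
  simp only [h0, neg_zero, Real.exp_zero, mul_one] at hconst
  rw [← hconst, Real.exp_neg]
  field_simp

/-- A curve that can only leave a closed ball through the open ball never leaves it. -/
theorem mem_closedBall_of_trapped {M : Type*} [PseudoMetricSpace M] {γ : ℝ → M}
    (hγ : ContinuousOn γ (Ici 0)) {q : M} {δ : ℝ}
    (h : ∀ T, 0 ≤ T → (∀ t ∈ Icc 0 T, dist (γ t) q ≤ δ) → dist (γ T) q < δ)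
    (h0 : dist (γ 0) q ≤ δ) {t : ℝ} (ht : 0 ≤ t) : dist (γ t) q ≤ δ := by
  by_contra! hlt
  have hcont : ContinuousOn (fun t => dist (γ t) q) (Ici 0) := fun s hs =>
    (hγ s hs).dist continuousWithinAt_const
  have hival : ∀ u, 0 ≤ u → δ ≤ dist (γ u) q → ∃ s ∈ Icc 0 u, dist (γ s) q = δ := fun u hu hδ =>
    intermediate_value_Icc hu (hcont.mono Icc_subset_Ici_self) ⟨h0, hδ⟩
  have hcl : IsClosed (Icc 0 t ∩ (fun t => dist (γ t) q) ⁻¹' {δ}) :=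
    (hcont.mono Icc_subset_Ici_self).preimage_isClosed_of_isClosed isClosed_Icc isClosed_singleton
  -- `T` is the first time on the sphere of radius `δ`. Up to then the curve is in the closed ball,
  -- so `h` puts it strictly inside at time `T`, a contradiction.
  obtain ⟨T, ⟨hT, hTδ⟩, hmin⟩ := (isCompact_Icc.of_isClosed_subset hcl
    inter_subset_left).exists_isLeast (hival t ht hlt.le)
  refine (h T hT.1 fun u hu => ?_).ne hTδ
  by_contra! hu'
  obtain ⟨s, hs, hsδ⟩ := hival u hu.1 hu'.le
  have hTs := hmin ⟨⟨hs.1, hs.2.trans (hu.2.trans hT.2)⟩, hsδ⟩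
  have : u = T := le_antisymm hu.2 (hTs.trans hs.2)
  rw [this] at hu'
  exact hu'.ne' hTδ

/-- A curve whose speed is at most `M e^{-κ t}` moves by at most `(M / κ) e^{-κ s}` after the time `s`. -/
theorem dist_le_of_exp_speed {γ γ' : ℝ → E} {M κ s T : ℝ} (hκ : 0 < κ) (hM : 0 ≤ M) (hsT : s ≤ T)
    (hγ : ∀ t ∈ Icc s T, HasDerivWithinAt γ (γ' t) (Icc s T) t)
    (hb : ∀ t ∈ Icc s T, ‖γ' t‖ ≤ M * Real.exp (-κ * t)) :
    dist (γ T) (γ s) ≤ M / κ * Real.exp (-κ * s) := by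
  have hB : ∀ t, HasDerivAt (fun t => M / κ * (Real.exp (-κ * s) - Real.exp (-κ * t)))
      (M * Real.exp (-κ * t)) t := fun t => by
    have h1 : HasDerivAt (fun t => Real.exp (-κ * t)) (Real.exp (-κ * t) * (-κ)) t := by
      simpa using ((hasDerivAt_id t).const_mul (-κ)).exp
    refine ((h1.const_sub _).const_mul (M / κ)).congr_deriv ?_
    field_simp
  have := image_norm_le_of_norm_deriv_right_le_deriv_boundary (f := fun t => γ t - γ s) (f' := γ')
    (a := s) (b := T)
    ((HasDerivWithinAt.continuousOn hγ).sub continuousOn_const)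
    (fun t ht => ((hγ t (Ico_subset_Icc_self ht)).sub_const _).mono_of_mem_nhdsWithin (by
      filter_upwards [Icc_mem_nhdsGE ht.2] with u hu using ⟨ht.1.trans hu.1, hu.2⟩))
    (by simp) hB (fun t ht => hb t (Ico_subset_Icc_self ht)) (right_mem_Icc.2 hsT)
  rw [dist_eq_norm]
  refine this.trans ?_
  have : 0 ≤ M / κ * Real.exp (-κ * T) := by positivity
  linarith

/-- Exponential decay from a differential inequality. -/
theorem le_mul_exp_of_hasDerivWithinAt {f f' : ℝ → ℝ} {κ T : ℝ} (hT : 0 ≤ T)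
    (hf : ∀ t ∈ Icc 0 T, HasDerivWithinAt f (f' t) (Icc 0 T) t)
    (hb : ∀ t ∈ Icc 0 T, f' t ≤ -κ * f t) : f T ≤ f 0 * Real.exp (-κ * T) := by
  have h1 : ∀ t, HasDerivAt (fun t => Real.exp (κ * t)) (Real.exp (κ * t) * κ) t := fun t => by
    simpa using ((hasDerivAt_id t).const_mul κ).exp
  have hd : ∀ t ∈ Icc 0 T, HasDerivWithinAt (fun t => f t * Real.exp (κ * t))
      (f' t * Real.exp (κ * t) + f t * (Real.exp (κ * t) * κ)) (Icc 0 T) t := fun t ht =>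
    (hf t ht).mul (h1 t).hasDerivWithinAt
  have := image_le_of_deriv_right_le_deriv_boundary (B := fun _ => f 0) (B' := fun _ => 0)
    (HasDerivWithinAt.continuousOn hd)
    (fun t ht => (hd t (Ico_subset_Icc_self ht)).mono_of_mem_nhdsWithin (by
      filter_upwards [Icc_mem_nhdsGE ht.2] with u hu using ⟨ht.1.trans hu.1, hu.2⟩))
    (by simp) continuousOn_const (fun t _ => hasDerivWithinAt_const _ _ _)
    (fun t ht => by
      have := hb t (Ico_subset_Icc_self ht)
      have he := Real.exp_pos (κ * t)
      nlinarith) (right_mem_Icc.2 hT)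
  have he := Real.exp_pos (κ * T)
  rw [neg_mul, Real.exp_neg, ← div_eq_mul_inv, le_div_iff₀ he]
  exact this

/-- A Lyapunov criterion for sinks. -/
theorem isSink_of_lyapunov [FiniteDimensional ℝ E] {V : E → E} {S R : Set E}
    (h : ∀ q₀ ∈ R, ∃ (W : E → E) (U : Set E) (Λ : E → ℝ) (C κ : ℝ), IsOpen U ∧ q₀ ∈ U ∧
      ContDiffOn ℝ 1 W U ∧ 0 < κ ∧ 0 ≤ C ∧ ContinuousOn Λ U ∧ Λ q₀ = 0 ∧
      (∀ q ∈ U ∩ S, V q = W q) ∧ (∀ q ∈ U, 0 ≤ Λ q) ∧ (∀ q ∈ U ∩ S, ‖W q‖ ≤ C * Real.sqrt (Λ q)) ∧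
      (∀ (T : ℝ) (γ : ℝ → E), 0 ≤ T → (∀ t ∈ Icc 0 T, γ t ∈ U ∧
        HasDerivWithinAt γ (W (γ t)) (Icc 0 T) t) → γ 0 ∈ S → γ T ∈ S) ∧
      (∀ (s : Set ℝ) (γ : ℝ → E) (t : ℝ), γ t ∈ U ∩ S → HasDerivWithinAt γ (W (γ t)) s t →
        ∃ l, HasDerivWithinAt (fun t => Λ (γ t)) l s t ∧ l ≤ -(2 * κ) * Λ (γ t)) ∧
      (∀ q ∈ U, q ∈ closure S → Λ q = 0 → q ∈ R)) : IsSink V S R := by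
  have : CompleteSpace E := FiniteDimensional.complete ℝ E
  intro q₀ hq₀ O hO
  obtain ⟨W, U, Λ, C, κ, hU, hqU, hW, hκ, hC, hΛ, hΛq, hVW, hΛ0, hWΛ, hinv, hdecay, hlim⟩ := h q₀ hq₀
  obtain ⟨δ, hδ, hball⟩ : ∃ δ > 0, Metric.closedBall q₀ (2 * δ) ⊆ U ∩ O := by
    obtain ⟨ε, hε, h1⟩ := Metric.nhds_basis_closedBall.mem_iff.1
      (Filter.inter_mem (hU.mem_nhds hqU) hO)
    exact ⟨ε / 2, by positivity, by rwa [mul_div_cancel₀ ε two_ne_zero]⟩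
  have hball1 : Metric.closedBall q₀ δ ⊆ U ∩ O :=
    (Metric.closedBall_subset_closedBall (by linarith)).trans hball
  let χ : ContDiffBump q₀ := ⟨δ, 2 * δ, hδ, by linarith⟩
  -- The cutoff makes the field globally Lipschitz and bounded, hence complete, without changing it
  -- on the ball of radius `δ` where the trajectories will be trapped.
  let W' : E → E := fun x => χ x • W x
  have hW'1 : ∀ x ∈ Metric.closedBall q₀ δ, W' x = W x := fun x hx => by
    simp [W', χ.one_of_mem_closedBall hx]
  have hsupp : HasCompactSupport W' := χ.hasCompactSupport.smul_right
  have hW' : ContDiff ℝ 1 W' := by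
    rw [contDiff_iff_contDiffAt]
    intro x
    by_cases hx : x ∈ Metric.closedBall q₀ (2 * δ)
    · exact χ.contDiffAt.smul (hW.contDiffAt (hU.mem_nhds (hball hx).1))
    · have : x ∈ (tsupport χ)ᶜ := by rw [χ.tsupport_eq]; exact hx
      have h0 : W' =ᶠ[𝓝 x] fun _ => 0 := by
        filter_upwards [(isClosed_tsupport χ).isOpen_compl.mem_nhds this] with y hy
        simp [W', image_eq_zero_of_notMem_tsupport hy]
      exact contDiffAt_const.congr_of_eventuallyEq h0
  obtain ⟨K, hK⟩ := hW'.lipschitzWith_of_hasCompactSupport hsupp (by simp)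
  obtain ⟨L, hL⟩ := hW'.continuous.bounded_above_of_compact_support hsupp
  have hΛc : ContinuousAt Λ q₀ := hΛ.continuousAt (hU.mem_nhds hqU)
  -- The first condition says that the total displacement `C √Λ / κ` cannot carry the curve out of
  -- the ball; the second makes the final constant independent of the starting point.
  have hsmall : ∀ᶠ q in 𝓝 q₀, dist q q₀ + C * Real.sqrt (Λ q) / κ < δ ∧ Real.sqrt (Λ q) ≤ 1 := by
    have hs : ContinuousAt (fun q => Real.sqrt (Λ q)) q₀ := hΛc.sqrt
    have h1 : ContinuousAt (fun q => dist q q₀ + C * Real.sqrt (Λ q) / κ) q₀ :=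
      (continuousAt_id.dist continuousAt_const).add ((hs.const_mul C).div_const κ)
    refine (h1.eventually_lt continuousAt_const (by simpa [hΛq] using hδ)).and
      ((hs.eventually_lt continuousAt_const (by simp [hΛq])).mono fun _ h => le_of_lt h)
  obtain ⟨O', hO', hO'2⟩ := Filter.eventually_iff_exists_mem.1 hsmall
  refine ⟨O', hO', C / κ, κ, hκ, fun q ⟨hqO', hqS⟩ => ?_⟩
  obtain ⟨hq1, hq2⟩ := hO'2 q hqO'
  set M := C * Real.sqrt (Λ q)
  have hM : 0 ≤ M := by positivity
  obtain ⟨γ, hγ0, hγ⟩ := exists_forward_trajectory hK hL q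
  -- Bootstrap: as long as the curve stays in the ball, `Λ` decays like `exp (-2κt)`, so the speed
  -- decays like `exp (-κt)`, and integrating the speed bounds the distance still to be covered.
  have key : ∀ T, 0 ≤ T → (∀ t ∈ Icc 0 T, dist (γ t) q₀ ≤ δ) →
      (∀ t ∈ Icc 0 T, γ t ∈ S) ∧ (∀ t ∈ Icc 0 T, Λ (γ t) ≤ Λ q * Real.exp (-(2 * κ) * t)) ∧
        ∀ t ∈ Icc 0 T, dist (γ T) (γ t) ≤ M / κ * Real.exp (-κ * t) := fun T hT hd => by
    have hU' : ∀ t ∈ Icc 0 T, γ t ∈ U := fun t ht => (hball1 (hd t ht)).1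
    have hγ' : ∀ t ∈ Icc 0 T, HasDerivWithinAt γ (W (γ t)) (Ici 0) t := fun t ht => by
      rw [← hW'1 _ (hd t ht)]; exact hγ t ht.1
    have hS : ∀ t ∈ Icc 0 T, γ t ∈ S := fun t ht =>
      hinv t γ ht.1 (fun s hs => ⟨hU' s ⟨hs.1, hs.2.trans ht.2⟩,
        (hγ' s ⟨hs.1, hs.2.trans ht.2⟩).mono Icc_subset_Ici_self⟩) (hγ0 ▸ hqS)
    have hΛt : ∀ t ∈ Icc 0 T, Λ (γ t) ≤ Λ q * Real.exp (-(2 * κ) * t) := fun t ht => by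
      have hex : ∀ s, ∃ l, s ∈ Icc 0 t → HasDerivWithinAt (fun t => Λ (γ t)) l (Icc 0 t) s ∧
          l ≤ -(2 * κ) * Λ (γ s) := fun s => by
        by_cases hs : s ∈ Icc 0 t
        · have hsT : s ∈ Icc 0 T := ⟨hs.1, hs.2.trans ht.2⟩
          obtain ⟨l, hl⟩ := hdecay (Icc 0 t) γ s ⟨hU' s hsT, hS s hsT⟩
            ((hγ' s hsT).mono Icc_subset_Ici_self)
          exact ⟨l, fun _ => hl⟩
        · exact ⟨0, fun h => absurd h hs⟩
      choose l hl using hex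
      have := le_mul_exp_of_hasDerivWithinAt ht.1 (fun s hs => (hl s hs).1) (fun s hs => (hl s hs).2)
      rwa [hγ0] at this
    refine ⟨hS, hΛt, fun t ht => ?_⟩
    have hsub : Icc t T ⊆ Icc 0 T := Icc_subset_Icc_left ht.1
    refine dist_le_of_exp_speed hκ hM ht.2
      (fun s hs => (hγ' s (hsub hs)).mono (hsub.trans Icc_subset_Ici_self)) fun s hs => ?_
    refine (hWΛ _ ⟨hU' s (hsub hs), hS s (hsub hs)⟩).trans ?_
    rw [mul_assoc]
    refine mul_le_mul_of_nonneg_left ?_ hC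
    refine (Real.sqrt_le_sqrt (hΛt s (hsub hs))).trans (le_of_eq ?_)
    rw [Real.sqrt_mul (hΛ0 q (hγ0 ▸ hU' 0 ⟨le_rfl, hT⟩)), show -(2 * κ) * s = -κ * s + -κ * s by ring,
      Real.exp_add, Real.sqrt_mul_self (Real.exp_pos _).le]
  have hγc : ContinuousOn γ (Ici 0) := fun t ht => (hγ t ht).continuousWithinAt
  have hin : ∀ t, 0 ≤ t → dist (γ t) q₀ ≤ δ := fun t ht => by
    refine mem_closedBall_of_trapped hγc (fun T hT hd => ?_) ?_ ht
    · have h1 := (key T hT hd).2.2 0 ⟨le_rfl, hT⟩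
      rw [hγ0] at h1
      have h2 := dist_triangle (γ T) q q₀
      simp only [mul_zero, Real.exp_zero, mul_one] at h1
      linarith
    · rw [hγ0]
      have : 0 ≤ M / κ := by positivity
      linarith
  have hS : ∀ t, 0 ≤ t → γ t ∈ S := fun t ht =>
    (key t ht fun s hs => hin s hs.1).1 t ⟨ht, le_rfl⟩
  have hdist : ∀ s t, 0 ≤ s → s ≤ t → dist (γ t) (γ s) ≤ M / κ * Real.exp (-κ * s) :=
    fun s t hs hst => (key t (hs.trans hst) fun u hu => hin u hu.1).2.2 s ⟨hs, hst⟩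
  have hexp : Tendsto (fun s : ℝ => Real.exp (-κ * s)) atTop (𝓝 0) :=
    Real.tendsto_exp_atBot.comp ((tendsto_id).const_mul_atTop_of_neg (by linarith))
  -- The displacement after time `s` is O(`exp (-κs)`), so the curve has a limit; `Λ` vanishes
  -- there.
  have hcau : Cauchy (map γ atTop) := by
    rw [Metric.cauchy_iff]
    refine ⟨inferInstance, fun ε hε => ?_⟩
    have h1 : Tendsto (fun s : ℝ => M / κ * Real.exp (-κ * s)) atTop (𝓝 0) := by
      simpa using hexp.const_mul (M / κ)
    obtain ⟨s, hs, hs0⟩ := ((h1.eventually (gt_mem_nhds (half_pos hε))).and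
      (eventually_ge_atTop 0)).exists
    refine ⟨γ '' Ici s, image_mem_map (Ici_mem_atTop s), ?_⟩
    rintro _ ⟨t, ht, rfl⟩ _ ⟨u, hu, rfl⟩
    have := hdist s t hs0 ht
    have := hdist s u hs0 hu
    have := dist_triangle_right (γ t) (γ u) (γ s)
    linarith
  obtain ⟨q₁, hq₁⟩ := CompleteSpace.complete hcau
  have hq₁ : Tendsto γ atTop (𝓝 q₁) := hq₁
  have hq₁d : dist q₁ q₀ ≤ δ := le_of_tendsto (hq₁.dist tendsto_const_nhds)
    ((eventually_ge_atTop 0).mono hin)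
  have hq₁U : q₁ ∈ U := (hball1 hq₁d).1
  have hΛ₁ : Λ q₁ = 0 := by
    have h1 : Tendsto (fun t => Λ (γ t)) atTop (𝓝 (Λ q₁)) :=
      (hΛ.continuousAt (hU.mem_nhds hq₁U)).tendsto.comp hq₁
    have h2 : Tendsto (fun t => Λ q * Real.exp (-(2 * κ) * t)) atTop (𝓝 0) := by
      have : Tendsto (fun s : ℝ => Real.exp (-(2 * κ) * s)) atTop (𝓝 0) :=
        Real.tendsto_exp_atBot.comp ((tendsto_id).const_mul_atTop_of_neg (by linarith))
      simpa using this.const_mul (Λ q)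
    refine le_antisymm (le_of_tendsto_of_tendsto h1 h2 ?_) (hΛ0 q₁ hq₁U)
    filter_upwards [eventually_ge_atTop 0] with t ht
    exact (key t ht fun s hs => hin s hs.1).2.1 t ⟨ht, le_rfl⟩
  refine ⟨γ, hγ0, fun s hs => ⟨⟨hS s hs, (hball1 (hin s hs)).2⟩, ?_⟩, q₁, ?_, fun s hs => ?_⟩
  · rw [hVW _ ⟨(hball1 (hin s hs)).1, hS s hs⟩, ← hW'1 _ (hin s hs)]
    exact hγ s hs
  -- The set `S` is not assumed closed, so the limit is only known to lie in its closure; `hlim` is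
  -- stated accordingly.
  · exact hlim q₁ hq₁U (mem_closure_of_tendsto hq₁ ((eventually_ge_atTop 0).mono hS)) hΛ₁
  · rw [dist_comm]
    have h1 : dist q₁ (γ s) ≤ M / κ * Real.exp (-κ * s) :=
      le_of_tendsto (hq₁.dist tendsto_const_nhds)
        ((eventually_ge_atTop s).mono fun t ht => hdist s t hs ht)
    refine h1.trans ?_
    gcongr
    exact mul_le_of_le_one_right hC hq2

end Flows
end NonrelKG

noncomputable section
namespace NonrelKG

variable {d : ℕ}

/-! ### The radial compactification -/

theorem bracket_pos (z : Spacetime d) : 0 < bracket z := Real.sqrt_pos.2 (by positivity)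

theorem bracket_sq (z : Spacetime d) : bracket z ^ 2 = 1 + ‖z‖ ^ 2 := Real.sq_sqrt (by positivity)

theorem baseEmbed_fst_pos (z : Spacetime d) : 0 < (baseEmbed z).1 := inv_pos.2 (bracket_pos z)

theorem baseEmbed_norm (z : Spacetime d) : (baseEmbed z).1 ^ 2 + ‖(baseEmbed z).2‖ ^ 2 = 1 := by
  have h := bracket_pos z
  have h2 := bracket_sq z
  simp only [baseEmbed, norm_smul, norm_inv, Real.norm_eq_abs, abs_of_pos h]
  field_simp
  linarith

theorem baseEmbed_mem (z : Spacetime d) : baseEmbed z ∈ baseSpace d :=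
  ⟨(baseEmbed_fst_pos z).le, baseEmbed_norm z⟩

theorem baseEmbed_inv_smul {m : BaseAmbient d} (hm : m.1 ^ 2 + ‖m.2‖ ^ 2 = 1) (h0 : 0 < m.1) :
    baseEmbed (m.1⁻¹ • m.2) = m := by
  have hb : bracket (m.1⁻¹ • m.2) = m.1⁻¹ := by
    rw [bracket, Real.sqrt_eq_iff_mul_self_eq (by positivity) (inv_pos.2 h0).le]
    rw [norm_smul, norm_inv, Real.norm_eq_abs, abs_of_pos h0]
    field_simp
    rw [hm]
  ext1
  · simp [baseEmbed, hb]
  · simp [baseEmbed, hb, smul_smul, h0.ne']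

@[simp] theorem natFreq_zero (h : ℝ) (ζ : Spacetime d) : natFreq h ζ 0 = h ^ 2 * ζ 0 := rfl

@[simp] theorem natFreq_succ (h : ℝ) (ζ : Spacetime d) (j : Fin d) :
    natFreq h ζ j.succ = h * ζ j.succ := rfl

/-! ### The inverse of the metric -/

/-- The signs of the Minkowski metric. -/
def minkowskiSign (i : Fin (d + 1)) : ℝ := Fin.cons (α := fun _ => ℝ) (-1) (fun _ => 1) i

@[simp] theorem minkowskiSign_zero : minkowskiSign (0 : Fin (d + 1)) = -1 := rfl

@[simp] theorem minkowskiSign_succ (j : Fin d) : minkowskiSign j.succ = 1 := rfl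

theorem minkowskiSign_mul_self (i : Fin (d + 1)) : minkowskiSign i * minkowskiSign i = 1 := by
  refine Fin.cases ?_ (fun j => ?_) i <;> simp

theorem contDiffOn_det {E : Type*} [NormedAddCommGroup E] [NormedSpace ℝ E] {n : ℕ} {U : Set E}
    {M : E → Matrix (Fin n) (Fin n) ℝ} (hM : ∀ i j, ContDiffOn ℝ ∞ (fun x => M x i j) U) :
    ContDiffOn ℝ ∞ (fun x => (M x).det) U := by
  simp only [Matrix.det_apply]
  exact ContDiffOn.sum fun τ _ => (contDiffOn_prod fun i _ => hM _ _).const_smul _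

/-- Cramer's rule: the entries of the adjugate are determinants. -/
theorem contDiffOn_matrix_inv {E : Type*} [NormedAddCommGroup E] [NormedSpace ℝ E] {n : ℕ} {U : Set E}
    {M : E → Matrix (Fin n) (Fin n) ℝ} (hM : ∀ i j, ContDiffOn ℝ ∞ (fun x => M x i j) U)
    (hdet : ∀ x ∈ U, (M x).det ≠ 0) (i j : Fin n) : ContDiffOn ℝ ∞ (fun x => (M x)⁻¹ i j) U := by
  simp only [Matrix.inv_def, Ring.inverse_eq_inv', Matrix.smul_apply, Matrix.adjugate_apply, smul_eq_mul]
  refine ((contDiffOn_det hM).inv hdet).mul (contDiffOn_det fun k l => ?_)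
  by_cases hk : k = j
  · subst hk; simp only [Matrix.updateRow_self]; exact contDiffOn_const
  · simp only [Matrix.updateRow_ne hk]; exact hM k l

/-- The deviation of the rescaled metric from the Minkowski metric, in terms of the coefficients. -/
def deviationMatrix (a : ℝ) (w : Fin d → ℝ) (k : Fin d → Fin d → ℝ) :
    Matrix (Fin (d + 1)) (Fin (d + 1)) ℝ :=
  Matrix.of (Fin.cons (Fin.cons a fun j => w j / 2)
    fun i => Fin.cons (w i / 2) fun j => (k i j + k j i) / 2)

theorem deviationMatrix_isSymm (a : ℝ) (w : Fin d → ℝ) (k : Fin d → Fin d → ℝ) (i j : Fin (d + 1)) :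
    deviationMatrix a w k i j = deviationMatrix a w k j i := by
  refine Fin.cases ?_ (fun i => ?_) i <;> refine Fin.cases ?_ (fun j => ?_) j <;>
    simp [deviationMatrix, add_comm]

theorem deviationMatrix_contDiffOn {E : Type*} [NormedAddCommGroup E] [NormedSpace ℝ E] {U : Set E}
    {a : E → ℝ} {w : Fin d → E → ℝ} {k : Fin d → Fin d → E → ℝ} (ha : ContDiffOn ℝ ∞ a U)
    (hw : ∀ j, ContDiffOn ℝ ∞ (w j) U) (hk : ∀ i j, ContDiffOn ℝ ∞ (k i j) U) (i j : Fin (d + 1)) :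
    ContDiffOn ℝ ∞ (fun x => deviationMatrix (a x) (fun j => w j x) (fun i j => k i j x) i j) U := by
  refine Fin.cases ?_ (fun i => ?_) i <;> refine Fin.cases ?_ (fun j => ?_) j
  · simpa [deviationMatrix] using ha
  · simpa [deviationMatrix] using (hw j).div_const 2
  · simpa [deviationMatrix] using (hw i).div_const 2
  · simpa [deviationMatrix] using ((hk i j).add (hk j i)).div_const 2

theorem IsLorentzian.det_ne_zero {A : Matrix (Fin (d + 1)) (Fin (d + 1)) ℝ} (hA : IsLorentzian A) :
    A.det ≠ 0 := by
  obtain ⟨Q, -, h⟩ := hA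
  intro h0
  have := congrArg Matrix.det h
  simp [Matrix.det_mul, h0, Fin.prod_univ_succ] at this

/-- The smooth structure of the inverse metric: in the natural frequencies it is the Minkowski metric up to
a perturbation that vanishes at `h = 0` and at spacetime infinity. -/
theorem exists_inverse_metric
    {α : ℝ → Spacetime d → ℝ} {w : Fin d → ℝ → Spacetime d → ℝ}
    {k : Fin d → Fin d → ℝ → Spacetime d → ℝ}
    (hα : IsClassicalFamily α) (hw : ∀ j, IsClassicalFamily (w j))
    (hk : ∀ i j, IsClassicalFamily (k i j)) (hsymm : ∀ i j, k i j = k j i)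
    (hLor : ∀ h ∈ Ioo (0 : ℝ) 1, ∀ z : Spacetime d, IsLorentzian (metricMatrix α w k h z)) (σ : ℝ) :
    ∃ (N : ℝ × BaseAmbient d → Matrix (Fin (d + 1)) (Fin (d + 1)) ℝ) (Ω : Set (ℝ × BaseAmbient d)),
      IsOpen Ω ∧ Ico (0 : ℝ) 1 ×ˢ baseSpace d ⊆ Ω ∧
      (∀ i j, ContDiffOn ℝ ∞ (fun x => N x i j) Ω) ∧ (∀ x i j, N x i j = N x j i) ∧
      (∀ x ∈ Ico (0 : ℝ) 1 ×ˢ baseSpace d, ∀ u : Fin (d + 1) → ℝ,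
        (∀ i, minkowskiSign i * u i + x.1 ^ 2 * x.2.1 * ∑ j, N x i j * u j = 0) → u = 0) ∧
      ∀ h ∈ Ioo (0 : ℝ) 1, ∀ z ζ : Spacetime d,
        symbol (metricMatrix α w k) σ h z ζ = (h ^ 2)⁻¹ *
          (-((∑ i, minkowskiSign i * natFreq h ζ i ^ 2) + h ^ 2 * (bracket z)⁻¹ *
            ∑ i, ∑ j, N (h, baseEmbed z) i j * natFreq h ζ i * natFreq h ζ j)
            + 2 * σ * natFreq h ζ 0) := by
  obtain ⟨Gα, ⟨Uα, Gα', hUα, hXα, hGα, hEα⟩, hα⟩ := hα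
  choose Gw hw using hw
  choose hw hw' using hw
  choose Uw Gw' hUw hXw hGw hEw using hw
  choose Gk hk using hk
  choose hk hk' using hk
  choose Uk Gk' hUk hXk hGk hEk using hk
  set U : Set (ℝ × BaseAmbient d) := Uα ∩ ((⋂ j, Uw j) ∩ ⋂ i, ⋂ j, Uk i j) with hU
  have hUo : IsOpen U := hUα.inter ((isOpen_iInter_of_finite hUw).inter
    (isOpen_iInter_of_finite fun i => isOpen_iInter_of_finite fun j => hUk i j))
  have hXU : Ico (0 : ℝ) 1 ×ˢ baseSpace d ⊆ U := fun x hx =>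
    ⟨hXα hx, mem_iInter.2 fun j => hXw j hx, mem_iInter.2 fun i => mem_iInter.2 fun j => hXk i j hx⟩
  -- The smooth extensions of kᵢⱼ and kⱼᵢ need agree only on `[0, 1) × 𝕄`. Since `deviationMatrix`
  -- averages them, `K` is symmetric everywhere.
  let K : ℝ × BaseAmbient d → Matrix (Fin (d + 1)) (Fin (d + 1)) ℝ := fun x =>
    deviationMatrix (Gα' x) (fun j => Gw' j x) (fun i j => Gk' i j x)
  have hK : ∀ i j, ContDiffOn ℝ ∞ (fun x => K x i j) U :=
    deviationMatrix_contDiffOn (hGα.mono fun x hx => hx.1)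
      (fun j => (hGw j).mono fun x hx => mem_iInter.1 hx.2.1 j)
      (fun i j => (hGk i j).mono fun x hx => mem_iInter.1 (mem_iInter.1 hx.2.2 i) j)
  let η : Matrix (Fin (d + 1)) (Fin (d + 1)) ℝ := Matrix.diagonal minkowskiSign
  have hηη : η * η = 1 := by
    simp only [η, Matrix.diagonal_mul_diagonal, minkowskiSign_mul_self]; exact Matrix.diagonal_one
  let M : ℝ × BaseAmbient d → Matrix (Fin (d + 1)) (Fin (d + 1)) ℝ := fun x =>
    η + (x.1 ^ 2 * x.2.1) • K x
  have hM : ∀ i j, ContDiffOn ℝ ∞ (fun x => M x i j) U := fun i j => by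
    have : ContDiff ℝ ∞ fun x : ℝ × BaseAmbient d => x.1 ^ 2 * x.2.1 := by fun_prop
    exact contDiffOn_const.add (this.contDiffOn.mul (hK i j))
  have hMsymm : ∀ x, (M x).transpose = M x := fun x => by
    ext i j
    simp only [M, Matrix.transpose_apply, Matrix.add_apply, Matrix.smul_apply]
    rw [show K x j i = K x i j from deviationMatrix_isSymm _ _ _ _ _]
    congr 1
    simp only [η, ← Matrix.transpose_apply (Matrix.diagonal minkowskiSign) i j, Matrix.diagonal_transpose]
  -- Conjugation with diag(h, 1, …, 1) passes to natural frequencies. The powers of h in the metric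
  -- are such that every perturbation entry acquires the same factor h²⟨z⟩⁻¹.
  have hdiag : ∀ h ∈ Ioo (0 : ℝ) 1, ∀ z, M (h, baseEmbed z) =
      Matrix.diagonal (Fin.cons h fun _ => 1) * metricMatrix α w k h z *
        Matrix.diagonal (Fin.cons h fun _ => 1) := fun h hh z => by
    have hx : (h, baseEmbed z) ∈ Ico (0 : ℝ) 1 ×ˢ baseSpace d :=
      ⟨⟨hh.1.le, hh.2⟩, baseEmbed_mem z⟩
    have hIco : h ∈ Ico (0 : ℝ) 1 := ⟨hh.1.le, hh.2⟩
    have h0 := hh.1.ne'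
    have hfst : (baseEmbed z).1 = (bracket z)⁻¹ := rfl
    ext i j
    simp only [Matrix.diagonal_mul, Matrix.mul_diagonal]
    refine Fin.cases ?_ (fun i => ?_) i <;> refine Fin.cases ?_ (fun j => ?_) j
    · simp [M, K, η, deviationMatrix, metricMatrix, hα h hIco, ← hEα hx, hfst]
      field_simp
    · simp [M, K, η, deviationMatrix, metricMatrix, hw' j h hIco, ← hEw j hx, hfst,
        Matrix.diagonal_apply_ne _ (Fin.succ_ne_zero j).symm]
      field_simp
    · simp [M, K, η, deviationMatrix, metricMatrix, hw' i h hIco, ← hEw i hx, hfst]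
      field_simp
    · have h2 : Gk i j (h, baseEmbed z) = Gk j i (h, baseEmbed z) := by
        have := congrFun (congrFun (hsymm i j) h) z
        rw [hk' i j h hIco, hk' j i h hIco] at this
        exact mul_left_cancel₀ (inv_ne_zero (bracket_pos z).ne') this
      simp [M, K, η, deviationMatrix, metricMatrix, ← hEk i j hx, ← hEk j i hx, hfst,
        Matrix.diagonal_apply, hk' i j h hIco, ← h2]
      ring
  -- Either h²m = 0 and `M` is the Minkowski matrix, or the point is interior and `M` is congruent
  -- to a Lorentzian matrix.
  have hdet : ∀ x ∈ Ico (0 : ℝ) 1 ×ˢ baseSpace d, (M x).det ≠ 0 := by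
    rintro ⟨h, m⟩ ⟨hh, hm⟩
    by_cases ht : h ^ 2 * m.1 = 0
    · simp [M, ht, η, Fin.prod_univ_succ]
    · have h0 : 0 < h := lt_of_le_of_ne hh.1 fun h0 => ht (by simp [← h0])
      have hm0 : 0 < m.1 := lt_of_le_of_ne hm.1 fun h0 => ht (by simp [← h0])
      rw [← baseEmbed_inv_smul (m := m) hm.2 hm0, hdiag h ⟨h0, hh.2⟩]
      simp [Matrix.det_mul, Fin.prod_univ_succ, h0.ne', (hLor h ⟨h0, hh.2⟩ _).det_ne_zero]
  let Ω : Set (ℝ × BaseAmbient d) := U ∩ (fun x => (M x).det) ⁻¹' {0}ᶜ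
  have hΩo : IsOpen Ω := (contDiffOn_det hM).continuousOn.isOpen_inter_preimage hUo isOpen_compl_singleton
  have hΩdet : ∀ x ∈ Ω, (M x).det ≠ 0 := fun x hx => hx.2
  -- With t = h²m one has M⁻¹ = η(M - tK)M⁻¹ = η - tηKM⁻¹, which divides the perturbation of the
  -- inverse by t smoothly.
  let N₀ : ℝ × BaseAmbient d → Matrix (Fin (d + 1)) (Fin (d + 1)) ℝ := fun x => -(η * K x * (M x)⁻¹)
  have hinv : ∀ x ∈ Ω, (M x)⁻¹ = η + (x.1 ^ 2 * x.2.1) • N₀ x := fun x hx => by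
    have hu : IsUnit (M x).det := (hΩdet x hx).isUnit
    refine Matrix.inv_eq_left_inv ?_
    rw [add_mul, smul_mul_assoc, Matrix.neg_mul, Matrix.mul_assoc, Matrix.nonsing_inv_mul _ hu,
      Matrix.mul_one, smul_neg, ← Matrix.mul_smul, ← sub_eq_add_neg, ← Matrix.mul_sub]
    simp [M, hηη]
  -- Symmetry of M⁻¹ controls only t`N₀`. Averaging with the transpose gives symmetry at every point
  -- and leaves t`N₀` unchanged on `Ω`.
  let N : ℝ × BaseAmbient d → Matrix (Fin (d + 1)) (Fin (d + 1)) ℝ := fun x =>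
    (2⁻¹ : ℝ) • (N₀ x + (N₀ x).transpose)
  have hinv' : ∀ x ∈ Ω, (M x)⁻¹ = η + (x.1 ^ 2 * x.2.1) • N x := fun x hx => by
    have h1 := hinv x hx
    have h2 : ((M x)⁻¹).transpose = (M x)⁻¹ := by rw [Matrix.transpose_nonsing_inv, hMsymm]
    rw [h1, Matrix.transpose_add, Matrix.transpose_smul, Matrix.diagonal_transpose] at h2
    have h3 := add_left_cancel h2
    rw [h1, smul_comm, smul_add, h3, ← two_smul ℝ, smul_smul]
    norm_num
  refine ⟨N, Ω, hΩo, fun x hx => ⟨hXU hx, hdet x hx⟩, fun i j => ?_, fun x i j => ?_, ?_, ?_⟩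
  · have hN₀ : ∀ i j, ContDiffOn ℝ ∞ (fun x => N₀ x i j) Ω := fun i j => by
      simp only [N₀, Matrix.neg_apply, Matrix.mul_apply]
      refine (ContDiffOn.sum fun l _ => ContDiffOn.mul (ContDiffOn.sum fun m _ =>
        contDiffOn_const.mul ((hK m l).mono inter_subset_left)) ?_).neg
      exact contDiffOn_matrix_inv (fun i j => (hM i j).mono inter_subset_left) hΩdet l j
    simp only [N, Matrix.smul_apply, Matrix.add_apply, Matrix.transpose_apply]
    exact ((hN₀ i j).add (hN₀ j i)).const_smul _
  · simp [N, add_comm]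
  · intro x hx u hu
    have hu' : IsUnit (M x).det := (hdet x hx).isUnit
    have h1 : (M x)⁻¹.mulVec u = 0 := by
      rw [hinv' x ⟨hXU hx, hdet x hx⟩]
      ext i
      rw [Matrix.add_mulVec, Matrix.smul_mulVec, Pi.add_apply, Pi.smul_apply, Matrix.mulVec_diagonal]
      exact hu i
    have h2 := congrArg (M x).mulVec h1
    rwa [Matrix.mulVec_mulVec, Matrix.mul_nonsing_inv _ hu', Matrix.one_mulVec, Matrix.mulVec_zero] at h2
  · intro h hh z ζ
    have hx : (h, baseEmbed z) ∈ Ico (0 : ℝ) 1 ×ˢ baseSpace d :=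
      ⟨⟨hh.1.le, hh.2⟩, baseEmbed_mem z⟩
    have h0 := hh.1.ne'
    let D : Fin (d + 1) → ℝ := Fin.cons h fun _ => 1
    have hDdet : IsUnit (Matrix.diagonal D).det := by simp [D, Fin.prod_univ_succ, h0]
    have hg : (metricMatrix α w k h z)⁻¹ = Matrix.diagonal D * (M (h, baseEmbed z))⁻¹ * Matrix.diagonal D := by
      rw [hdiag h hh z, Matrix.mul_inv_rev, Matrix.mul_inv_rev, Matrix.mul_nonsing_inv_cancel_left _ _ hDdet,
        Matrix.nonsing_inv_mul_cancel_right _ _ hDdet]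
    have hDζ : ∀ i, natFreq h ζ i = h * (D i * ζ i) := fun i => by
      refine Fin.cases ?_ (fun i => ?_) i
      · simp [D]; ring
      · simp [D]
    have hsum : ∑ i, ∑ j, (metricMatrix α w k h z)⁻¹ i j * ζ i * ζ j = (h ^ 2)⁻¹ *
        ((∑ i, minkowskiSign i * natFreq h ζ i ^ 2) + h ^ 2 * (bracket z)⁻¹ *
            ∑ i, ∑ j, N (h, baseEmbed z) i j * natFreq h ζ i * natFreq h ζ j) := by
      rw [Finset.mul_sum, ← Finset.sum_add_distrib, Finset.mul_sum]
      refine Finset.sum_congr rfl fun i _ => ?_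
      have hdi : minkowskiSign i * natFreq h ζ i ^ 2 =
          ∑ j, Matrix.diagonal minkowskiSign i j * natFreq h ζ i * natFreq h ζ j := by
        rw [Finset.sum_eq_single i (fun j _ hj => by rw [Matrix.diagonal_apply_ne' _ hj]; ring) (by simp),
          Matrix.diagonal_apply_eq]; ring
      rw [hdi, Finset.mul_sum, ← Finset.sum_add_distrib, Finset.mul_sum]
      refine Finset.sum_congr rfl fun j _ => ?_
      rw [hg, Matrix.mul_diagonal, Matrix.diagonal_mul, hinv' _ ⟨hXU hx, hdet _ hx⟩]
      simp only [Matrix.add_apply, Matrix.smul_apply, smul_eq_mul, hDζ, η]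
      simp only [baseEmbed]
      field_simp
    rw [symbol, hsum, natFreq_zero]
    field_simp

end NonrelKG
end

noncomputable section
namespace NonrelKG

variable {d : ℕ}

/-! ### Time and space components -/

/-- The spatial part as a continuous linear map. -/
def spatialCLM (d : ℕ) : Spacetime d →L[ℝ] EuclideanSpace ℝ (Fin d) :=
  LinearMap.toContinuousLinearMap
    { toFun := spatial
      map_add' := fun x y => by ext; simp [spatial]
      map_smul' := fun c x => by ext; simp [spatial] }

/-- The assembling of time and space components as a continuous linear map. -/
def spacetimeVecCLM (d : ℕ) : ℝ × EuclideanSpace ℝ (Fin d) →L[ℝ] Spacetime d :=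
  LinearMap.toContinuousLinearMap
    { toFun := fun x => spacetimeVec x.1 x.2
      map_add' := fun x y => by
        ext i; refine Fin.cases ?_ (fun j => ?_) i <;> simp [spacetimeVec]
      map_smul' := fun c x => by
        ext i; refine Fin.cases ?_ (fun j => ?_) i <;> simp [spacetimeVec] }

@[simp] theorem spatial_smul (c : ℝ) (x : Spacetime d) : spatial (c • x) = c • spatial x :=
  (spatialCLM d).map_smul c x

@[simp] theorem spatial_sub (x y : Spacetime d) : spatial (x - y) = spatial x - spatial y :=
  (spatialCLM d).map_sub x y

@[simp] theorem spatial_apply (x : Spacetime d) (j : Fin d) : spatial x j = x j.succ := rfl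

@[simp] theorem spacetimeVec_zero (τ : ℝ) (ξ : EuclideanSpace ℝ (Fin d)) : spacetimeVec τ ξ 0 = τ := rfl

@[simp] theorem spacetimeVec_succ (τ : ℝ) (ξ : EuclideanSpace ℝ (Fin d)) (j : Fin d) :
    spacetimeVec τ ξ j.succ = ξ j := rfl

@[simp] theorem spatial_spacetimeVec (τ : ℝ) (ξ : EuclideanSpace ℝ (Fin d)) :
    spatial (spacetimeVec τ ξ) = ξ := rfl

theorem spacetime_ext {x y : Spacetime d} (h0 : x 0 = y 0) (h1 : spatial x = spatial y) : x = y := by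
  ext i
  refine Fin.cases h0 (fun j => ?_) i
  exact congrArg (fun v : EuclideanSpace ℝ (Fin d) => v j) h1

theorem inner_spacetime (x y : Spacetime d) :
    inner ℝ x y = x 0 * y 0 + inner ℝ (spatial x) (spatial y) := by
  simp [PiLp.inner_apply, Fin.sum_univ_succ, mul_comm]

theorem norm_sq_spacetime (x : Spacetime d) : ‖x‖ ^ 2 = x 0 ^ 2 + ‖spatial x‖ ^ 2 := by
  rw [← real_inner_self_eq_norm_sq, ← real_inner_self_eq_norm_sq, inner_spacetime, sq]

theorem sum_minkowskiSign_mul_sq (x : Spacetime d) :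
    ∑ i, minkowskiSign i * x i ^ 2 = -x 0 ^ 2 + ‖spatial x‖ ^ 2 := by
  rw [Fin.sum_univ_succ, EuclideanSpace.norm_sq_eq]
  simp

theorem hasDerivAt_spatial {f : ℝ → Spacetime d} {f' : Spacetime d} {s : Set ℝ} {t : ℝ}
    (hf : HasDerivWithinAt f f' s t) : HasDerivWithinAt (fun t => spatial (f t)) (spatial f') s t :=
  (spatialCLM d).hasFDerivAt.comp_hasDerivWithinAt t hf

theorem hasDerivAt_time {f : ℝ → Spacetime d} {f' : Spacetime d} {s : Set ℝ} {t : ℝ}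
    (hf : HasDerivWithinAt f f' s t) (i : Fin (d + 1)) : HasDerivWithinAt (fun t => f t i) (f' i) s t :=
  (EuclideanSpace.proj (𝕜 := ℝ) i : Spacetime d →L[ℝ] ℝ).hasFDerivAt.comp_hasDerivWithinAt t hf

/-! ### The rescaled symbol and Hamiltonian vector field -/

/-- The lift to the hemisphere of the scattering vector field with coefficients `v`, divided by the boundary
defining function `m.1`. -/
def sphereField (m : BaseAmbient d) (v : Spacetime d) : BaseAmbient d :=
  (-(m.1 * inner ℝ v m.2), v - inner ℝ v m.2 • m.2)

theorem sphereField_smul (m : BaseAmbient d) (c : ℝ) (v : Spacetime d) :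
    sphereField m (c • v) = c • sphereField m v := by
  ext1
  · simp only [sphereField, inner_smul_left, Prod.smul_fst, smul_eq_mul]
    simp; ring
  · simp only [sphereField, inner_smul_left, Prod.smul_snd, smul_sub, smul_smul]
    simp

theorem sphereField_add (m : BaseAmbient d) (v w : Spacetime d) :
    sphereField m (v + w) = sphereField m v + sphereField m w := by
  ext1
  · simp only [sphereField, inner_add_left, Prod.fst_add]; ring
  · simp only [sphereField, inner_add_left, Prod.snd_add, add_smul]; abel

/-- The arguments `(h, m)` of the metric coefficients. -/
def metricArg (q : Ambient d) : ℝ × BaseAmbient d := (pfFun q * nfFun q, q.1)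

/-- The natural frequency in the blowup: `pfFun q • blowFreq q` is the compactified one. -/
def blowFreq (q : Ambient d) : Spacetime d := spacetimeVec (pfFun q * timeFun q) (spaceFun q)

variable (N : ℝ × BaseAmbient d → Matrix (Fin (d + 1)) (Fin (d + 1)) ℝ)

/-- The quadratic form of the perturbation of the metric. -/
def pertQuad (x : ℝ × BaseAmbient d) (u : Spacetime d) : ℝ := ∑ i, ∑ j, N x i j * u i * u j

/-- The inverse metric at `x`, applied to the covector `u`. -/
def raise (x : ℝ × BaseAmbient d) (u : Spacetime d) : Spacetime d :=
  WithLp.toLp 2 fun i => minkowskiSign i * u i + x.1 ^ 2 * x.2.1 * ∑ j, N x i j * u j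

/-- The rescaled symbol, up to boundary defining functions. -/
def resSymbol (σ : ℝ) (q : Ambient d) : ℝ :=
  -((∑ i, minkowskiSign i * blowFreq q i ^ 2) + (pfFun q * nfFun q) ^ 2 * bfFun q *
    pertQuad N (metricArg q) (blowFreq q)) + 2 * σ * timeFun q * dfFun q

/-- The rescaled velocity in spacetime. -/
def velocity (σ : ℝ) (q : Ambient d) : Spacetime d :=
  spacetimeVec (nfFun q * (σ * dfFun q - pfFun q * raise N (metricArg q) (blowFreq q) 0))
    (-spatial (raise N (metricArg q) (blowFreq q)))

/-- The derivative of `m.1 * pertQuad` in the direction of `v`, divided by `2 * m.1`. -/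
def forceForm (x : ℝ × BaseAmbient d) (u v : Spacetime d) : ℝ :=
  2⁻¹ * (-(inner ℝ v x.2.2 * pertQuad N x u) +
    ∑ i, ∑ j, fderiv ℝ (fun y => N y i j) x (0, sphereField x.2 v) * u i * u j)

/-- The vector that represents `forceForm`. -/
def force (x : ℝ × BaseAmbient d) (u : Spacetime d) : Spacetime d :=
  WithLp.toLp 2 fun i => forceForm N x u (EuclideanSpace.single i 1)

/-- The rescaled force in the natural frequencies. -/
def natForce (q : Ambient d) : Spacetime d :=
  spacetimeVec (nfFun q ^ 2 * (pfFun q * nfFun q * force N (metricArg q) (blowFreq q) 0))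
    (nfFun q ^ 2 • spatial (force N (metricArg q) (blowFreq q)))

/-- The power of the force. -/
def power (q : Ambient d) (φ : Spacetime d) : ℝ := inner ℝ (blowFreq q) φ

/-- The logarithmic growth rate of the radius of the blowup, divided by `bfFun q`. -/
def radialRate (q : Ambient d) (φ : Spacetime d) : ℝ :=
  pfFun q ^ 2 * ‖spaceFun q‖ ^ 2 * (inner ℝ (spaceFun q) (spatial φ)
      - pfFun q ^ 2 * power q φ * ‖spaceFun q‖ ^ 2)
    + 2⁻¹ * (pfFun q * timeFun q * (φ 0 - pfFun q ^ 3 * timeFun q * power q φ))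

/-- The frequency components of the rescaled Hamiltonian vector field for the force `φ`, divided
by `bfFun q`. -/
def freqField (q : Ambient d) (φ : Spacetime d) : ℝ × ℝ × ℝ × ℝ × EuclideanSpace ℝ (Fin d) :=
  (pfFun q * radialRate q φ, -(nfFun q * radialRate q φ), -(dfFun q * (pfFun q ^ 4 * power q φ)),
    pfFun q * (φ 0 - pfFun q ^ 3 * timeFun q * power q φ) - 2 * timeFun q * radialRate q φ,
    pfFun q ^ 2 • (spatial φ - (pfFun q ^ 2 * power q φ) • spaceFun q) - radialRate q φ • spaceFun q)

/-- The rescaled Hamiltonian vector field, up to boundary defining functions. -/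
def resField (σ : ℝ) (q : Ambient d) : Ambient d :=
  (sphereField q.1 (velocity N σ q), bfFun q • freqField q (natForce N q))

/-- `sphereField` is linear in the vector, hence so is `forceForm`, and it is enough to know it on
unit vectors. -/
theorem forceForm_eq_inner (x : ℝ × BaseAmbient d) (u v : Spacetime d) :
    forceForm N x u v = inner ℝ (force N x u) v := by
  let F : Spacetime d →ₗ[ℝ] ℝ :=
    { toFun := forceForm N x u
      map_add' := fun v w => by
        have h : ((0 : ℝ), sphereField x.2 (v + w)) = (0, sphereField x.2 v) + (0, sphereField x.2 w) := by
          rw [sphereField_add]; simp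
        simp only [forceForm, h, map_add, inner_add_left, add_mul, Finset.sum_add_distrib]
        ring
      map_smul' := fun c v => by
        have h : ((0 : ℝ), sphereField x.2 (c • v)) = c • (0, sphereField x.2 v) := by
          rw [sphereField_smul]; simp
        simp only [forceForm, h, map_smul, inner_smul_left, smul_eq_mul, mul_assoc, ← Finset.mul_sum]
        simp
        ring }
  have h1 : F v = F (∑ i, v i • EuclideanSpace.single i (1 : ℝ)) := by
    congr 1
    ext i
    simp [Pi.single_apply]
  change F v = _
  rw [h1, map_sum]
  simp only [map_smul, smul_eq_mul, PiLp.inner_apply, F, force]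
  simp

section Smooth

variable {N} {Ω : Set (ℝ × BaseAmbient d)}

theorem contDiff_coordinates :
    ContDiff ℝ ∞ (bfFun : Ambient d → ℝ) ∧ ContDiff ℝ ∞ (dirFun : Ambient d → Spacetime d) ∧
    ContDiff ℝ ∞ (pfFun : Ambient d → ℝ) ∧ ContDiff ℝ ∞ (nfFun : Ambient d → ℝ) ∧
    ContDiff ℝ ∞ (dfFun : Ambient d → ℝ) ∧ ContDiff ℝ ∞ (timeFun : Ambient d → ℝ) ∧
    ContDiff ℝ ∞ (spaceFun : Ambient d → EuclideanSpace ℝ (Fin d)) := by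
  unfold bfFun dirFun pfFun nfFun dfFun timeFun spaceFun
  refine ⟨?_, ?_, ?_, ?_, ?_, ?_, ?_⟩ <;> fun_prop

@[fun_prop] theorem contDiff_bfFun : ContDiff ℝ ∞ (bfFun : Ambient d → ℝ) := contDiff_coordinates.1
@[fun_prop] theorem contDiff_dirFun : ContDiff ℝ ∞ (dirFun : Ambient d → Spacetime d) :=
  contDiff_coordinates.2.1
@[fun_prop] theorem contDiff_pfFun : ContDiff ℝ ∞ (pfFun : Ambient d → ℝ) := contDiff_coordinates.2.2.1
@[fun_prop] theorem contDiff_nfFun : ContDiff ℝ ∞ (nfFun : Ambient d → ℝ) :=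
  contDiff_coordinates.2.2.2.1
@[fun_prop] theorem contDiff_dfFun : ContDiff ℝ ∞ (dfFun : Ambient d → ℝ) :=
  contDiff_coordinates.2.2.2.2.1
@[fun_prop] theorem contDiff_timeFun : ContDiff ℝ ∞ (timeFun : Ambient d → ℝ) :=
  contDiff_coordinates.2.2.2.2.2.1
@[fun_prop] theorem contDiff_spaceFun :
    ContDiff ℝ ∞ (spaceFun : Ambient d → EuclideanSpace ℝ (Fin d)) := contDiff_coordinates.2.2.2.2.2.2

theorem contDiff_metricArg : ContDiff ℝ ∞ (metricArg : Ambient d → ℝ × BaseAmbient d) :=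
  (contDiff_pfFun.mul contDiff_nfFun).prodMk contDiff_fst

theorem ContDiffOn.spacetimeVec {E : Type*} [NormedAddCommGroup E] [NormedSpace ℝ E] {U : Set E}
    {f : E → ℝ} {g : E → EuclideanSpace ℝ (Fin d)} (hf : ContDiffOn ℝ ∞ f U) (hg : ContDiffOn ℝ ∞ g U) :
    ContDiffOn ℝ ∞ (fun x => spacetimeVec (f x) (g x)) U :=
  (spacetimeVecCLM d).contDiff.comp_contDiffOn (hf.prodMk hg)

theorem ContDiffOn.spatial {E : Type*} [NormedAddCommGroup E] [NormedSpace ℝ E] {U : Set E}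
    {f : E → Spacetime d} (hf : ContDiffOn ℝ ∞ f U) :
    ContDiffOn ℝ ∞ (fun x => NonrelKG.spatial (f x)) U :=
  (spatialCLM d).contDiff.comp_contDiffOn hf

theorem ContDiffOn.spacetime_apply {E : Type*} [NormedAddCommGroup E] [NormedSpace ℝ E] {U : Set E}
    {f : E → Spacetime d} (hf : ContDiffOn ℝ ∞ f U) (i : Fin (d + 1)) :
    ContDiffOn ℝ ∞ (fun x => f x i) U :=
  contDiffOn_euclidean.1 hf i

theorem contDiff_blowFreq : ContDiff ℝ ∞ (blowFreq : Ambient d → Spacetime d) :=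
  contDiffOn_univ.1 (ContDiffOn.spacetimeVec (contDiff_pfFun.mul contDiff_timeFun).contDiffOn
    contDiff_spaceFun.contDiffOn)

/-- The part of the ambient space over the domain of the metric coefficients. -/
def metricDomain (Ω : Set (ℝ × BaseAmbient d)) : Set (Ambient d) := metricArg ⁻¹' Ω

theorem isOpen_metricDomain (hΩ : IsOpen Ω) : IsOpen (metricDomain Ω) :=
  hΩ.preimage contDiff_metricArg.continuous

theorem phaseSpace_subset_metricDomain (hX : Ico (0 : ℝ) 1 ×ˢ baseSpace d ⊆ Ω) :
    phaseSpace d ⊆ metricDomain Ω := fun _ hq =>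
  hX ⟨⟨mul_nonneg hq.2.1 hq.2.2.1, hq.2.2.2.2.1⟩, hq.1⟩

theorem contDiffOn_coeff (hN : ∀ i j, ContDiffOn ℝ ∞ (fun x => N x i j) Ω) (i j : Fin (d + 1)) :
    ContDiffOn ℝ ∞ (fun q => N (metricArg q) i j) (metricDomain Ω) :=
  (hN i j).comp contDiff_metricArg.contDiffOn fun _ hq => hq

theorem contDiffOn_pertQuad (hN : ∀ i j, ContDiffOn ℝ ∞ (fun x => N x i j) Ω) :
    ContDiffOn ℝ ∞ (fun q => pertQuad N (metricArg q) (blowFreq q)) (metricDomain Ω) := by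
  have hb := fun i => ContDiffOn.spacetime_apply (contDiff_blowFreq (d := d)).contDiffOn
    (U := metricDomain Ω) i
  exact ContDiffOn.sum fun i _ => ContDiffOn.sum fun j _ => ((contDiffOn_coeff hN i j).mul (hb i)).mul (hb j)

theorem contDiffOn_raise (hN : ∀ i j, ContDiffOn ℝ ∞ (fun x => N x i j) Ω) :
    ContDiffOn ℝ ∞ (fun q => raise N (metricArg q) (blowFreq q)) (metricDomain Ω) := by
  have hb := fun i => ContDiffOn.spacetime_apply (contDiff_blowFreq (d := d)).contDiffOn
    (U := metricDomain Ω) i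
  refine contDiffOn_euclidean.2 fun i => ?_
  refine (contDiffOn_const.mul (hb i)).add (ContDiffOn.mul ?_
    (ContDiffOn.sum fun j _ => (contDiffOn_coeff hN i j).mul (hb j)))
  exact (((contDiff_fst.comp contDiff_metricArg).pow 2).mul contDiff_bfFun).contDiffOn

theorem contDiffOn_resSymbol (hN : ∀ i j, ContDiffOn ℝ ∞ (fun x => N x i j) Ω) (σ : ℝ) :
    ContDiffOn ℝ ∞ (resSymbol N σ) (metricDomain Ω) := by
  have hb := fun i => ContDiffOn.spacetime_apply (contDiff_blowFreq (d := d)).contDiffOn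
    (U := metricDomain Ω) i
  have h1 : ContDiff ℝ ∞ fun q : Ambient d => (pfFun q * nfFun q) ^ 2 * bfFun q := by fun_prop
  have h2 : ContDiff ℝ ∞ fun q : Ambient d => 2 * σ * timeFun q * dfFun q := by fun_prop
  exact ((ContDiffOn.sum fun i _ => contDiffOn_const.mul ((hb i).pow 2)).add
    (h1.contDiffOn.mul (contDiffOn_pertQuad hN))).neg.add h2.contDiffOn

theorem contDiffOn_velocity (hN : ∀ i j, ContDiffOn ℝ ∞ (fun x => N x i j) Ω) (σ : ℝ) :
    ContDiffOn ℝ ∞ (velocity N σ) (metricDomain Ω) := by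
  have hr := contDiffOn_raise hN
  refine ContDiffOn.spacetimeVec ?_ (ContDiffOn.spatial hr).neg
  have h1 : ContDiff ℝ ∞ fun q : Ambient d => σ * dfFun q := by fun_prop
  exact contDiff_nfFun.contDiffOn.mul
    (h1.contDiffOn.sub (contDiff_pfFun.contDiffOn.mul (ContDiffOn.spacetime_apply hr 0)))

theorem ContDiffOn.sphereField {E : Type*} [NormedAddCommGroup E] [NormedSpace ℝ E] {U : Set E}
    {m : E → BaseAmbient d} {v : E → Spacetime d} (hm : ContDiffOn ℝ ∞ m U) (hv : ContDiffOn ℝ ∞ v U) :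
    ContDiffOn ℝ ∞ (fun x => sphereField (m x) (v x)) U := by
  have hi : ContDiffOn ℝ ∞ (fun x => inner ℝ (v x) (m x).2) U := hv.inner ℝ hm.snd
  exact (hm.fst.mul hi).neg.prodMk (hv.sub (hi.smul hm.snd))

theorem contDiffOn_force (hΩ : IsOpen Ω) (hN : ∀ i j, ContDiffOn ℝ ∞ (fun x => N x i j) Ω) :
    ContDiffOn ℝ ∞ (fun q => force N (metricArg q) (blowFreq q)) (metricDomain Ω) := by
  have hb := fun i => ContDiffOn.spacetime_apply (contDiff_blowFreq (d := d)).contDiffOn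
    (U := metricDomain Ω) i
  refine contDiffOn_euclidean.2 fun l => ?_
  have h1 : ContDiffOn ℝ ∞ (fun q : Ambient d =>
      inner ℝ (EuclideanSpace.single l (1 : ℝ)) (dirFun q)) (metricDomain Ω) :=
    contDiffOn_const.inner ℝ contDiff_dirFun.contDiffOn
  refine contDiffOn_const.mul (((h1.mul (contDiffOn_pertQuad hN)).neg).add
    (ContDiffOn.sum fun i _ => ContDiffOn.sum fun j _ => ContDiffOn.mul (ContDiffOn.mul ?_ (hb i)) (hb j)))
  have h2 : ContDiffOn ℝ ∞ (fun q => fderiv ℝ (fun y => N y i j) (metricArg q)) (metricDomain Ω) :=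
    ((hN i j).fderiv_of_isOpen hΩ (m := ∞) (by simp)).comp contDiff_metricArg.contDiffOn fun _ hq => hq
  exact h2.clm_apply (contDiffOn_const.prodMk
    (ContDiffOn.sphereField contDiff_fst.contDiffOn contDiffOn_const))

theorem contDiffOn_natForce (hΩ : IsOpen Ω) (hN : ∀ i j, ContDiffOn ℝ ∞ (fun x => N x i j) Ω) :
    ContDiffOn ℝ ∞ (natForce N) (metricDomain Ω) := by
  have hf := contDiffOn_force hΩ hN
  have h1 : ContDiff ℝ ∞ fun q : Ambient d => nfFun q ^ 2 := by fun_prop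
  have h2 : ContDiff ℝ ∞ fun q : Ambient d => pfFun q * nfFun q := by fun_prop
  exact ContDiffOn.spacetimeVec (h1.contDiffOn.mul (h2.contDiffOn.mul (ContDiffOn.spacetime_apply hf 0)))
    (h1.contDiffOn.smul (ContDiffOn.spatial hf))

theorem ContDiffOn.freqField {U : Set (Ambient d)} {φ : Ambient d → Spacetime d}
    (hφ : ContDiffOn ℝ ∞ φ U) : ContDiffOn ℝ ∞ (fun q => freqField q (φ q)) U := by
  have hφ0 := ContDiffOn.spacetime_apply hφ 0
  have hφx := ContDiffOn.spatial hφ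
  have hr : ContDiffOn ℝ ∞ (pfFun : Ambient d → ℝ) U := contDiff_pfFun.contDiffOn
  have ha : ContDiffOn ℝ ∞ (nfFun : Ambient d → ℝ) U := contDiff_nfFun.contDiffOn
  have hy : ContDiffOn ℝ ∞ (dfFun : Ambient d → ℝ) U := contDiff_dfFun.contDiffOn
  have hθ : ContDiffOn ℝ ∞ (timeFun : Ambient d → ℝ) U := contDiff_timeFun.contDiffOn
  have hb : ContDiffOn ℝ ∞ (spaceFun : Ambient d → _) U := contDiff_spaceFun.contDiffOn
  have hp : ContDiffOn ℝ ∞ (fun q => power q (φ q)) U := contDiff_blowFreq.contDiffOn.inner ℝ hφ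
  have hbb : ContDiffOn ℝ ∞ (fun q : Ambient d => ‖spaceFun q‖ ^ 2) U := hb.norm_sq ℝ
  have hi : ContDiffOn ℝ ∞ (fun q => inner ℝ (spaceFun q) (NonrelKG.spatial (φ q))) U := hb.inner ℝ hφx
  have hk : ContDiffOn ℝ ∞ (fun q => φ q 0 - pfFun q ^ 3 * timeFun q * power q (φ q)) U :=
    hφ0.sub (((hr.pow 3).mul hθ).mul hp)
  have hρ : ContDiffOn ℝ ∞ (fun q => radialRate q (φ q)) U :=
    (((hr.pow 2).mul hbb).mul (hi.sub (((hr.pow 2).mul hp).mul hbb))).add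
      (contDiffOn_const.mul ((hr.mul hθ).mul hk))
  exact (hr.mul hρ).prodMk ((ha.mul hρ).neg.prodMk ((hy.mul ((hr.pow 4).mul hp)).neg.prodMk
    (((hr.mul hk).sub ((contDiffOn_const.mul hθ).mul hρ)).prodMk
      (((hr.pow 2).smul (hφx.sub (((hr.pow 2).mul hp).smul hb))).sub (hρ.smul hb)))))

theorem contDiffOn_resField (hΩ : IsOpen Ω) (hN : ∀ i j, ContDiffOn ℝ ∞ (fun x => N x i j) Ω) (σ : ℝ) :
    ContDiffOn ℝ ∞ (resField N σ) (metricDomain Ω) :=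
  (ContDiffOn.sphereField contDiff_fst.contDiffOn (contDiffOn_velocity hN σ)).prodMk
    (contDiff_bfFun.contDiffOn.smul (ContDiffOn.freqField (contDiffOn_natForce hΩ hN)))

end Smooth

end NonrelKG
end

noncomputable section
namespace NonrelKG

variable {d : ℕ}

/-! ### The embedding of the interior -/

/-- This is the computation behind `sphereField`: a velocity weighted by ⟨z⟩⁻¹ lifts to a field on
the hemisphere that is smooth and tangent to the boundary. -/
theorem hasDerivAt_baseEmbed {f : ℝ → Spacetime d} {f' : Spacetime d} {t : ℝ} (hf : HasDerivAt f f' t) :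
    HasDerivAt (fun t => baseEmbed (f t)) (sphereField (baseEmbed (f t)) ((bracket (f t))⁻¹ • f')) t := by
  have hb := bracket_pos (f t)
  have h1 : HasDerivAt (fun t => bracket (f t)) (inner ℝ (f t) f' / bracket (f t)) t := by
    have h2 : HasDerivAt (fun t => 1 + ‖f t‖ ^ 2) (2 * inner ℝ (f t) f') t := by
      simpa using hf.norm_sq.const_add 1
    refine (h2.sqrt (by positivity)).congr_deriv ?_
    rw [bracket]; field_simp
  have h3 := h1.inv hb.ne'
  refine (h3.prodMk (h3.smul hf)).congr_deriv ?_
  ext1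
  · simp only [sphereField, baseEmbed, inner_smul_left, inner_smul_right, real_inner_comm f']
    simp; field_simp
  · simp only [sphereField, baseEmbed, inner_smul_left, inner_smul_right, real_inner_comm f', smul_smul]
    simp only [RCLike.conj_to_real, sub_eq_add_neg, ← neg_smul]
    congr 2
    field_simp

theorem differentiable_baseEmbed : Differentiable ℝ (baseEmbed : Spacetime d → BaseAmbient d) := by
  have h1 : Differentiable ℝ (bracket : Spacetime d → ℝ) := fun z =>
    ((differentiableAt_id.norm_sq ℝ).const_add 1).sqrt (by positivity)
  have h2 := h1.inv fun z => (bracket_pos z).ne'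
  exact h2.prodMk (h2.smul differentiable_id)

/-- `natFreq h` as a continuous linear map. -/
def natFreqCLM (d : ℕ) (h : ℝ) : Spacetime d →L[ℝ] Spacetime d :=
  LinearMap.toContinuousLinearMap
    { toFun := natFreq h
      map_add' := fun x y => by
        ext i; refine Fin.cases ?_ (fun j => ?_) i <;> simp <;> ring
      map_smul' := fun c x => by
        ext i; refine Fin.cases ?_ (fun j => ?_) i <;> simp <;> ring }

theorem blowup_quartic_pos {h : ℝ} (hh : 0 < h) (y : Spacetime d) :
    0 < h ^ 4 + ‖spatial y‖ ^ 4 + y 0 ^ 2 := by positivity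

theorem blowupRadius_pos {h : ℝ} (hh : 0 < h) (ζ : Spacetime d) : 0 < blowupRadius h ζ :=
  Real.sqrt_pos.2 (Real.sqrt_pos.2 (blowup_quartic_pos hh _))

theorem blowupRadius_pow_four {h : ℝ} (hh : 0 < h) (ζ : Spacetime d) :
    blowupRadius h ζ ^ 4 = h ^ 4 + ‖spatial (baseEmbed (natFreq h ζ)).2‖ ^ 4
      + (baseEmbed (natFreq h ζ)).2 0 ^ 2 := by
  rw [show 4 = 2 * 2 from rfl, pow_mul, blowupRadius, Real.sq_sqrt (Real.sqrt_nonneg _),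
    Real.sq_sqrt (blowup_quartic_pos hh _).le]

section Embed

variable {h : ℝ} (z ζ : Spacetime d)

@[simp] theorem phaseEmbed_fst : (phaseEmbed h z ζ).1 = baseEmbed z := rfl
@[simp] theorem bfFun_phaseEmbed : bfFun (phaseEmbed h z ζ) = (bracket z)⁻¹ := rfl
@[simp] theorem pfFun_phaseEmbed : pfFun (phaseEmbed h z ζ) = blowupRadius h ζ := rfl
@[simp] theorem nfFun_phaseEmbed : nfFun (phaseEmbed h z ζ) = h / blowupRadius h ζ := rfl
@[simp] theorem dfFun_phaseEmbed : dfFun (phaseEmbed h z ζ) = (bracket (natFreq h ζ))⁻¹ := rfl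
@[simp] theorem timeFun_phaseEmbed : timeFun (phaseEmbed h z ζ) =
    (baseEmbed (natFreq h ζ)).2 0 / blowupRadius h ζ ^ 2 := rfl
@[simp] theorem spaceFun_phaseEmbed : spaceFun (phaseEmbed h z ζ) =
    (blowupRadius h ζ)⁻¹ • spatial (baseEmbed (natFreq h ζ)).2 := rfl

variable (hh : 0 < h)
include hh

theorem pfFun_mul_nfFun_phaseEmbed : pfFun (phaseEmbed h z ζ) * nfFun (phaseEmbed h z ζ) = h := by
  have := (blowupRadius_pos hh ζ).ne'
  simp; field_simp

theorem metricArg_phaseEmbed : metricArg (phaseEmbed h z ζ) = (h, baseEmbed z) := by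
  rw [metricArg, pfFun_mul_nfFun_phaseEmbed z ζ hh]; rfl

theorem pf_sq_mul_time_phaseEmbed : pfFun (phaseEmbed h z ζ) ^ 2 * timeFun (phaseEmbed h z ζ) =
    (baseEmbed (natFreq h ζ)).2 0 := by
  have := (blowupRadius_pos hh ζ).ne'
  simp only [pfFun_phaseEmbed, timeFun_phaseEmbed]; field_simp

theorem pf_smul_space_phaseEmbed : pfFun (phaseEmbed h z ζ) • spaceFun (phaseEmbed h z ζ) =
    spatial (baseEmbed (natFreq h ζ)).2 := by
  have := (blowupRadius_pos hh ζ).ne'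
  simp only [pfFun_phaseEmbed, spaceFun_phaseEmbed, smul_smul]
  rw [mul_inv_cancel₀ this, one_smul]

theorem pf_smul_blowFreq_phaseEmbed : pfFun (phaseEmbed h z ζ) • blowFreq (phaseEmbed h z ζ) =
    (baseEmbed (natFreq h ζ)).2 := by
  refine spacetime_ext ?_ ?_
  · rw [← pf_sq_mul_time_phaseEmbed z ζ hh]
    simp [blowFreq]; ring
  · rw [← pf_smul_space_phaseEmbed z ζ hh]
    simp [blowFreq]

theorem phaseEmbed_mem (hh1 : h < 1) : phaseEmbed h z ζ ∈ phaseSpace d := by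
  have hr := blowupRadius_pos hh ζ
  have hr4 := blowupRadius_pow_four hh ζ
  refine ⟨baseEmbed_mem z, hr.le, (div_pos hh hr).le, (baseEmbed_fst_pos _).le, ?_, ?_, ?_⟩
  · rw [pfFun_mul_nfFun_phaseEmbed z ζ hh]; exact hh1
  · simp only [nfFun, spaceFun, timeFun, phaseEmbed, norm_smul, norm_inv, Real.norm_eq_abs, abs_of_pos hr]
    field_simp
    rw [hr4]
  · rw [pf_smul_space_phaseEmbed z ζ hh, pf_sq_mul_time_phaseEmbed z ζ hh, add_assoc, add_comm (_ ^ 2) (_ ^ 2),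
      ← norm_sq_spacetime]
    exact baseEmbed_norm _

/-- The curves in the interior of the phase space: if the frequency moves with the rescaled force `φ`, then
the frequency components move along `freqField`. -/
theorem hasDerivAt_phaseEmbed {f g : ℝ → Spacetime d} {f' g' v φ : Spacetime d} {s t : ℝ}
    (hf : HasDerivAt f f' t) (hg : HasDerivAt g g' t)
    (hv : (bracket (f t))⁻¹ • f' = v)
    (hφ : (bracket (natFreq h (g t)))⁻¹ • natFreq h g' = (s * blowupRadius h (g t) ^ 3) • φ) :
    HasDerivAt (fun t => phaseEmbed h (f t) (g t)) (sphereField (baseEmbed (f t)) v,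
      s • freqField (phaseEmbed h (f t) (g t)) φ) t := by
  have hr := blowupRadius_pos hh (g t)
  have hr4 := blowupRadius_pow_four hh (g t)
  have hn : HasDerivAt (fun t => natFreq h (g t)) (natFreq h g') t :=
    (natFreqCLM d h).hasFDerivAt.comp_hasDerivAt t hg
  have hy := hasDerivAt_baseEmbed hn
  rw [hφ] at hy
  set q := phaseEmbed h (f t) (g t) with hq
  set r := blowupRadius h (g t) with hr_def
  have hu : r • blowFreq q = (baseEmbed (natFreq h (g t))).2 := pf_smul_blowFreq_phaseEmbed _ _ hh
  have hb : r • spaceFun q = spatial (baseEmbed (natFreq h (g t))).2 := pf_smul_space_phaseEmbed _ _ hh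
  have hθ : r ^ 2 * timeFun q = (baseEmbed (natFreq h (g t))).2 0 := pf_sq_mul_time_phaseEmbed _ _ hh
  have hinner : inner ℝ ((s * r ^ 3) • φ) (baseEmbed (natFreq h (g t))).2 = s * r ^ 4 * power q φ := by
    rw [← hu, inner_smul_left, inner_smul_right, real_inner_comm]
    simp [power]; ring
  have hy0 : HasDerivAt (fun t => (baseEmbed (natFreq h (g t))).1) _ t :=
    hasFDerivAt_fst.comp_hasDerivAt t hy
  have hyv : HasDerivAt (fun t => (baseEmbed (natFreq h (g t))).2) _ t :=
    hasFDerivAt_snd.comp_hasDerivAt t hy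
  simp only [sphereField, hinner, ContinuousLinearMap.coe_fst', ContinuousLinearMap.coe_snd'] at hy0 hyv
  have hyξ : HasDerivAt (fun t => spatial (baseEmbed (natFreq h (g t))).2)
      ((s * r ^ 3) • (spatial φ - (r ^ 2 * power q φ) • spaceFun q)) t := by
    refine ((hasDerivAt_spatial hyv.hasDerivWithinAt).hasDerivAt univ_mem).congr_deriv ?_
    rw [spatial_sub, spatial_smul, spatial_smul, ← hb, smul_sub, smul_smul, smul_smul]
    congr 2; ring
  have hyτ : HasDerivAt (fun t => (baseEmbed (natFreq h (g t))).2 0)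
      (s * r ^ 3 * (φ 0 - r ^ 3 * timeFun q * power q φ)) t := by
    refine ((hasDerivAt_time hyv.hasDerivWithinAt 0).hasDerivAt univ_mem).congr_deriv ?_
    simp only [PiLp.sub_apply, PiLp.smul_apply, smul_eq_mul, ← hθ]
    ring
  -- The fourth power of the radius is differentiated, being polynomial in the compactified
  -- frequency. The factor r³ assumed in `hφ` is what makes the resulting logarithmic rate smooth
  -- down to r = 0.
  have hR : HasDerivAt (fun t => blowupRadius h (g t)) (s * (r * radialRate q φ)) t := by
    have h1 : HasDerivAt (fun t => h ^ 4 + ‖spatial (baseEmbed (natFreq h (g t))).2‖ ^ 4 +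
        (baseEmbed (natFreq h (g t))).2 0 ^ 2) (4 * r ^ 3 * (s * (r * radialRate q φ))) t := by
      have h2 := (hyξ.norm_sq.pow 2)
      have h3 := ((h2.const_add (h ^ 4)).add (hyτ.pow 2))
      refine (h3.congr_deriv ?_).congr_of_eventuallyEq (Eventually.of_forall fun t => ?_)
      · rw [← hb, ← hθ, inner_smul_left, inner_smul_right, inner_sub_right, inner_smul_right,
          real_inner_self_eq_norm_sq, norm_smul, Real.norm_eq_abs, abs_of_pos hr]
        simp [radialRate, ← hr_def, hq]
        simp only [← hq]
        ring
      · simp only [Pi.pow_apply, Pi.add_apply, ← pow_mul]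
    refine ((h1.sqrt (blowup_quartic_pos hh _).ne').sqrt
      (Real.sqrt_pos.2 (blowup_quartic_pos hh _)).ne').congr_deriv ?_
    have h5 : √(h ^ 4 + ‖spatial (baseEmbed (natFreq h (g t))).2‖ ^ 4 +
        (baseEmbed (natFreq h (g t))).2 0 ^ 2) = r ^ 2 := by
      rw [← hr4, Real.sqrt_eq_iff_mul_self_eq (by positivity) (by positivity)]; ring
    rw [h5, Real.sqrt_sq hr.le]
    field_simp; ring
  have hz := hasDerivAt_baseEmbed hf
  rw [hv] at hz
  have ha := (hasDerivAt_const t h).div hR hr.ne'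
  have hθ' := hyτ.div (hR.pow 2) (pow_pos hr 2).ne'
  have hb' := (hR.inv hr.ne').smul hyξ
  refine (hz.prodMk (hR.prodMk (ha.prodMk (hy0.prodMk (hθ'.prodMk hb'))))).congr_deriv ?_
  simp only [freqField, Prod.smul_mk, smul_eq_mul, Prod.mk.injEq, true_and]
  refine ⟨rfl, ?_, ?_, ?_, ?_⟩
  · simp only [hq, nfFun_phaseEmbed, ← hr_def]
    simp only [← hq]
    field_simp; ring
  · simp only [hq, dfFun_phaseEmbed, pfFun_phaseEmbed, ← hr_def]
    simp only [← hq, baseEmbed]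
    ring
  · rw [← hθ]
    simp only [hq, pfFun_phaseEmbed, ← hr_def]
    simp only [← hq, Pi.pow_apply, ← hr_def]
    field_simp
    ring
  · rw [← hb]
    simp only [hq, pfFun_phaseEmbed, ← hr_def]
    simp only [← hq, smul_sub, smul_smul, Pi.inv_apply, ← hr_def]
    have e1 : r⁻¹ * (s * r ^ 3) = s * r ^ 2 := by field_simp
    have e2 : -(s * (r * radialRate q φ)) / r ^ 2 * r = -(s * radialRate q φ) := by field_simp
    have e3 : r⁻¹ * (s * r ^ 3 * (r ^ 2 * power q φ)) = s * (r ^ 2 * (r ^ 2 * power q φ)) := by field_simp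
    rw [e1, e2, e3, neg_smul]
    abel

theorem differentiableAt_phaseEmbed :
    DifferentiableAt ℝ (fun v : Spacetime d × Spacetime d => phaseEmbed h v.1 v.2) (z, ζ) := by
  have h1 : DifferentiableAt ℝ (fun v : Spacetime d × Spacetime d => baseEmbed (natFreq h v.2)) (z, ζ) :=
    (differentiable_baseEmbed _).comp (z, ζ)
      (((natFreqCLM d h).differentiableAt).comp (z, ζ) differentiableAt_snd)
  have h2 : DifferentiableAt ℝ (fun v : Spacetime d × Spacetime d =>
      spatial (baseEmbed (natFreq h v.2)).2) (z, ζ) := (spatialCLM d).differentiableAt.comp (z, ζ) h1.snd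
  have h3 : DifferentiableAt ℝ (fun v : Spacetime d × Spacetime d =>
      (baseEmbed (natFreq h v.2)).2 0) (z, ζ) := differentiableAt_euclidean.1 h1.snd 0
  have h4 : DifferentiableAt ℝ (fun v : Spacetime d × Spacetime d => blowupRadius h v.2) (z, ζ) := by
    have h5 : DifferentiableAt ℝ (fun v : Spacetime d × Spacetime d =>
        h ^ 4 + (‖spatial (baseEmbed (natFreq h v.2)).2‖ ^ 2) ^ 2 +
          (baseEmbed (natFreq h v.2)).2 0 ^ 2) (z, ζ) := (((h2.norm_sq ℝ).pow 2).const_add _).add (h3.pow 2)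
    simp only [← pow_mul] at h5
    exact (h5.sqrt (blowup_quartic_pos hh _).ne').sqrt (Real.sqrt_pos.2 (blowup_quartic_pos hh _)).ne'
  have h6 := (blowupRadius_pos hh ζ).ne'
  have hz : DifferentiableAt ℝ (fun v : Spacetime d × Spacetime d => baseEmbed v.1) (z, ζ) :=
    (differentiable_baseEmbed _).comp (z, ζ) differentiableAt_fst
  have hi : DifferentiableAt ℝ (fun v : Spacetime d × Spacetime d => (blowupRadius h v.2)⁻¹) (z, ζ) :=
    h4.inv h6
  have h7 : DifferentiableAt ℝ (fun v : Spacetime d × Spacetime d => h / blowupRadius h v.2) (z, ζ) := by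
    simp only [div_eq_mul_inv]; exact hi.const_mul h
  have h8 : DifferentiableAt ℝ (fun v : Spacetime d × Spacetime d =>
      (baseEmbed (natFreq h v.2)).2 0 / blowupRadius h v.2 ^ 2) (z, ζ) := by
    simp only [div_eq_mul_inv, ← inv_pow]; exact h3.mul (hi.pow 2)
  have h9 : DifferentiableAt ℝ (fun v : Spacetime d × Spacetime d =>
      (blowupRadius h v.2)⁻¹ • spatial (baseEmbed (natFreq h v.2)).2) (z, ζ) := hi.smul h2
  exact hz.prodMk (h4.prodMk (h7.prodMk (h1.fst.prodMk (h8.prodMk h9))))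

end Embed

theorem gradient_apply {f : Spacetime d → ℝ} (x : Spacetime d) (i : Fin (d + 1)) :
    gradient f x i = fderiv ℝ f x (EuclideanSpace.single i 1) := by
  rw [← inner_gradient_left, EuclideanSpace.inner_single_right]
  simp

end NonrelKG
end

noncomputable section
namespace NonrelKG

variable {d : ℕ}

/-! ### The symbol and its Hamiltonian field in the blowup coordinates. -/

section Rescaled

variable {N : ℝ × BaseAmbient d → Matrix (Fin (d + 1)) (Fin (d + 1)) ℝ}

theorem pertQuad_smul (x : ℝ × BaseAmbient d) (c : ℝ) (u : Spacetime d) :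
    pertQuad N x (c • u) = c ^ 2 * pertQuad N x u := by
  simp only [pertQuad, Finset.mul_sum]
  refine Finset.sum_congr rfl fun i _ => Finset.sum_congr rfl fun j _ => ?_
  simp; ring

theorem raise_smul (x : ℝ × BaseAmbient d) (c : ℝ) (u : Spacetime d) :
    raise N x (c • u) = c • raise N x u := by
  ext i
  simp only [raise, PiLp.smul_apply, smul_eq_mul, mul_add, Finset.mul_sum]
  congr 1
  · ring
  · exact Finset.sum_congr rfl fun j _ => by ring

theorem force_smul (x : ℝ × BaseAmbient d) (c : ℝ) (u : Spacetime d) :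
    force N x (c • u) = c ^ 2 • force N x u := by
  ext l
  simp only [force, forceForm, PiLp.smul_apply, smul_eq_mul, pertQuad_smul, mul_add, Finset.mul_sum]
  congr 1
  · ring
  · exact Finset.sum_congr rfl fun i _ => Finset.sum_congr rfl fun j _ => by ring

theorem inner_raise (x : ℝ × BaseAmbient d) (u v : Spacetime d) : inner ℝ (raise N x u) v =
    (∑ i, minkowskiSign i * u i * v i) + x.1 ^ 2 * x.2.1 * ∑ i, ∑ j, N x i j * v i * u j := by
  simp only [PiLp.inner_apply, raise, Finset.mul_sum, ← Finset.sum_add_distrib]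
  refine Finset.sum_congr rfl fun i _ => ?_
  simp only [RCLike.inner_apply, RCLike.conj_to_real, mul_add, Finset.mul_sum]
  congr 1
  · ring
  · exact Finset.sum_congr rfl fun j _ => by ring

variable (hsymm : ∀ x i j, N x i j = N x j i)
include hsymm

/-- The derivative of the quadratic form of the inverse metric in the covector. -/
theorem hasDerivAt_quadratic (x : ℝ × BaseAmbient d) {f : ℝ → Spacetime d} {f' : Spacetime d} {s : Set ℝ}
    {t : ℝ} (hf : HasDerivWithinAt f f' s t) :
    HasDerivWithinAt (fun t => (∑ i, minkowskiSign i * f t i ^ 2) + x.1 ^ 2 * x.2.1 * pertQuad N x (f t))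
      (2 * inner ℝ (raise N x (f t)) f') s t := by
  have hi := fun i => hasDerivAt_time hf i
  have h1 : HasDerivWithinAt (fun t => ∑ i, minkowskiSign i * f t i ^ 2)
      (∑ i, minkowskiSign i * (2 * f t i * f' i)) s t := by
    refine HasDerivWithinAt.fun_sum fun i _ => ?_
    refine (((hi i).fun_pow 2).const_mul _).congr_deriv ?_
    push_cast; ring
  have h2 : HasDerivWithinAt (fun t => pertQuad N x (f t))
      (∑ i, ∑ j, (N x i j * f' i * f t j + N x i j * f t i * f' j)) s t := by
    refine HasDerivWithinAt.fun_sum fun i _ => HasDerivWithinAt.fun_sum fun j _ => ?_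
    exact ((hi i).const_mul (N x i j)).fun_mul (hi j)
  refine (h1.add (h2.const_mul (x.1 ^ 2 * x.2.1))).congr_deriv ?_
  have h3 : ∑ i, ∑ j, N x i j * f t i * f' j = ∑ i, ∑ j, N x i j * f' i * f t j := by
    rw [Finset.sum_comm]
    refine Finset.sum_congr rfl fun i _ => Finset.sum_congr rfl fun j _ => ?_
    rw [hsymm]; ring
  have h4 : ∑ i, minkowskiSign i * (2 * f t i * f' i) = 2 * ∑ i, minkowskiSign i * f t i * f' i := by
    rw [Finset.mul_sum]
    exact Finset.sum_congr rfl fun i _ => by ring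
  rw [inner_raise]
  simp only [Finset.sum_add_distrib, h3, h4]
  ring

omit hsymm in
/-- The derivative of the perturbation of the metric along a curve in the base. -/
theorem hasDerivAt_pertQuad {h : ℝ} {m : ℝ → BaseAmbient d} {v u : Spacetime d} {s : Set ℝ} {t : ℝ}
    (hN : ∀ i j, DifferentiableAt ℝ (fun x => N x i j) (h, m t))
    (hm : HasDerivWithinAt m (sphereField (m t) v) s t) :
    HasDerivWithinAt (fun t => (m t).1 * pertQuad N (h, m t) u)
      ((m t).1 * (2 * forceForm N (h, m t) u v)) s t := by
  have h1 : HasDerivWithinAt (fun t => (h, m t)) ((0 : ℝ), sphereField (m t) v) s t :=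
    (hasDerivWithinAt_const t s h).prodMk hm
  have h2 : HasDerivWithinAt (fun t => pertQuad N (h, m t) u)
      (∑ i, ∑ j, fderiv ℝ (fun y => N y i j) (h, m t) (0, sphereField (m t) v) * u i * u j) s t := by
    refine HasDerivWithinAt.fun_sum fun i _ => HasDerivWithinAt.fun_sum fun j _ => ?_
    exact (((hN i j).hasFDerivAt.comp_hasDerivWithinAt t h1).mul_const _).mul_const _
  have h3 : HasDerivWithinAt (fun t => (m t).1) (-((m t).1 * inner ℝ v (m t).2)) s t :=
    (hasFDerivAt_fst : HasFDerivAt (Prod.fst : BaseAmbient d → ℝ) _ _).comp_hasDerivWithinAt t hm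
  refine (h3.fun_mul h2).congr_deriv ?_
  simp only [forceForm]
  ring

/-- The symbol with the inverse metric in normal form. -/
def normalSymbol (N : ℝ × BaseAmbient d → Matrix (Fin (d + 1)) (Fin (d + 1)) ℝ) (σ h : ℝ)
    (z ζ : Spacetime d) : ℝ :=
  (h ^ 2)⁻¹ * (-((∑ i, minkowskiSign i * natFreq h ζ i ^ 2) + h ^ 2 * (bracket z)⁻¹ *
    pertQuad N (h, baseEmbed z) (natFreq h ζ)) + 2 * σ * natFreq h ζ 0)

theorem gradient_normalSymbol_freq (σ h : ℝ) (z ζ : Spacetime d) (i : Fin (d + 1)) :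
    gradient (fun ζ' => normalSymbol N σ h z ζ') ζ i = (h ^ 2)⁻¹ *
      (-(2 * inner ℝ (raise N (h, baseEmbed z) (natFreq h ζ)) (natFreq h (EuclideanSpace.single i 1)))
        + 2 * σ * natFreq h (EuclideanSpace.single i 1) 0) := by
  have hd : Differentiable ℝ fun ζ' => normalSymbol N σ h z ζ' := by
    have h0 : ∀ i, Differentiable ℝ fun ζ' : Spacetime d => natFreq h ζ' i := fun i =>
      differentiable_euclidean.1 (natFreqCLM d h).differentiable i
    unfold normalSymbol pertQuad
    exact Differentiable.const_mul ((((Differentiable.fun_sum fun i _ =>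
      ((h0 i).pow 2).const_mul _).add ((Differentiable.fun_sum fun i _ => Differentiable.fun_sum fun j _ =>
        ((h0 i).const_mul _).mul (h0 j)).const_mul _)).neg).add ((h0 0).const_mul _)) _
  set e : Spacetime d := EuclideanSpace.single i 1
  have hl : HasDerivAt (fun t : ℝ => ζ + t • e) e 0 := by
    simpa using ((hasDerivAt_id (0 : ℝ)).smul_const e).const_add ζ
  have h1 : HasDerivAt (fun t : ℝ => normalSymbol N σ h z (ζ + t • e))
      (fderiv ℝ (fun ζ' => normalSymbol N σ h z ζ') ζ e) 0 := by
    have := hd.differentiableAt (x := ζ + (0 : ℝ) • e)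
    have h2 := this.hasFDerivAt.comp_hasDerivAt (0 : ℝ) hl
    simpa [Function.comp_def] using h2
  have hn : HasDerivAt (fun t : ℝ => natFreq h (ζ + t • e)) (natFreq h e) 0 :=
    (natFreqCLM d h).hasFDerivAt.comp_hasDerivAt (0 : ℝ) hl
  have h2 := (((hasDerivAt_quadratic hsymm (h, baseEmbed z) hn.hasDerivWithinAt (s := univ)).neg).add
    ((hasDerivAt_time hn.hasDerivWithinAt 0).const_mul (2 * σ))).const_mul ((h ^ 2)⁻¹)
  have h3 := h2.hasDerivAt univ_mem
  rw [gradient_apply, h1.unique h3]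
  simp

omit hsymm in
-- Only the perturbation depends on z. One power of ⟨z⟩⁻¹ is the decay of the coefficients, the
-- other comes from differentiating along the hemisphere. Division by the defining function of bf
-- removes only one of them, so the rescaled force vanishes at bf.
theorem gradient_normalSymbol_base {h : ℝ} (hh : h ≠ 0) (σ : ℝ) (z ζ : Spacetime d)
    (hN : ∀ i j, DifferentiableAt ℝ (fun x => N x i j) (h, baseEmbed z)) :
    gradient (fun z' => normalSymbol N σ h z' ζ) z =
      -(2 * (bracket z)⁻¹ ^ 2) • force N (h, baseEmbed z) (natFreq h ζ) := by
  have hd : DifferentiableAt ℝ (fun z' => normalSymbol N σ h z' ζ) z := by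
    have hb := differentiable_baseEmbed z
    have hx : DifferentiableAt ℝ (fun z' : Spacetime d => (h, baseEmbed z')) z :=
      (differentiableAt_const h).prodMk hb
    have hN' : ∀ i j, DifferentiableAt ℝ (fun z' => N (h, baseEmbed z') i j) z := fun i j =>
      DifferentiableAt.comp z (g := fun x => N x i j) (hN i j) hx
    have hb1 : DifferentiableAt ℝ (fun z' : Spacetime d => (bracket z')⁻¹) z := hb.fst
    unfold normalSymbol pertQuad
    exact (((((hb1.const_mul _).mul (DifferentiableAt.fun_sum fun i _ => DifferentiableAt.fun_sum fun j _ =>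
        ((hN' i j).mul_const _).mul_const _)).const_add _).neg).add_const _).const_mul _
  ext i
  set e : Spacetime d := EuclideanSpace.single i 1
  have hl : HasDerivAt (fun t : ℝ => z + t • e) e 0 := by
    simpa using ((hasDerivAt_id (0 : ℝ)).smul_const e).const_add z
  have h1 : HasDerivAt (fun t : ℝ => normalSymbol N σ h (z + t • e) ζ)
      (fderiv ℝ (fun z' => normalSymbol N σ h z' ζ) z e) 0 := by
    have hd' : DifferentiableAt ℝ (fun z' => normalSymbol N σ h z' ζ) (z + (0 : ℝ) • e) := by simpa using hd
    have h2 := hd'.hasFDerivAt.comp_hasDerivAt (0 : ℝ) hl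
    simpa [Function.comp_def] using h2
  have hm := hasDerivAt_baseEmbed hl
  have h2 := hasDerivAt_pertQuad (N := N) (h := h) (u := natFreq h ζ) (by simpa using hN)
    (hm.hasDerivWithinAt (s := univ))
  have h3 := ((((h2.const_mul (h ^ 2)).const_add
    (∑ i, minkowskiSign i * natFreq h ζ i ^ 2)).neg.add_const
      (2 * σ * natFreq h ζ 0)).const_mul ((h ^ 2)⁻¹)).hasDerivAt univ_mem
  have h4 : HasDerivAt (fun t : ℝ => normalSymbol N σ h (z + t • e) ζ) _ 0 :=
    h3.congr_of_eventuallyEq (Eventually.of_forall fun t => by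
      simp only [normalSymbol, baseEmbed, Pi.neg_apply]; ring)
  rw [gradient_apply, h1.unique h4]
  simp only [zero_smul, add_zero, forceForm_eq_inner, inner_smul_right, PiLp.smul_apply,
    EuclideanSpace.inner_single_right, e, baseEmbed]
  simp
  field_simp

omit hsymm in
theorem smul_natFreq_phaseEmbed {h : ℝ} (hh : 0 < h) (z ζ : Spacetime d) :
    natFreq h ζ = (pfFun (phaseEmbed h z ζ) * (dfFun (phaseEmbed h z ζ))⁻¹) • blowFreq (phaseEmbed h z ζ) := by
  have h1 := pf_smul_blowFreq_phaseEmbed z ζ hh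
  have h2 := (bracket_pos (natFreq h ζ)).ne'
  rw [mul_comm, mul_smul, h1, dfFun_phaseEmbed, inv_inv, baseEmbed, smul_smul, mul_inv_cancel₀ h2, one_smul]

omit hsymm in
-- The natural frequency is r/y times `blowFreq`, and y²a²/h² = y²/r² because h = ra. The quadratic
-- part thus loses all singular factors, and the linear term becomes 2σθy.
theorem resSymbol_phaseEmbed {h : ℝ} (hh : 0 < h) (σ : ℝ) (z ζ : Spacetime d) :
    resSymbol N σ (phaseEmbed h z ζ) = dfFun (phaseEmbed h z ζ) ^ 2 * nfFun (phaseEmbed h z ζ) ^ 2 *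
      normalSymbol N σ h z ζ := by
  have hr : 0 < pfFun (phaseEmbed h z ζ) := blowupRadius_pos hh ζ
  have hy : 0 < dfFun (phaseEmbed h z ζ) := baseEmbed_fst_pos _
  have hra := pfFun_mul_nfFun_phaseEmbed z ζ hh
  have hq := smul_natFreq_phaseEmbed hh z ζ
  have hx := metricArg_phaseEmbed z ζ hh
  have hm : (bracket z)⁻¹ = bfFun (phaseEmbed h z ζ) := rfl
  rw [resSymbol, normalSymbol, hq, ← hx, pertQuad_smul, hra, hm]
  generalize phaseEmbed h z ζ = q at *
  have ha : nfFun q = h / pfFun q := by rw [← hra]; field_simp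
  have hs : ∑ i, minkowskiSign i * ((pfFun q * (dfFun q)⁻¹) • blowFreq q) i ^ 2 =
      (pfFun q * (dfFun q)⁻¹) ^ 2 * ∑ i, minkowskiSign i * blowFreq q i ^ 2 := by
    rw [Finset.mul_sum]
    exact Finset.sum_congr rfl fun i _ => by simp; ring
  rw [hs, ha]
  simp only [PiLp.smul_apply, smul_eq_mul, blowFreq, spacetimeVec_zero]
  field_simp

/-- In the interior, `resField` is the rescaled Hamiltonian vector field. -/
theorem resField_phaseEmbed {h : ℝ} (hh : 0 < h) (σ : ℝ) (z ζ : Spacetime d)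
    (hN : ∀ i j, DifferentiableAt ℝ (fun x => N x i j) (h, baseEmbed z)) :
    resField N σ (phaseEmbed h z ζ) = (2⁻¹ * dfFun (phaseEmbed h z ζ) * (bfFun (phaseEmbed h z ζ))⁻¹ *
      nfFun (phaseEmbed h z ζ)) •
        fderiv ℝ (fun v : Spacetime d × Spacetime d => phaseEmbed h v.1 v.2) (z, ζ)
          (hamiltonianField (normalSymbol N σ h) z ζ) := by
  rw [← map_smul]
  set c := 2⁻¹ * dfFun (phaseEmbed h z ζ) * (bfFun (phaseEmbed h z ζ))⁻¹ * nfFun (phaseEmbed h z ζ) with hc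
  set H := c • hamiltonianField (normalSymbol N σ h) z ζ with hH
  have hr : 0 < blowupRadius h ζ := blowupRadius_pos hh ζ
  have hy := bracket_pos (natFreq h ζ)
  have hm := bracket_pos z
  have hra := pfFun_mul_nfFun_phaseEmbed z ζ hh
  have hq := smul_natFreq_phaseEmbed hh z ζ
  have hx := metricArg_phaseEmbed z ζ hh
  have hlf : HasDerivAt (fun t : ℝ => z + t • H.1) H.1 0 := by
    simpa using ((hasDerivAt_id (0 : ℝ)).smul_const H.1).const_add z
  have hlg : HasDerivAt (fun t : ℝ => ζ + t • H.2) H.2 0 := by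
    simpa using ((hasDerivAt_id (0 : ℝ)).smul_const H.2).const_add ζ
  have h1 : HasDerivAt (fun t : ℝ => phaseEmbed h (z + t • H.1) (ζ + t • H.2))
      (fderiv ℝ (fun v : Spacetime d × Spacetime d => phaseEmbed h v.1 v.2) (z, ζ) H) 0 := by
    have hd : DifferentiableAt ℝ (fun v : Spacetime d × Spacetime d => phaseEmbed h v.1 v.2)
        (z + (0 : ℝ) • H.1, ζ + (0 : ℝ) • H.2) := by
      simpa using differentiableAt_phaseEmbed z ζ hh
    have h2 := hd.hasFDerivAt.comp_hasDerivAt (0 : ℝ) (hlf.prodMk hlg)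
    simpa [Function.comp_def] using h2
  -- With s = m, the two remaining goals say that `velocity` and `natForce` are the rescaled ∂_ζ p
  -- and -∂_z p.
  have h2 := hasDerivAt_phaseEmbed hh hlf hlg (v := velocity N σ (phaseEmbed h z ζ))
    (φ := natForce N (phaseEmbed h z ζ)) (s := bfFun (phaseEmbed h z ζ)) ?_ ?_
  · rw [h1.unique h2]
    simp [resField]
  · simp only [zero_smul, add_zero]
    have hraise : raise N (h, baseEmbed z) (natFreq h ζ) = (pfFun (phaseEmbed h z ζ) *
      (dfFun (phaseEmbed h z ζ))⁻¹) • raise N (metricArg (phaseEmbed h z ζ)) (blowFreq (phaseEmbed h z ζ)) := by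
      rw [hq, raise_smul, hx]
    ext i
    simp only [hH, hamiltonianField, Prod.smul_fst, PiLp.smul_apply, smul_eq_mul,
      gradient_normalSymbol_freq hsymm, hraise]
    have hsingle : ∀ (w : Spacetime d) (i : Fin (d + 1)), inner ℝ w (natFreq h (EuclideanSpace.single i 1)) =
        w i * natFreq h (EuclideanSpace.single i 1) i := fun w i => by
      rw [PiLp.inner_apply, Finset.sum_eq_single i]
      · simp [mul_comm]
      · intro j _ hj
        have : natFreq h (EuclideanSpace.single i (1 : ℝ)) j = 0 := by
          revert hj; refine Fin.cases ?_ (fun j => ?_) j <;> intro hj <;> simp [hj]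
        simp [this]
      · simp
    rw [hsingle, hc]
    refine Fin.cases ?_ (fun j => ?_) i
    · simp [velocity]
      field_simp
      ring
    · simp [velocity]
      field_simp
  · simp only [zero_smul, add_zero]
    have hforce : force N (h, baseEmbed z) (natFreq h ζ) = (pfFun (phaseEmbed h z ζ) *
      (dfFun (phaseEmbed h z ζ))⁻¹) ^ 2 •
        force N (metricArg (phaseEmbed h z ζ)) (blowFreq (phaseEmbed h z ζ)) := by
      rw [hq, force_smul, hx]
    simp only [hH, hamiltonianField, Prod.smul_snd, gradient_normalSymbol_base hh.ne' σ z ζ hN, hforce,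
      natForce, hra, hc]
    generalize force N (metricArg (phaseEmbed h z ζ)) (blowFreq (phaseEmbed h z ζ)) = F
    ext i
    refine Fin.cases ?_ (fun j => ?_) i
    · simp
      field_simp
    · simp
      field_simp

end Rescaled

end NonrelKG
end

noncomputable section
namespace NonrelKG

variable {d : ℕ}

/-! ### The flat model at spacetime infinity -/

/-- The rescaled symbol of the Minkowski metric. -/
def flatSymbol (σ : ℝ) (q : Ambient d) : ℝ :=
  pfFun q ^ 2 * timeFun q ^ 2 - ‖spaceFun q‖ ^ 2 + 2 * σ * timeFun q * dfFun q

/-- A positive multiple of `1 + σ h²τ`. -/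
def energyFun (σ : ℝ) (q : Ambient d) : ℝ := σ * (pfFun q ^ 2 * timeFun q) + dfFun q

/-- The rescaled velocity for the Minkowski metric. -/
def flatVelocity (σ : ℝ) (q : Ambient d) : Spacetime d :=
  spacetimeVec (nfFun q * (pfFun q ^ 2 * timeFun q + σ * dfFun q)) (-spaceFun q)

theorem contDiff_flatSymbol (σ : ℝ) : ContDiff ℝ ∞ (flatSymbol σ : Ambient d → ℝ) := by
  have : ContDiff ℝ ∞ fun q : Ambient d => ‖spaceFun q‖ ^ 2 := contDiff_spaceFun.norm_sq ℝ
  unfold flatSymbol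
  fun_prop

theorem continuous_energyFun (σ : ℝ) : Continuous (energyFun σ : Ambient d → ℝ) := by
  have : ContDiff ℝ ∞ (energyFun σ : Ambient d → ℝ) := by unfold energyFun; fun_prop
  exact this.continuous

theorem contDiff_flatVelocity (σ : ℝ) : ContDiff ℝ ∞ (flatVelocity σ : Ambient d → Spacetime d) := by
  have h1 : ContDiff ℝ ∞ fun q : Ambient d => nfFun q * (pfFun q ^ 2 * timeFun q + σ * dfFun q) := by
    fun_prop
  exact contDiffOn_univ.1 (ContDiffOn.spacetimeVec h1.contDiffOn contDiff_spaceFun.neg.contDiffOn)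

section Flat

variable {N : ℝ × BaseAmbient d → Matrix (Fin (d + 1)) (Fin (d + 1)) ℝ} {σ : ℝ} {q : Ambient d}

theorem resSymbol_eq (σ : ℝ) (q : Ambient d) : resSymbol N σ q = flatSymbol σ q -
    (pfFun q * nfFun q) ^ 2 * bfFun q * pertQuad N (metricArg q) (blowFreq q) := by
  rw [resSymbol, sum_minkowskiSign_mul_sq, flatSymbol, blowFreq, spacetimeVec_zero, spatial_spacetimeVec]
  ring

theorem resSymbol_eq_flatSymbol (h : (pfFun q * nfFun q) * bfFun q = 0) :
    resSymbol N σ q = flatSymbol σ q := by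
  rw [resSymbol_eq, show (pfFun q * nfFun q) ^ 2 * bfFun q = (pfFun q * nfFun q) *
    ((pfFun q * nfFun q) * bfFun q) by ring, h]
  simp

/-- The vector of the metric perturbation applied to the frequency. -/
def pertVec (N : ℝ × BaseAmbient d → Matrix (Fin (d + 1)) (Fin (d + 1)) ℝ) (q : Ambient d) : Spacetime d :=
  WithLp.toLp 2 fun i => ∑ j, N (metricArg q) i j * blowFreq q j

theorem velocity_eq (σ : ℝ) (q : Ambient d) : velocity N σ q = flatVelocity σ q -
    ((pfFun q * nfFun q) ^ 2 * bfFun q) •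
      spacetimeVec (nfFun q * pfFun q * pertVec N q 0) (spatial (pertVec N q)) := by
  refine spacetime_ext ?_ ?_
  · simp [velocity, flatVelocity, raise, pertVec, metricArg, blowFreq, bfFun]
    ring
  · ext j
    simp [velocity, flatVelocity, raise, pertVec, metricArg, blowFreq, bfFun]
    ring

theorem velocity_eq_flatVelocity (h : (pfFun q * nfFun q) * bfFun q = 0) :
    velocity N σ q = flatVelocity σ q := by
  rw [velocity_eq, show (pfFun q * nfFun q) ^ 2 * bfFun q = (pfFun q * nfFun q) *
    ((pfFun q * nfFun q) * bfFun q) by ring, h]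
  simp

theorem phaseSpace_sphere (hq : q ∈ phaseSpace d) : dfFun q ^ 2 + pfFun q ^ 2 * ‖spaceFun q‖ ^ 2
    + (pfFun q ^ 2 * timeFun q) ^ 2 = 1 := by
  have := hq.2.2.2.2.2.2
  rwa [norm_smul, mul_pow, Real.norm_eq_abs, sq_abs] at this

/-- The mass shell (1 + στ)² = 1 + |ξ|² in natural frequencies, multiplied by y² so that it persists
at fiber infinity. -/
theorem energyFun_sq (hσ : σ ^ 2 = 1) (hflat : flatSymbol σ q = 0) :
    energyFun σ q ^ 2 = dfFun q ^ 2 + pfFun q ^ 2 * ‖spaceFun q‖ ^ 2 := by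
  simp only [flatSymbol, energyFun] at *
  linear_combination (pfFun q ^ 2 * timeFun q) ^ 2 * hσ + pfFun q ^ 2 * hflat

/-- If E = 0, then y = 0 and rb = 0 by `energyFun_sq`, and then r²θ = 0, which contradicts that the
compactified frequency has norm one. The two sheets stay apart even at the boundary, so the closed
condition E ≥ 0 is also open on the shell. -/
theorem energyFun_pos (hσ : σ ^ 2 = 1) (hq : q ∈ phaseSpace d) (hflat : flatSymbol σ q = 0)
    (he : 0 ≤ energyFun σ q) : 0 < energyFun σ q := by
  refine lt_of_le_of_ne he fun h0 => ?_
  have h1 := energyFun_sq hσ hflat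
  rw [← h0] at h1
  have h2 := phaseSpace_sphere hq
  have h3 : dfFun q = 0 := by nlinarith [sq_nonneg (pfFun q * ‖spaceFun q‖), sq_nonneg (dfFun q)]
  rw [energyFun, h3, add_zero] at h0
  have h4 : (pfFun q ^ 2 * timeFun q) ^ 2 = 0 := by
    have : (σ * (pfFun q ^ 2 * timeFun q)) ^ 2 = 0 := by rw [← h0]; ring
    rwa [mul_pow, hσ, one_mul] at this
  rw [h4] at h2
  nlinarith

/-- The velocity is (σaE, -b). If it vanishes, then b = 0, and a = 0 since E > 0; the blowup
equation a⁴ + |b|⁴ + θ² = 1 leaves only θ = ±1. These two points of the fiber are not on the good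
sheet, because for b = 0 the symbol equals σθ(E + y). -/
theorem flatVelocity_ne_zero (hσ : σ ^ 2 = 1) (hq : q ∈ phaseSpace d) (hflat : flatSymbol σ q = 0)
    (he : 0 ≤ energyFun σ q) : flatVelocity σ q ≠ 0 := by
  intro h0
  have he' := energyFun_pos hσ hq hflat he
  have hb : spaceFun q = 0 := by
    ext j
    simpa [flatVelocity] using congrArg (fun v : Spacetime d => v j.succ) h0
  have h1 : nfFun q * (pfFun q ^ 2 * timeFun q + σ * dfFun q) = 0 := by
    simpa [flatVelocity] using congrArg (fun v : Spacetime d => v 0) h0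
  have ha : nfFun q = 0 := by
    rcases mul_eq_zero.1 h1 with h | h
    · exact h
    · have : energyFun σ q = σ * (pfFun q ^ 2 * timeFun q + σ * dfFun q) := by
        rw [energyFun]; linear_combination -(dfFun q) * hσ
      rw [this, h, mul_zero] at he'
      exact absurd he' (lt_irrefl _)
  have h2 := hq.2.2.2.2.2.1
  rw [ha, hb] at h2
  have h3 : timeFun q ^ 2 = 1 := by simpa using h2
  have h4 : timeFun q * (σ * energyFun σ q + σ * dfFun q) = 0 := by
    have := hflat
    rw [flatSymbol, hb] at this
    rw [energyFun]
    simp at this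
    linear_combination this + timeFun q ^ 2 * pfFun q ^ 2 * hσ
  have hσ0 : σ ≠ 0 := fun h => by simp [h] at hσ
  have hθ0 : timeFun q ≠ 0 := fun h => by simp [h] at h3
  have h5 : energyFun σ q + dfFun q = 0 := by
    have : σ * (energyFun σ q + dfFun q) = 0 := by
      rcases mul_eq_zero.1 h4 with h | h
      · exact absurd h hθ0
      · linarith
    exact (mul_eq_zero.1 this).resolve_left hσ0
  have := hq.2.2.2.1
  linarith

end Flat

/-! ### Density of the interior -/

/-- The factor that normalizes the frequency. -/
def freqNorm (q : Ambient d) : ℝ :=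
  Real.sqrt (dfFun q ^ 2 + ‖pfFun q • spaceFun q‖ ^ 2 + (pfFun q ^ 2 * timeFun q) ^ 2)

/-- The factor that normalizes the fibers of the blowup. -/
def blowNorm (q : Ambient d) : ℝ :=
  Real.sqrt (Real.sqrt (nfFun q ^ 4 + ‖(freqNorm q)⁻¹ • spaceFun q‖ ^ 4
    + ((freqNorm q)⁻¹ * timeFun q) ^ 2))

/-- The frequency components of a retraction of a neighbourhood onto the phase space. -/
def normalizeFreq (q : Ambient d) : ℝ × ℝ × ℝ × ℝ × EuclideanSpace ℝ (Fin d) :=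
  (pfFun q * blowNorm q, nfFun q * (blowNorm q)⁻¹, dfFun q * (freqNorm q)⁻¹,
    timeFun q * (freqNorm q)⁻¹ * (blowNorm q)⁻¹ ^ 2, ((blowNorm q)⁻¹ * (freqNorm q)⁻¹) • spaceFun q)

theorem freqNorm_eq_one {q : Ambient d} (hq : q ∈ phaseSpace d) : freqNorm q = 1 := by
  rw [freqNorm, hq.2.2.2.2.2.2, Real.sqrt_one]

theorem blowNorm_eq_one {q : Ambient d} (hq : q ∈ phaseSpace d) : blowNorm q = 1 := by
  rw [blowNorm, freqNorm_eq_one hq, inv_one, one_smul, one_mul, hq.2.2.2.2.2.1, Real.sqrt_one, Real.sqrt_one]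

theorem normalizeFreq_eq {q : Ambient d} (hq : q ∈ phaseSpace d) : normalizeFreq q = q.2 := by
  rw [normalizeFreq, freqNorm_eq_one hq, blowNorm_eq_one hq]
  simp [pfFun, nfFun, dfFun, timeFun, spaceFun]

theorem continuousAt_normalizeFreq {q : Ambient d} (hq : q ∈ phaseSpace d) :
    ContinuousAt normalizeFreq q := by
  have hr : ContinuousAt (pfFun : Ambient d → ℝ) q := contDiff_pfFun.continuous.continuousAt
  have ha : ContinuousAt (nfFun : Ambient d → ℝ) q := contDiff_nfFun.continuous.continuousAt
  have hy : ContinuousAt (dfFun : Ambient d → ℝ) q := contDiff_dfFun.continuous.continuousAt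
  have hθ : ContinuousAt (timeFun : Ambient d → ℝ) q := contDiff_timeFun.continuous.continuousAt
  have hb : ContinuousAt (spaceFun : Ambient d → _) q := contDiff_spaceFun.continuous.continuousAt
  have hc : ContinuousAt (freqNorm : Ambient d → ℝ) q :=
    (((hy.pow 2).add ((hr.smul hb).norm.pow 2)).add (((hr.pow 2).mul hθ).pow 2)).sqrt
  have hc' := hc.inv₀ (by rw [freqNorm_eq_one hq]; exact one_ne_zero)
  have hn : ContinuousAt (blowNorm : Ambient d → ℝ) q :=
    (((ha.pow 4).add ((hc'.smul hb).norm.pow 4)).add ((hc'.mul hθ).pow 2)).sqrt.sqrt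
  have hn' := hn.inv₀ (by rw [blowNorm_eq_one hq]; exact one_ne_zero)
  exact (hr.mul hn).prodMk ((ha.mul hn').prodMk ((hy.mul hc').prodMk
    (((hθ.mul hc').mul (hn'.pow 2)).prodMk ((hn'.mul hc').smul hb))))

section Normalize

variable {q : Ambient d} (ha : 0 < nfFun q) (hy : 0 < dfFun q)

include hy in
theorem freqNorm_pos : 0 < freqNorm q := Real.sqrt_pos.2 (by positivity)

include ha in
theorem blowNorm_pos : 0 < blowNorm q := Real.sqrt_pos.2 (Real.sqrt_pos.2 (by positivity))

include ha hy in
-- Dividing y, b, θ by `freqNorm` restores the equation of the compactified frequency. The parabolic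
-- rescaling by `blowNorm` then restores that of the blowup fiber without changing ra, rb and r²θ.
theorem normalizeFreq_mem (hr : 0 < pfFun q) (hra : pfFun q * nfFun q < 1) {m : BaseAmbient d}
    (hm : m ∈ baseSpace d) : (m, normalizeFreq q) ∈ phaseSpace d := by
  have hc := freqNorm_pos hy
  have hn := blowNorm_pos ha
  have hc2 : freqNorm q ^ 2 = dfFun q ^ 2 + ‖pfFun q • spaceFun q‖ ^ 2 + (pfFun q ^ 2 * timeFun q) ^ 2 :=
    Real.sq_sqrt (by positivity)
  have hn4 : blowNorm q ^ 4 = nfFun q ^ 4 + ‖(freqNorm q)⁻¹ • spaceFun q‖ ^ 4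
      + ((freqNorm q)⁻¹ * timeFun q) ^ 2 := by
    rw [show 4 = 2 * 2 from rfl, pow_mul, blowNorm, Real.sq_sqrt (Real.sqrt_nonneg _),
      Real.sq_sqrt (by positivity)]
  rw [norm_smul, Real.norm_eq_abs, abs_of_pos hr] at hc2
  rw [norm_smul, norm_inv, Real.norm_eq_abs, abs_of_pos hc] at hn4
  refine ⟨hm, ?_, ?_, ?_, ?_, ?_, ?_⟩
  · exact (mul_pos hr hn).le
  · exact (mul_pos ha (inv_pos.2 hn)).le
  · exact (mul_pos hy (inv_pos.2 hc)).le
  · change pfFun q * blowNorm q * (nfFun q * (blowNorm q)⁻¹) < 1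
    rwa [show pfFun q * blowNorm q * (nfFun q * (blowNorm q)⁻¹) = pfFun q * nfFun q by field_simp]
  · change (nfFun q * (blowNorm q)⁻¹) ^ 4 + ‖((blowNorm q)⁻¹ * (freqNorm q)⁻¹) • spaceFun q‖ ^ 4 +
      (timeFun q * (freqNorm q)⁻¹ * (blowNorm q)⁻¹ ^ 2) ^ 2 = 1
    rw [norm_smul, Real.norm_eq_abs, abs_of_pos (mul_pos (inv_pos.2 hn) (inv_pos.2 hc))]
    have : (blowNorm q)⁻¹ ^ 4 * blowNorm q ^ 4 = 1 := by field_simp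
    rw [← this, hn4]; ring
  · change (dfFun q * (freqNorm q)⁻¹) ^ 2 + ‖(pfFun q * blowNorm q) • ((blowNorm q)⁻¹ * (freqNorm q)⁻¹) •
      spaceFun q‖ ^ 2 + ((pfFun q * blowNorm q) ^ 2 * (timeFun q * (freqNorm q)⁻¹ * (blowNorm q)⁻¹ ^ 2)) ^ 2 = 1
    rw [norm_smul, norm_smul, Real.norm_eq_abs, Real.norm_eq_abs, abs_of_pos (mul_pos hr hn),
      abs_of_pos (mul_pos (inv_pos.2 hn) (inv_pos.2 hc))]
    have : (freqNorm q)⁻¹ ^ 2 * freqNorm q ^ 2 = 1 := by field_simp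
    rw [← this, hc2]; field_simp

include ha hy in
-- The flat symbol is homogeneous under both rescalings, so points perturbed along the mass shell
-- remain on it after normalization.
theorem flatSymbol_normalizeFreq (σ : ℝ) (m : BaseAmbient d) : flatSymbol σ (m, normalizeFreq q) =
    ((blowNorm q)⁻¹ * (freqNorm q)⁻¹) ^ 2 * flatSymbol σ q := by
  have hc := freqNorm_pos hy
  have hn := blowNorm_pos ha
  change (pfFun q * blowNorm q) ^ 2 * (timeFun q * (freqNorm q)⁻¹ * (blowNorm q)⁻¹ ^ 2) ^ 2 -
    ‖((blowNorm q)⁻¹ * (freqNorm q)⁻¹) • spaceFun q‖ ^ 2 +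
      2 * σ * (timeFun q * (freqNorm q)⁻¹ * (blowNorm q)⁻¹ ^ 2) * (dfFun q * (freqNorm q)⁻¹) = _
  rw [norm_smul, Real.norm_eq_abs, abs_of_pos (mul_pos (inv_pos.2 hn) (inv_pos.2 hc)), flatSymbol]
  field_simp

end Normalize

/-- Points with positive frequency components come from the interior of the blowup. -/
theorem exists_freq_of_pos {q : Ambient d} (hq : q ∈ phaseSpace d) (hr : 0 < pfFun q) (ha : 0 < nfFun q)
    (hy : 0 < dfFun q) : ∃ ζ : Spacetime d,
      natFreq (pfFun q * nfFun q) ζ = spacetimeVec ((dfFun q)⁻¹ * (pfFun q ^ 2 * timeFun q))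
        (((dfFun q)⁻¹ * pfFun q) • spaceFun q) ∧
      ∀ z, (phaseEmbed (pfFun q * nfFun q) z ζ).2 = q.2 := by
  set h := pfFun q * nfFun q with hh
  have h0 : 0 < h := mul_pos hr ha
  set n : Spacetime d := spacetimeVec ((dfFun q)⁻¹ * (pfFun q ^ 2 * timeFun q))
        (((dfFun q)⁻¹ * pfFun q) • spaceFun q) with hn
  let ζ : Spacetime d := spacetimeVec ((h ^ 2)⁻¹ * n 0) (h⁻¹ • spatial n)
  have hζ : natFreq h ζ = n := by
    ext i
    refine Fin.cases ?_ (fun j => ?_) i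
    · simp [ζ]; field_simp
    · simp [ζ]; field_simp
  refine ⟨ζ, hζ, fun z => ?_⟩
  have hsph := hq.2.2.2.2.2.2
  have hblow := hq.2.2.2.2.2.1
  have hbase : baseEmbed n = (dfFun q, spacetimeVec (pfFun q ^ 2 * timeFun q) (pfFun q • spaceFun q)) := by
    rw [← baseEmbed_inv_smul (m := (dfFun q, spacetimeVec (pfFun q ^ 2 * timeFun q)
      (pfFun q • spaceFun q))) (by
        rw [norm_sq_spacetime, spacetimeVec_zero, spatial_spacetimeVec]; linarith) hy]
    congr 1
    refine spacetime_ext ?_ ?_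
    · simp [hn]
    · simp [hn, smul_smul]
  have hR : blowupRadius h ζ = pfFun q := by
    rw [blowupRadius, hζ, hbase]
    simp only [spacetimeVec_zero, spatial_spacetimeVec, norm_smul, Real.norm_eq_abs, abs_of_pos hr]
    -- The blowup equation a⁴ + |b|⁴ + θ² = 1 multiplied by r⁴.
    rw [show h ^ 4 + (pfFun q * ‖spaceFun q‖) ^ 4 + (pfFun q ^ 2 * timeFun q) ^ 2 = (pfFun q ^ 2) ^ 2 by
      rw [hh]; linear_combination pfFun q ^ 4 * hblow, Real.sqrt_sq (by positivity), Real.sqrt_sq hr.le]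
  simp only [phaseEmbed, hR, hζ, hbase]
  refine Prod.ext rfl (Prod.ext ?_ (Prod.ext rfl (Prod.ext ?_ ?_)))
  · simp only [hh]
    rw [mul_div_cancel_left₀ _ hr.ne']; rfl
  · simp only [spacetimeVec_zero]
    rw [mul_div_cancel_left₀ _ (pow_ne_zero 2 hr.ne')]; rfl
  · simp only [spatial_spacetimeVec, smul_smul]
    rw [inv_mul_cancel₀ hr.ne', one_smul]; rfl

theorem exists_phaseEmbed_of_pos {q : Ambient d} (hq : q ∈ phaseSpace d) (hm : 0 < bfFun q)
    (hr : 0 < pfFun q) (ha : 0 < nfFun q) (hy : 0 < dfFun q) : ∃ h ∈ Ioo (0 : ℝ) 1, ∃ z ζ : Spacetime d,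
      q = phaseEmbed h z ζ ∧ natFreq h ζ 0 = (dfFun q)⁻¹ * (pfFun q ^ 2 * timeFun q) := by
  obtain ⟨ζ, h1, h2⟩ := exists_freq_of_pos hq hr ha hy
  refine ⟨_, ⟨mul_pos hr ha, hq.2.2.2.2.1⟩, q.1.1⁻¹ • q.1.2, ζ, ?_, by rw [h1]; rfl⟩
  refine Prod.ext ?_ (h2 _).symm
  exact (baseEmbed_inv_smul hq.1.2 hm).symm

/-- Adding ε to all boundary-defining coordinates leaves the faces but breaks the three sphere
equations; the normalizations repair these and are continuous with value the given point at ε = 0.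
-/
theorem tendsto_interior {q : Ambient d} (hq : q ∈ phaseSpace d) : ∃ p : ℝ → Ambient d,
    Tendsto p (𝓝[>] 0) (𝓝 q) ∧ ∀ᶠ ε in 𝓝[>] (0 : ℝ), p ε ∈ phaseSpace d ∧ 0 < bfFun (p ε) ∧
      0 < pfFun (p ε) ∧ 0 < nfFun (p ε) ∧ 0 < dfFun (p ε) := by
  let l : ℝ → ℝ := fun ε => Real.sqrt ((bfFun q + ε) ^ 2 + ‖dirFun q‖ ^ 2)
  let f : ℝ → Ambient d := fun ε => (q.1, (pfFun q + ε, nfFun q + ε, dfFun q + ε, timeFun q, spaceFun q))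
  have hl0 : l 0 = 1 := by
    have := hq.1.2
    simp only [l, add_zero]
    exact (congrArg Real.sqrt this).trans Real.sqrt_one
  have hlc : Continuous l := by fun_prop
  have hf : Continuous f := by fun_prop
  have hf0 : f 0 = q := by simp [f, pfFun, nfFun, dfFun, timeFun, spaceFun]
  refine ⟨fun ε => (((bfFun q + ε) * (l ε)⁻¹, (l ε)⁻¹ • dirFun q), normalizeFreq (f ε)), ?_, ?_⟩
  · have h1 : ContinuousAt (fun ε : ℝ => (((bfFun q + ε) * (l ε)⁻¹, (l ε)⁻¹ • dirFun q),
        normalizeFreq (f ε))) 0 := by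
      have hli : ContinuousAt (fun ε => (l ε)⁻¹) 0 :=
        hlc.continuousAt.inv₀ (by rw [hl0]; exact one_ne_zero)
      refine ContinuousAt.prodMk (ContinuousAt.prodMk ?_ ?_) ?_
      · exact (continuousAt_const.add continuousAt_id).mul hli
      · exact hli.smul continuousAt_const
      · exact ContinuousAt.comp (by rw [hf0]; exact continuousAt_normalizeFreq hq) hf.continuousAt
    have h2 := h1.tendsto.mono_left (nhdsWithin_le_nhds (s := Ioi 0))
    rw [hl0, hf0, normalizeFreq_eq hq] at h2
    simpa [bfFun, dirFun] using h2
  · have hra : ∀ᶠ ε in 𝓝[>] (0 : ℝ), (pfFun q + ε) * (nfFun q + ε) < 1 := by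
      have : Continuous fun ε : ℝ => (pfFun q + ε) * (nfFun q + ε) := by fun_prop
      exact (this.continuousAt.eventually_lt continuousAt_const (by simpa using hq.2.2.2.2.1)).filter_mono
        nhdsWithin_le_nhds
    filter_upwards [hra, self_mem_nhdsWithin] with ε hε hε0
    have hε0 : 0 < ε := hε0
    have hm : 0 < bfFun q + ε := add_pos_of_nonneg_of_pos hq.1.1 hε0
    have hr : 0 < pfFun (f ε) := add_pos_of_nonneg_of_pos hq.2.1 hε0
    have ha : 0 < nfFun (f ε) := add_pos_of_nonneg_of_pos hq.2.2.1 hε0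
    have hy : 0 < dfFun (f ε) := add_pos_of_nonneg_of_pos hq.2.2.2.1 hε0
    have hl : 0 < l ε := Real.sqrt_pos.2 (by positivity)
    have hl2 : l ε ^ 2 = (bfFun q + ε) ^ 2 + ‖dirFun q‖ ^ 2 := Real.sq_sqrt (by positivity)
    refine ⟨normalizeFreq_mem ha hy hr hε ⟨by positivity, ?_⟩, ?_, ?_, ?_, ?_⟩
    · simp only [norm_smul, norm_inv, Real.norm_eq_abs, abs_of_pos hl]
      have : (l ε)⁻¹ ^ 2 * l ε ^ 2 = 1 := by field_simp
      rw [← this, hl2]; ring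
    · exact mul_pos hm (inv_pos.2 hl)
    · exact mul_pos hr (blowNorm_pos ha)
    · exact mul_pos ha (inv_pos.2 (blowNorm_pos ha))
    · exact mul_pos hy (inv_pos.2 (freqNorm_pos hy))

/-- The good part of phase space lies in the closure of `{σ h²τ > -1}`. -/
theorem mem_closure_of_energyFun_pos {σ : ℝ} {q : Ambient d} (hq : q ∈ phaseSpace d)
    (he : 0 < energyFun σ q) : q ∈ closure {q | ∃ h ∈ Ioo (0 : ℝ) 1, ∃ z ζ : Spacetime d,
      q = phaseEmbed h z ζ ∧ -1 < σ * natFreq h ζ 0} := by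
  obtain ⟨p, hp, hpos⟩ := tendsto_interior hq
  refine mem_closure_of_tendsto hp ?_
  filter_upwards [hpos, hp.eventually ((continuous_energyFun σ).continuousAt.eventually (lt_mem_nhds he))]
    with ε h1 h2
  obtain ⟨h, hh, z, ζ, hp1, hp2⟩ := exists_phaseEmbed_of_pos h1.1 h1.2.1 h1.2.2.1 h1.2.2.2.1 h1.2.2.2.2
  refine ⟨h, hh, z, ζ, hp1, ?_⟩
  have hy := h1.2.2.2.2
  rw [energyFun] at h2
  rw [hp2, show σ * ((dfFun (p ε))⁻¹ * (pfFun (p ε) ^ 2 * timeFun (p ε))) =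
    (dfFun (p ε))⁻¹ * (σ * (pfFun (p ε) ^ 2 * timeFun (p ε)) + dfFun (p ε)) - 1 by field_simp; ring]
  have := mul_pos (inv_pos.2 hy) h2
  linarith

/-- In the interior E = y(1 + σh²τ), and E is continuous up to the boundary. -/
theorem energyFun_nonneg_of_mem_closure {σ : ℝ} {q : Ambient d}
    (hq : q ∈ closure {q | ∃ h ∈ Ioo (0 : ℝ) 1, ∃ z ζ : Spacetime d,
      q = phaseEmbed h z ζ ∧ -1 < σ * natFreq h ζ 0}) : 0 ≤ energyFun σ q := by
  refine closure_minimal (t := {q | 0 ≤ energyFun σ q}) ?_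
    (isClosed_le continuous_const (continuous_energyFun σ)) hq
  rintro q ⟨h, hh, z, ζ, rfl, h1⟩
  have hb : 0 < (bracket (natFreq h ζ))⁻¹ := inv_pos.2 (bracket_pos _)
  have : 0 < (bracket (natFreq h ζ))⁻¹ * (σ * natFreq h ζ 0 + 1) := mul_pos hb (by linarith)
  simp only [mem_ofPred_eq, energyFun, pf_sq_mul_time_phaseEmbed z ζ hh.1, dfFun_phaseEmbed]
  simp only [baseEmbed, PiLp.smul_apply, smul_eq_mul]
  linarith

end NonrelKG
end

noncomputable section
namespace NonrelKG

variable {d : ℕ}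

/-! ### The radial set -/

/-- The equations of the radial set. -/
def radialLocus (σ ς : ℝ) : Set (Ambient d) :=
  {q ∈ phaseSpace d | bfFun q = 0 ∧ flatSymbol σ q = 0 ∧ 0 ≤ energyFun σ q ∧
    ‖flatVelocity σ q‖ • dirFun q = (ς * σ) • flatVelocity σ q}

/-- The part of the radial set over `h ∈ (0, 1)` outside fiber infinity. -/
def radialInterior (σ ς : ℝ) : Set (Ambient d) :=
  {q | ∃ h ∈ Ioo (0 : ℝ) 1, ∃ ξ : EuclideanSpace ℝ (Fin d), ∃ ζ : Spacetime d,
    natFreq h ζ = spacetimeVec (σ * (Real.sqrt (1 + ‖ξ‖ ^ 2) - 1)) ξ ∧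
    q.2 = (phaseEmbed h 0 ζ).2 ∧
    bfFun q = 0 ∧ ‖dirFun q‖ = 1 ∧
    ∃ l : ℝ, 0 < l ∧ dirFun q = (ς * l) • spacetimeVec (h * Real.sqrt (1 + ‖ξ‖ ^ 2)) (-σ • ξ)}

theorem radialComponent_eq (σ ς : ℝ) : (radialComponent σ ς : Set (Ambient d)) =
    phaseSpace d ∩ closure (radialInterior σ ς) := rfl

theorem abs_eq_one_of_sq {x : ℝ} (hx : x ^ 2 = 1) : |x| = 1 := by
  rcases sq_eq_one_iff.1 hx with h | h <;> simp [h]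

theorem dirFun_norm {q : Ambient d} (hq : q ∈ phaseSpace d) (hm : bfFun q = 0) : ‖dirFun q‖ = 1 := by
  have h1 : bfFun q ^ 2 + ‖dirFun q‖ ^ 2 = 1 := hq.1.2
  rw [hm] at h1
  nlinarith [norm_nonneg (dirFun q)]

/-- Here (r/y)b is the natural spatial frequency ξ, and E/y is √(1 + |ξ|²) on the good sheet. The
prefactor has the sign of σ: this sign decides which of the two radial sets attracts. -/
theorem flatVelocity_eq {σ : ℝ} (hσ : σ ^ 2 = 1) {q : Ambient d} (hr : pfFun q ≠ 0) (hy : dfFun q ≠ 0) :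
    flatVelocity σ q = (σ * (dfFun q / pfFun q)) • spacetimeVec
      (pfFun q * nfFun q * ((dfFun q)⁻¹ * energyFun σ q)) (-σ • (((dfFun q)⁻¹ * pfFun q) • spaceFun q)) := by
  refine spacetime_ext ?_ ?_
  · simp only [flatVelocity, spacetimeVec_zero, PiLp.smul_apply, smul_eq_mul, energyFun]
    field_simp
    linear_combination -(nfFun q * pfFun q ^ 2 * timeFun q) * hσ
  · simp only [flatVelocity, spatial_spacetimeVec, spatial_smul, smul_smul]
    rw [show σ * (dfFun q / pfFun q) * (-σ * ((dfFun q)⁻¹ * pfFun q)) = -(σ ^ 2) by field_simp, hσ, neg_one_smul]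

theorem radialInterior_subset_phaseSpace (σ ς : ℝ) :
    (radialInterior σ ς : Set (Ambient d)) ⊆ phaseSpace d := by
  rintro q ⟨h, hh, ξ, ζ, -, h2, h3, h4, -⟩
  have := phaseEmbed_mem 0 ζ hh.1 hh.2
  obtain ⟨m, f⟩ := q
  obtain rfl : f = _ := h2
  refine ⟨⟨h3.ge, ?_⟩, this.2⟩
  change bfFun (m, _) ^ 2 + ‖dirFun (m, _)‖ ^ 2 = 1
  rw [h3, h4]; norm_num

theorem radialInterior_subset_radialLocus {σ ς : ℝ} (hσ : σ ^ 2 = 1) (hς : ς ^ 2 = 1) :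
    (radialInterior σ ς : Set (Ambient d)) ⊆ radialLocus σ ς := by
  intro q hq
  have hqX := radialInterior_subset_phaseSpace σ ς hq
  obtain ⟨h, hh, ξ, ζ, h1, h2, h3, h4, l, hl, h5⟩ := hq
  set E := √(1 + ‖ξ‖ ^ 2) with hE
  have hE2 : E ^ 2 = 1 + ‖ξ‖ ^ 2 := Real.sq_sqrt (by positivity)
  have hE0 : 0 < E := Real.sqrt_pos.2 (by positivity)
  obtain ⟨m, f⟩ := q
  obtain rfl : f = (phaseEmbed h 0 ζ).2 := h2
  set q : Ambient d := (m, (phaseEmbed h 0 ζ).2) with hq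
  have hr : 0 < pfFun q := blowupRadius_pos hh.1 ζ
  have hy : 0 < dfFun q := baseEmbed_fst_pos _
  have hra : pfFun q * nfFun q = h := pfFun_mul_nfFun_phaseEmbed 0 ζ hh.1
  have hdf : dfFun q = (bracket (spacetimeVec (σ * (E - 1)) ξ))⁻¹ := by rw [← h1]; rfl
  have hθ : pfFun q ^ 2 * timeFun q = dfFun q * (σ * (E - 1)) := by
    refine (pf_sq_mul_time_phaseEmbed 0 ζ hh.1).trans ?_
    rw [h1, hdf]; rfl
  have hb : pfFun q • spaceFun q = dfFun q • ξ := by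
    refine (pf_smul_space_phaseEmbed 0 ζ hh.1).trans ?_
    rw [h1]
    rw [hdf]; simp only [baseEmbed, spatial_smul, spatial_spacetimeVec]
  have hen : energyFun σ q = dfFun q * E := by
    rw [energyFun, hθ]; linear_combination dfFun q * (E - 1) * hσ
  have hb2 : pfFun q ^ 2 * ‖spaceFun q‖ ^ 2 = dfFun q ^ 2 * ‖ξ‖ ^ 2 := by
    rw [← mul_pow, ← mul_pow, ← abs_of_pos hr, ← abs_of_pos hy, ← Real.norm_eq_abs, ← Real.norm_eq_abs,
      ← norm_smul, ← norm_smul, hb]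
  -- After multiplication by r² the symbol involves only r²θ and r²|b|², which are known in terms of
  -- ξ.
  have hflat : flatSymbol σ q = 0 := by
    have : pfFun q ^ 2 * flatSymbol σ q = 0 := by
      rw [show pfFun q ^ 2 * flatSymbol σ q = (pfFun q ^ 2 * timeFun q) ^ 2 - pfFun q ^ 2 * ‖spaceFun q‖ ^ 2
        + 2 * σ * (pfFun q ^ 2 * timeFun q) * dfFun q by rw [flatSymbol]; ring, hθ, hb2]
      linear_combination dfFun q ^ 2 * (E - 1) * (E + 1) * hσ + dfFun q ^ 2 * hE2
    exact (mul_eq_zero.1 this).resolve_left (pow_ne_zero 2 hr.ne')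
  have hv := flatVelocity_eq hσ hr.ne' hy.ne'
  rw [hra, hen, inv_mul_cancel_left₀ hy.ne', mul_smul (dfFun q)⁻¹, hb, inv_smul_smul₀ hy.ne'] at hv
  refine ⟨hqX, h3, hflat, by rw [hen]; positivity, ?_⟩
  set v : Spacetime d := spacetimeVec (h * E) (-σ • ξ) with hv_def
  have hσ1 : |σ| = 1 := abs_eq_one_of_sq hσ
  have hs : 0 < dfFun q / pfFun q := by positivity
  have hv0 : ‖v‖ ≠ 0 := fun h0 => by
    rw [h5, norm_smul, h0, mul_zero] at h4; norm_num at h4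
  rw [hv, norm_smul, norm_mul, Real.norm_eq_abs, hσ1, one_mul, Real.norm_eq_abs, abs_of_pos hs]
  rw [h5, smul_smul, smul_smul]
  have h6 : l * ‖v‖ = 1 := by
    rwa [h5, norm_smul, norm_mul, Real.norm_eq_abs, Real.norm_eq_abs, abs_of_pos hl,
      abs_eq_one_of_sq hς, one_mul] at h4
  congr 1
  linear_combination dfFun q / pfFun q * ς * h6 - ς * (dfFun q / pfFun q) * hσ

theorem isClosed_radialLocus_conditions (σ ς : ℝ) : IsClosed {q : Ambient d | bfFun q = 0 ∧
    flatSymbol σ q = 0 ∧ 0 ≤ energyFun σ q ∧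
    ‖flatVelocity σ q‖ • dirFun q = (ς * σ) • flatVelocity σ q} := by
  have hv := (contDiff_flatVelocity (d := d) σ).continuous
  have hv' : Continuous fun q : Ambient d => (ς * σ) • flatVelocity σ q := by fun_prop
  refine (isClosed_eq contDiff_bfFun.continuous continuous_const).inter
    ((isClosed_eq (contDiff_flatSymbol σ).continuous continuous_const).inter
      ((isClosed_le continuous_const (continuous_energyFun σ)).inter
        (isClosed_eq (hv.norm.smul contDiff_dirFun.continuous) hv')))

theorem energyFun_normalizeFreq {q : Ambient d} (ha : 0 < nfFun q) (hy : 0 < dfFun q) (σ : ℝ)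
    (m : BaseAmbient d) : energyFun σ (m, normalizeFreq q) = (freqNorm q)⁻¹ * energyFun σ q := by
  have hc := freqNorm_pos hy
  have hn := blowNorm_pos ha
  change σ * ((pfFun q * blowNorm q) ^ 2 * (timeFun q * (freqNorm q)⁻¹ * (blowNorm q)⁻¹ ^ 2)) +
    dfFun q * (freqNorm q)⁻¹ = _
  rw [energyFun]
  field_simp

/-- Points of the radial locus with positive frequency components. -/
theorem mem_radialInterior {σ ς : ℝ} (hσ : σ ^ 2 = 1) {q : Ambient d}
    (hq : q ∈ radialLocus σ ς) (hr : 0 < pfFun q) (ha : 0 < nfFun q) (hy : 0 < dfFun q) :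
    q ∈ radialInterior σ ς := by
  obtain ⟨hqX, hm, hflat, he, hdir⟩ := hq
  have he' := energyFun_pos hσ hqX hflat he
  have hv0 := norm_pos_iff.2 (flatVelocity_ne_zero hσ hqX hflat he)
  obtain ⟨ζ, h1, h2⟩ := exists_freq_of_pos hqX hr ha hy
  have hE : √(1 + ‖((dfFun q)⁻¹ * pfFun q) • spaceFun q‖ ^ 2) = (dfFun q)⁻¹ * energyFun σ q := by
    rw [Real.sqrt_eq_iff_mul_self_eq (by positivity) (by positivity), norm_smul, Real.norm_eq_abs,
      abs_of_pos (mul_pos (inv_pos.2 hy) hr)]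
    have := energyFun_sq hσ hflat
    field_simp
    linarith
  refine ⟨pfFun q * nfFun q, ⟨mul_pos hr ha, hqX.2.2.2.2.1⟩, ((dfFun q)⁻¹ * pfFun q) • spaceFun q, ζ, ?_,
    (h2 0).symm, hm, dirFun_norm hqX hm, ‖flatVelocity σ q‖⁻¹ * (dfFun q / pfFun q), by positivity, ?_⟩
  · rw [h1, hE]
    congr 1
    rw [energyFun]
    field_simp
    linear_combination -(pfFun q ^ 2 * timeFun q) * hσ
  · rw [hE]
    have h3 : dirFun q = ‖flatVelocity σ q‖⁻¹ • (ς * σ) • flatVelocity σ q := by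
      rw [← hdir, inv_smul_smul₀ hv0.ne']
    rw [h3]
    nth_rw 2 [flatVelocity_eq hσ hr.ne' hy.ne']
    rw [smul_smul, smul_smul]
    congr 1
    linear_combination ‖flatVelocity σ q‖⁻¹ * ς * (dfFun q / pfFun q) * hσ

/-- The approximating points must keep to the mass shell: r, a, y are increased by ε, θ is
recomputed from the shell equation, the frequencies are normalized, and the direction is reset to
that of the new velocity, which is nonzero for small ε. -/
theorem tendsto_radialInterior {σ ς : ℝ} (hσ : σ ^ 2 = 1) (hς : ς ^ 2 = 1) {q : Ambient d}
    (hq : q ∈ radialLocus σ ς) : ∃ p : ℝ → Ambient d,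
    Tendsto p (𝓝[>] 0) (𝓝 q) ∧ ∀ᶠ ε in 𝓝[>] (0 : ℝ), p ε ∈ radialInterior σ ς := by
  obtain ⟨hqX, hm, hflat, he, hdir⟩ := hq
  have he' := energyFun_pos hσ hqX hflat he
  have hv0 := flatVelocity_ne_zero hσ hqX hflat he
  let D : ℝ → ℝ := fun ε => √((dfFun q + ε) ^ 2 + (pfFun q + ε) ^ 2 * ‖spaceFun q‖ ^ 2)
  -- The root of r²θ² + 2σθy = |b|² on the good sheet, in rationalized form: σθ = |b|²/(y + D) with
  -- D² = y² + r²|b|². It stays continuous at r = 0, since y + D tends to y + E > 0.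
  let f : ℝ → Ambient d := fun ε => (q.1, (pfFun q + ε, nfFun q + ε, dfFun q + ε,
    σ * ‖spaceFun q‖ ^ 2 * (dfFun q + ε + D ε)⁻¹, spaceFun q))
  have hD0 : D 0 = energyFun σ q := by
    simp only [D, add_zero]
    rw [← energyFun_sq hσ hflat, Real.sqrt_sq he]
  have hDc : Continuous D := by fun_prop
  have hy0 : 0 ≤ dfFun q := hqX.2.2.2.1
  have hfc : ContinuousAt f 0 := by
    have : ContinuousAt (fun ε => (dfFun q + ε + D ε)⁻¹) 0 := by
      refine ContinuousAt.inv₀ (by fun_prop) ?_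
      rw [hD0]; linarith
    fun_prop
  have hf0 : f 0 = q := by
    have : σ * ‖spaceFun q‖ ^ 2 * (dfFun q + 0 + D 0)⁻¹ = timeFun q := by
      rw [hD0, add_zero, mul_inv_eq_iff_eq_mul₀ (by linarith), energyFun]
      rw [flatSymbol] at hflat
      linear_combination -σ * hflat + 2 * timeFun q * dfFun q * hσ
    simp only [f, this]
    simp [pfFun, nfFun, dfFun, timeFun, spaceFun]
  let g : ℝ → Ambient d := fun ε => (q.1, normalizeFreq (f ε))
  have hg0 : g 0 = q := by
    simp only [g, hf0]
    exact Prod.ext rfl (normalizeFreq_eq hqX)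
  have hgc : ContinuousAt g 0 := continuousAt_const.prodMk
    (ContinuousAt.comp (f := f) (g := normalizeFreq)
      (by rw [hf0]; exact continuousAt_normalizeFreq hqX) hfc)
  have hvc : ContinuousAt (fun ε => flatVelocity σ (g ε)) 0 :=
    ((contDiff_flatVelocity σ).continuous.continuousAt).comp hgc
  have hvne : ∀ᶠ ε in 𝓝 (0 : ℝ), flatVelocity σ (g ε) ≠ 0 :=
    hvc.eventually_ne (by rw [hg0]; exact hv0)
  refine ⟨fun ε => ((0, (‖flatVelocity σ (g ε)‖⁻¹ * (ς * σ)) • flatVelocity σ (g ε)), (g ε).2), ?_, ?_⟩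
  · have h1 : ContinuousAt (fun ε => (((0 : ℝ), (‖flatVelocity σ (g ε)‖⁻¹ * (ς * σ)) •
        flatVelocity σ (g ε)), (g ε).2)) 0 := by
      have := hvc.norm.inv₀ (by rw [hg0]; exact norm_ne_zero_iff.2 hv0)
      exact (continuousAt_const.prodMk ((this.mul continuousAt_const).smul hvc)).prodMk hgc.snd
    have h2 := h1.tendsto.mono_left (nhdsWithin_le_nhds (s := Ioi 0))
    rw [hg0, mul_smul, ← hdir, inv_smul_smul₀ (norm_ne_zero_iff.2 hv0)] at h2
    rwa [show q = ((0, dirFun q), q.2) from Prod.ext (Prod.ext hm rfl) rfl]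
  · have hra : ∀ᶠ ε in 𝓝[>] (0 : ℝ), (pfFun q + ε) * (nfFun q + ε) < 1 := by
      have : Continuous fun ε : ℝ => (pfFun q + ε) * (nfFun q + ε) := by fun_prop
      exact (this.continuousAt.eventually_lt continuousAt_const (by simpa using hqX.2.2.2.2.1)).filter_mono
        nhdsWithin_le_nhds
    filter_upwards [hra, self_mem_nhdsWithin, hvne.filter_mono nhdsWithin_le_nhds] with ε hε hε0 hvε
    have hε0 : 0 < ε := hε0
    have hr : 0 < pfFun (f ε) := add_pos_of_nonneg_of_pos hqX.2.1 hε0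
    have ha : 0 < nfFun (f ε) := add_pos_of_nonneg_of_pos hqX.2.2.1 hε0
    have hy : 0 < dfFun (f ε) := add_pos_of_nonneg_of_pos hqX.2.2.2.1 hε0
    have hy' : 0 < dfFun q + ε := hy
    have hDp : 0 ≤ D ε := Real.sqrt_nonneg _
    have hD2 : D ε ^ 2 = (dfFun q + ε) ^ 2 + (pfFun q + ε) ^ 2 * ‖spaceFun q‖ ^ 2 :=
      Real.sq_sqrt (by positivity)
    have hflat' : flatSymbol σ (f ε) = 0 := by
      change (pfFun q + ε) ^ 2 * (σ * ‖spaceFun q‖ ^ 2 * (dfFun q + ε + D ε)⁻¹) ^ 2 - ‖spaceFun q‖ ^ 2 +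
        2 * σ * (σ * ‖spaceFun q‖ ^ 2 * (dfFun q + ε + D ε)⁻¹) * (dfFun q + ε) = 0
      field_simp
      linear_combination ‖spaceFun q‖ ^ 2 * ((pfFun q + ε) ^ 2 * ‖spaceFun q‖ ^ 2 +
        2 * (dfFun q + ε) * (dfFun q + ε + D ε)) * hσ - ‖spaceFun q‖ ^ 2 * hD2
    have hen : energyFun σ (f ε) = D ε := by
      change σ * ((pfFun q + ε) ^ 2 * (σ * ‖spaceFun q‖ ^ 2 * (dfFun q + ε + D ε)⁻¹)) + (dfFun q + ε) = D ε
      field_simp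
      linear_combination ((pfFun q + ε) ^ 2 * ‖spaceFun q‖ ^ 2) * hσ - hD2
    have hvn := norm_ne_zero_iff.2 hvε
    set v := flatVelocity σ (g ε) with hv
    have hnorm : ‖(‖v‖⁻¹ * (ς * σ)) • v‖ = 1 := by
      rw [norm_smul, norm_mul, norm_mul, norm_inv, norm_norm, Real.norm_eq_abs, Real.norm_eq_abs,
        abs_eq_one_of_sq hσ, abs_eq_one_of_sq hς]
      field_simp
    have hflat'' := flatSymbol_normalizeFreq ha hy σ (0, (‖v‖⁻¹ * (ς * σ)) • v)
    rw [hflat', mul_zero] at hflat''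
    have hen'' := energyFun_normalizeFreq ha hy σ (0, (‖v‖⁻¹ * (ς * σ)) • v)
    refine mem_radialInterior hσ ⟨normalizeFreq_mem ha hy hr hε ⟨le_rfl, ?_⟩, rfl, hflat'', ?_, ?_⟩ ?_ ?_ ?_
    · simp only [hnorm]; norm_num
    · refine hen''.ge.trans' ?_
      rw [hen]
      exact mul_nonneg (inv_nonneg.2 (freqNorm_pos hy).le) hDp
    · change ‖v‖ • ((‖v‖⁻¹ * (ς * σ)) • v) = (ς * σ) • v
      rw [smul_smul, mul_inv_cancel_left₀ hvn]
    · exact mul_pos hr (blowNorm_pos ha)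
    · exact mul_pos ha (inv_pos.2 (blowNorm_pos ha))
    · exact mul_pos hy (inv_pos.2 (freqNorm_pos hy))

/-- One inclusion holds because the equations of the locus are closed conditions, the other by
approximation. From here on the closure is replaced by equations. -/
theorem radialComponent_eq_radialLocus {σ ς : ℝ} (hσ : σ ^ 2 = 1) (hς : ς ^ 2 = 1) :
    (radialComponent σ ς : Set (Ambient d)) = radialLocus σ ς := by
  rw [radialComponent_eq]
  refine Subset.antisymm (fun q hq => ⟨hq.1, ?_⟩) fun q hq => ⟨hq.1, ?_⟩
  · exact closure_minimal (fun q hq => (radialInterior_subset_radialLocus hσ hς hq).2)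
      (isClosed_radialLocus_conditions σ ς) hq.2
  · obtain ⟨p, hp, hpR⟩ := tendsto_radialInterior hσ hς hq
    exact mem_closure_of_tendsto hp hpR

/-- A nonzero velocity cannot be aligned and opposite to the same direction. -/
theorem disjoint_radialLocus {σ : ℝ} (hσ : σ ^ 2 = 1) :
    Disjoint (radialLocus σ (-1) : Set (Ambient d)) (radialLocus σ 1) := by
  refine Set.disjoint_left.2 fun q h1 h2 => ?_
  have hv := flatVelocity_ne_zero hσ h1.1 h1.2.2.1 h1.2.2.2.1
  have h3 := h1.2.2.2.2.symm.trans h2.2.2.2.2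
  have h4 : (-1 * σ) = 1 * σ := smul_left_injective ℝ hv h3
  have : σ = 0 := by linarith
  simp [this] at hσ

theorem exists_natFreq_eq {h : ℝ} (hh : h ≠ 0) (n : Spacetime d) : ∃ ζ, natFreq h ζ = n := by
  refine ⟨spacetimeVec ((h ^ 2)⁻¹ * n 0) (h⁻¹ • spatial n), ?_⟩
  ext i
  refine Fin.cases ?_ (fun j => ?_) i
  · simp [hh]
  · simp [hh]

/-- The radial variable of the blowup in terms of the compactified natural frequency. -/
def compactRadius (h : ℝ) (y : Spacetime d) : ℝ := √(√(h ^ 4 + ‖spatial y‖ ^ 4 + y 0 ^ 2))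

/-- The frequency components of `phaseEmbed` in terms of the compactified natural frequency. -/
def compactFreq (h : ℝ) (y : BaseAmbient d) : ℝ × ℝ × ℝ × ℝ × EuclideanSpace ℝ (Fin d) :=
  (compactRadius h y.2, h / compactRadius h y.2, y.1, y.2 0 / compactRadius h y.2 ^ 2,
    (compactRadius h y.2)⁻¹ • spatial y.2)

theorem phaseEmbed_snd (h : ℝ) (z ζ : Spacetime d) :
    (phaseEmbed h z ζ).2 = compactFreq h (baseEmbed (natFreq h ζ)) := rfl

theorem continuousOn_compactFreq : ContinuousOn (fun x : ℝ × BaseAmbient d => compactFreq x.1 x.2)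
    (Ioi 0 ×ˢ univ) := by
  have hs : Continuous fun x : ℝ × BaseAmbient d => spatial x.2.2 :=
    (spatialCLM d).continuous.comp continuous_snd.snd
  have h0 : Continuous fun x : ℝ × BaseAmbient d => x.2.2 0 :=
    (EuclideanSpace.proj (0 : Fin (d + 1))).continuous.comp continuous_snd.snd
  have hr : ContinuousOn (fun x : ℝ × BaseAmbient d => compactRadius x.1 x.2.2) (Ioi 0 ×ˢ univ) := by
    have : Continuous fun x : ℝ × BaseAmbient d => compactRadius x.1 x.2.2 :=
      ((((continuous_fst.pow 4).add (hs.norm.pow 4)).add (h0.pow 2)).sqrt).sqrt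
    exact this.continuousOn
  have hr0 : ∀ x ∈ (Ioi 0 ×ˢ univ : Set (ℝ × BaseAmbient d)), compactRadius x.1 x.2.2 ≠ 0 := fun x hx =>
    (Real.sqrt_pos.2 (Real.sqrt_pos.2 (blowup_quartic_pos hx.1 _))).ne'
  have h1 : ContinuousOn (fun x : ℝ × BaseAmbient d => x.1 / compactRadius x.1 x.2.2) (Ioi 0 ×ˢ univ) :=
    continuousOn_fst.div hr hr0
  have h2 : ContinuousOn (fun x : ℝ × BaseAmbient d => x.2.2 0 / compactRadius x.1 x.2.2 ^ 2)
      (Ioi 0 ×ˢ univ) := h0.continuousOn.div (hr.pow 2) fun x hx => pow_ne_zero 2 (hr0 x hx)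
  have h3 : ContinuousOn (fun x : ℝ × BaseAmbient d => (compactRadius x.1 x.2.2)⁻¹ • spatial x.2.2)
      (Ioi 0 ×ˢ univ) := (hr.inv₀ hr0).smul hs.continuousOn
  exact hr.prodMk (h1.prodMk (continuous_snd.fst.continuousOn.prodMk (h2.prodMk h3)))

/-- Over h ∈ (0, 1) and finite frequencies the set is the continuous image of (0, 1) × ℝ^d, as the
direction is determined by (h, ξ). A set between a connected set and its closure is connected. -/
theorem isConnected_radialComponent (σ : ℝ) {ς : ℝ} (hς : ς ^ 2 = 1) :
    IsConnected (radialComponent σ ς : Set (Ambient d)) := by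
  let n : EuclideanSpace ℝ (Fin d) → Spacetime d := fun ξ => spacetimeVec (σ * (√(1 + ‖ξ‖ ^ 2) - 1)) ξ
  let v : ℝ × EuclideanSpace ℝ (Fin d) → Spacetime d := fun x =>
    spacetimeVec (x.1 * √(1 + ‖x.2‖ ^ 2)) (-σ • x.2)
  let G : ℝ × EuclideanSpace ℝ (Fin d) → Ambient d := fun x =>
    ((0, (ς * ‖v x‖⁻¹) • v x), compactFreq x.1 (baseEmbed (n x.2)))
  have hn : Continuous n :=
    (spacetimeVecCLM d).continuous.comp (f := fun ξ => (σ * (√(1 + ‖ξ‖ ^ 2) - 1), ξ)) (by fun_prop)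
  have hv : Continuous v := (spacetimeVecCLM d).continuous.comp
    (f := fun x : ℝ × EuclideanSpace ℝ (Fin d) => (x.1 * √(1 + ‖x.2‖ ^ 2), -σ • x.2)) (by fun_prop)
  have hv0 : ∀ x : ℝ × EuclideanSpace ℝ (Fin d), 0 < x.1 → ‖v x‖ ≠ 0 := by
    intro x hx h
    have h1 : x.1 * √(1 + ‖x.2‖ ^ 2) = 0 := congrArg (fun w : Spacetime d => w 0) (norm_eq_zero.1 h)
    exact (mul_pos hx (Real.sqrt_pos.2 (by positivity))).ne' h1
  have hG : ContinuousOn G (Ioo 0 1 ×ˢ univ) := by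
    have h1 : ContinuousOn (fun x => (ς * ‖v x‖⁻¹) • v x) (Ioo 0 1 ×ˢ univ) :=
      (continuousOn_const.mul (hv.norm.continuousOn.inv₀ fun x hx => hv0 x hx.1.1)).smul hv.continuousOn
    refine (continuousOn_const.prodMk h1).prodMk
      (continuousOn_compactFreq.comp (f := fun x : ℝ × EuclideanSpace ℝ (Fin d) => (x.1, baseEmbed (n x.2)))
        (continuous_fst.prodMk (differentiable_baseEmbed.continuous.comp
          (hn.comp continuous_snd))).continuousOn fun x hx => ⟨hx.1.1, trivial⟩)
  have himage : (radialInterior σ ς : Set (Ambient d)) = G '' (Ioo 0 1 ×ˢ univ) := by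
    ext q
    constructor
    · rintro ⟨h, hh, ξ, ζ, h1, h2, h3, h4, l, hl, h5⟩
      refine ⟨(h, ξ), ⟨hh, trivial⟩, ?_⟩
      have h6 : l = ‖v (h, ξ)‖⁻¹ := by
        rw [h5, norm_smul, norm_mul, Real.norm_eq_abs, Real.norm_eq_abs, abs_of_pos hl,
          abs_eq_one_of_sq hς, one_mul] at h4
        exact eq_inv_of_mul_eq_one_left h4
      refine Prod.ext (Prod.ext h3.symm ?_) ?_
      · change (ς * ‖v (h, ξ)‖⁻¹) • v (h, ξ) = dirFun q
        rw [h5, h6]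
      · rw [h2, phaseEmbed_snd, h1]
    · rintro ⟨⟨h, ξ⟩, ⟨hh, -⟩, rfl⟩
      obtain ⟨ζ, hζ⟩ := exists_natFreq_eq hh.1.ne' (n ξ)
      have hvx := hv0 (h, ξ) hh.1
      refine ⟨h, hh, ξ, ζ, hζ, by rw [phaseEmbed_snd, hζ], rfl, ?_, ‖v (h, ξ)‖⁻¹,
        inv_pos.2 ((norm_nonneg _).lt_of_ne' hvx), rfl⟩
      change ‖(ς * ‖v (h, ξ)‖⁻¹) • v (h, ξ)‖ = 1
      rw [norm_smul, norm_mul, norm_inv, norm_norm, Real.norm_eq_abs, abs_eq_one_of_sq hς, one_mul,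
        inv_mul_cancel₀ hvx]
  have hpre : IsPreconnected (radialInterior σ ς : Set (Ambient d)) := by
    rw [himage]
    exact (isPreconnected_Ioo.prod isPreconnected_univ).image G hG
  have hsub : (radialInterior σ ς : Set (Ambient d)) ⊆ radialComponent σ ς := fun q hq =>
    ⟨radialInterior_subset_phaseSpace σ ς hq, subset_closure hq⟩
  refine ⟨Set.Nonempty.mono hsub ?_, hpre.subset_closure hsub inter_subset_right⟩
  rw [himage]
  exact ⟨_, (2⁻¹, 0), ⟨by norm_num, trivial⟩, rfl⟩

section RadialSet

variable {N : ℝ × BaseAmbient d → Matrix (Fin (d + 1)) (Fin (d + 1)) ℝ} {σ ς : ℝ} {q : Ambient d}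

theorem resField_eq_zero_of_mem_radialLocus (hσ : σ ^ 2 = 1) (hς : ς ^ 2 = 1)
    (hq : q ∈ radialLocus σ ς) : resField N σ q = 0 := by
  obtain ⟨hqX, hm, hflat, he, hdir⟩ := hq
  have hn := dirFun_norm hqX hm
  have hv : velocity N σ q = flatVelocity σ q := velocity_eq_flatVelocity (by rw [hm, mul_zero])
  have hm' : q.1.1 = 0 := hm
  have hv' : flatVelocity σ q = (ς * σ * ‖flatVelocity σ q‖) • dirFun q := by
    rw [mul_smul, hdir, smul_smul, show ς * σ * (ς * σ) = ς ^ 2 * σ ^ 2 by ring, hς, hσ, one_mul, one_smul]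
  rw [resField, hm, zero_smul, hv, sphereField, hm', zero_mul, neg_zero]
  refine Prod.ext (Prod.ext rfl ?_) rfl
  change flatVelocity σ q - inner ℝ (flatVelocity σ q) (dirFun q) • dirFun q = 0
  rw [hv', inner_smul_left, real_inner_self_eq_norm_sq, hn]
  simp

/-- At bf a zero of the field means that v is parallel to n, and nothing more, since the frequencies
do not move there. The other two faces contribute no zeros off bf. -/
theorem mem_radialLocus_of_resField_eq_zero (hσ : σ = 1 ∨ σ = -1)
    (hN : ∀ x ∈ Ico (0 : ℝ) 1 ×ˢ baseSpace d, ∀ u : Fin (d + 1) → ℝ,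
      (∀ i, minkowskiSign i * u i + x.1 ^ 2 * x.2.1 * ∑ j, N x i j * u j = 0) → u = 0)
    (hqX : q ∈ phaseSpace d) (hP : resSymbol N σ q = 0)
    (hbd : dfFun q = 0 ∨ bfFun q = 0 ∨ nfFun q = 0) (he : 0 ≤ energyFun σ q)
    (hV : resField N σ q = 0) : q ∈ radialLocus σ (-1) ∪ radialLocus σ 1 := by
  have hσ2 : σ ^ 2 = 1 := by rcases hσ with h | h <;> simp [h]
  have h1 : sphereField q.1 (velocity N σ q) = 0 := congrArg Prod.fst hV
  have h1a : -(bfFun q * inner ℝ (velocity N σ q) (dirFun q)) = 0 := congrArg Prod.fst h1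
  have h1b : velocity N σ q - inner ℝ (velocity N σ q) (dirFun q) • dirFun q = 0 := congrArg Prod.snd h1
  by_cases hm : bfFun q = 0
  · have hflat : flatSymbol σ q = 0 := by
      rw [← hP]; exact (resSymbol_eq_flatSymbol (by rw [hm, mul_zero])).symm
    rw [velocity_eq_flatVelocity (by rw [hm, mul_zero])] at h1b
    have hn := dirFun_norm hqX hm
    set s : ℝ := inner ℝ (flatVelocity σ q) (dirFun q) with hs
    have hv : flatVelocity σ q = s • dirFun q := sub_eq_zero.1 h1b
    have hnorm : ‖flatVelocity σ q‖ = |s| := by rw [hv, norm_smul, hn, mul_one, Real.norm_eq_abs]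
    -- The sign ς is σ times that of ⟨v, n⟩.
    have key : ∀ ς : ℝ, |s| = ς * σ * s → q ∈ radialLocus σ ς := fun ς h =>
      ⟨hqX, hm, hflat, he, by rw [hnorm, h, mul_smul, ← hv]⟩
    rcases hσ with rfl | rfl <;> rcases le_total 0 s with h | h
    · exact Or.inr (key _ (by rw [abs_of_nonneg h]; ring))
    · exact Or.inl (key _ (by rw [abs_of_nonpos h]; ring))
    · exact Or.inl (key _ (by rw [abs_of_nonneg h]; ring))
    · exact Or.inr (key _ (by rw [abs_of_nonpos h]; ring))
  -- Off bf the m-component forces the velocity to be orthogonal to n, and then the n-component says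
  -- that the velocity itself vanishes.
  · exfalso
    have hs : inner ℝ (velocity N σ q) (dirFun q) = (0 : ℝ) :=
      (mul_eq_zero.1 (neg_eq_zero.1 h1a)).resolve_left hm
    rw [hs, zero_smul, sub_zero] at h1b
    by_cases ha : nfFun q = 0
    · have hh : (pfFun q * nfFun q) * bfFun q = 0 := by rw [ha]; ring
      rw [velocity_eq_flatVelocity hh] at h1b
      rw [resSymbol_eq_flatSymbol hh] at hP
      exact flatVelocity_ne_zero hσ2 hqX hP he h1b
    -- At fiber infinity the term σy drops out, so the vanishing velocity is the raised covector up
    -- to the factors a and r, which are nonzero here. Nondegeneracy of the metric then kills the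
    -- frequency, which has norm one.
    · have hy : dfFun q = 0 := by tauto
      have hsph := phaseSpace_sphere hqX
      have hr : pfFun q ≠ 0 := fun h => by rw [hy, h] at hsph; norm_num at hsph
      set w := raise N (metricArg q) (blowFreq q) with hw
      have h2 : nfFun q * (σ * dfFun q - pfFun q * w 0) = 0 :=
        congrArg (fun v : Spacetime d => v 0) h1b
      have hw0 : w 0 = 0 := by
        have := (mul_eq_zero.1 h2).resolve_left ha
        rw [hy, mul_zero, zero_sub, neg_eq_zero] at this
        exact (mul_eq_zero.1 this).resolve_left hr
      have hwx : ∀ j, w (Fin.succ j) = 0 := fun j => by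
        have := congrArg (fun v : Spacetime d => v j.succ) h1b
        simpa [velocity] using this
      have hu : (fun i => blowFreq q i) = 0 := by
        refine hN (metricArg q) ⟨⟨mul_nonneg hqX.2.1 hqX.2.2.1, hqX.2.2.2.2.1⟩, hqX.1⟩ _ fun i => ?_
        change w i = 0
        exact Fin.cases hw0 hwx i
      have hθ : pfFun q * timeFun q = 0 := congrFun hu 0
      have hb : spaceFun q = 0 := by
        ext j
        simpa [blowFreq] using congrFun hu j.succ
      rw [hy, hb, show pfFun q ^ 2 * timeFun q = pfFun q * (pfFun q * timeFun q) by ring, hθ] at hsph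
      norm_num at hsph

end RadialSet

end NonrelKG
end

noncomputable section
namespace NonrelKG

variable {d : ℕ}

/-! ### The radial set as a p-submanifold -/

/-- The functions that cut out the phase space and the part of the zero set in `bf`. -/
def faceFun (σ : ℝ) : Fin 8 → Ambient d → ℝ :=
  ![fun q => bfFun q ^ 2 + ‖dirFun q‖ ^ 2 - 1,
    fun q => nfFun q ^ 4 + (‖spaceFun q‖ ^ 2) ^ 2 + timeFun q ^ 2 - 1,
    fun q => dfFun q ^ 2 + pfFun q ^ 2 * ‖spaceFun q‖ ^ 2 + (pfFun q ^ 2 * timeFun q) ^ 2 - 1,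
    bfFun, pfFun, nfFun, dfFun, flatSymbol σ]

/-- Vanishes if `n`, `e` cannot distinguish the direction from that of the velocity. -/
def alignFun (σ : ℝ) (n e : Spacetime d) (q : Ambient d) : ℝ :=
  inner ℝ n (flatVelocity σ q) * inner ℝ e (dirFun q) - inner ℝ n (dirFun q) * inner ℝ e (flatVelocity σ q)

theorem contDiff_faceFun (σ : ℝ) (i : Fin 8) : ContDiff ℝ ∞ (faceFun σ i : Ambient d → ℝ) := by
  have h1 : ContDiff ℝ ∞ fun q : Ambient d => ‖dirFun q‖ ^ 2 := contDiff_dirFun.norm_sq ℝ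
  have h2 : ContDiff ℝ ∞ fun q : Ambient d => ‖spaceFun q‖ ^ 2 := contDiff_spaceFun.norm_sq ℝ
  have h3 := contDiff_flatSymbol (d := d) σ
  fin_cases i <;> simp only [faceFun] <;> simp <;> fun_prop

theorem contDiff_alignFun (σ : ℝ) (n e : Spacetime d) : ContDiff ℝ ∞ (alignFun σ n e) := by
  have hv := contDiff_flatVelocity (d := d) σ
  exact ((contDiff_const.inner ℝ hv).mul (contDiff_const.inner ℝ contDiff_dirFun)).sub
    ((contDiff_const.inner ℝ contDiff_dirFun).mul (contDiff_const.inner ℝ hv))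

/-- The bound h < 1 is an open condition, so it is only assumed locally and does not count among the
defining functions. -/
theorem mem_phaseSpace_iff {σ : ℝ} {q : Ambient d} (h : pfFun q * nfFun q < 1) : q ∈ phaseSpace d ↔
    (faceFun σ 0 q = 0 ∧ faceFun σ 1 q = 0 ∧ faceFun σ 2 q = 0) ∧
    0 ≤ faceFun σ 3 q ∧ 0 ≤ faceFun σ 4 q ∧ 0 ≤ faceFun σ 5 q ∧ 0 ≤ faceFun σ 6 q := by
  have e : ‖pfFun q • spaceFun q‖ ^ 2 = pfFun q ^ 2 * ‖spaceFun q‖ ^ 2 := by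
    rw [norm_smul, mul_pow, Real.norm_eq_abs, sq_abs]
  have e' : (‖spaceFun q‖ ^ 2) ^ 2 = ‖spaceFun q‖ ^ 4 := by ring
  simp only [faceFun, phaseSpace, mem_ofPred_eq, baseSpace, e]
  simp [sub_eq_zero, e']
  change (0 ≤ bfFun q ∧ bfFun q ^ 2 + ‖dirFun q‖ ^ 2 = 1) ∧ _ ↔ _
  tauto

theorem fderiv_apply_eq {G : Type*} [NormedAddCommGroup G] [NormedSpace ℝ G] {f : Ambient d → G}
    (hf : ContDiff ℝ ∞ f) {q w : Ambient d} {l : G}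
    (h : HasDerivAt (fun t : ℝ => f (q + t • w)) l 0) : fderiv ℝ f q w = l := by
  have h1 : HasDerivAt (fun t : ℝ => q + t • w) w 0 := by
    simpa using ((hasDerivAt_id (0 : ℝ)).smul_const w).const_add q
  have h2 : HasFDerivAt f (fderiv ℝ f q) (q + (0 : ℝ) • w) := by
    rw [zero_smul, add_zero]; exact (hf.differentiable (by simp) q).hasFDerivAt
  exact (h2.comp_hasDerivAt (0 : ℝ) h1).unique h

section Line

variable (q w : Ambient d)

theorem hasDerivAt_line :
    HasDerivAt (fun t : ℝ => bfFun (q + t • w)) (bfFun w) 0 ∧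
    HasDerivAt (fun t : ℝ => dirFun (q + t • w)) (dirFun w) 0 ∧
    HasDerivAt (fun t : ℝ => pfFun (q + t • w)) (pfFun w) 0 ∧
    HasDerivAt (fun t : ℝ => nfFun (q + t • w)) (nfFun w) 0 ∧
    HasDerivAt (fun t : ℝ => dfFun (q + t • w)) (dfFun w) 0 ∧
    HasDerivAt (fun t : ℝ => timeFun (q + t • w)) (timeFun w) 0 ∧
    HasDerivAt (fun t : ℝ => spaceFun (q + t • w)) (spaceFun w) 0 := by
  have key : ∀ {G : Type} [NormedAddCommGroup G] [NormedSpace ℝ G] (x y : G),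
      HasDerivAt (fun t : ℝ => x + t • y) y 0 := fun x y => by
    simpa using ((hasDerivAt_id (0 : ℝ)).smul_const y).const_add x
  exact ⟨key q.1.1 w.1.1, key q.1.2 w.1.2, key q.2.1 w.2.1, key q.2.2.1 w.2.2.1, key q.2.2.2.1 w.2.2.2.1,
    key q.2.2.2.2.1 w.2.2.2.2.1, key q.2.2.2.2.2 w.2.2.2.2.2⟩

section Coordinates

variable (m : BaseAmbient d) (r a y θ : ℝ) (b : EuclideanSpace ℝ (Fin d))
  (f : ℝ × ℝ × ℝ × ℝ × EuclideanSpace ℝ (Fin d))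

@[simp] theorem bfFun_mk : bfFun (m, f) = m.1 := rfl
@[simp] theorem dirFun_mk : dirFun (m, f) = m.2 := rfl
@[simp] theorem pfFun_mk : pfFun (m, (r, a, y, θ, b)) = r := rfl
@[simp] theorem nfFun_mk : nfFun (m, (r, a, y, θ, b)) = a := rfl
@[simp] theorem dfFun_mk : dfFun (m, (r, a, y, θ, b)) = y := rfl
@[simp] theorem timeFun_mk : timeFun (m, (r, a, y, θ, b)) = θ := rfl
@[simp] theorem spaceFun_mk : spaceFun (m, (r, a, y, θ, b)) = b := rfl

end Coordinates

/-- The derivatives of `faceFun`. -/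
def faceDeriv (σ : ℝ) : Fin 8 → ℝ :=
  ![2 * bfFun q * bfFun w + 2 * inner ℝ (dirFun q) (dirFun w),
    4 * nfFun q ^ 3 * nfFun w + 4 * ‖spaceFun q‖ ^ 2 * inner ℝ (spaceFun q) (spaceFun w)
      + 2 * timeFun q * timeFun w,
    2 * dfFun q * dfFun w + (2 * pfFun q * pfFun w * ‖spaceFun q‖ ^ 2
      + pfFun q ^ 2 * (2 * inner ℝ (spaceFun q) (spaceFun w)))
      + 2 * (pfFun q ^ 2 * timeFun q) * (2 * pfFun q * pfFun w * timeFun q + pfFun q ^ 2 * timeFun w),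
    bfFun w, pfFun w, nfFun w, dfFun w,
    2 * pfFun q * pfFun w * timeFun q ^ 2 + pfFun q ^ 2 * (2 * timeFun q * timeFun w)
      - 2 * inner ℝ (spaceFun q) (spaceFun w) + (2 * σ * timeFun w * dfFun q + 2 * σ * timeFun q * dfFun w)]

theorem fderiv_faceFun (σ : ℝ) (i : Fin 8) : fderiv ℝ (faceFun σ i) q w = faceDeriv q w σ i := by
  refine fderiv_apply_eq (contDiff_faceFun σ i) ?_
  obtain ⟨hm, hn, hr, ha, hy, hθ, hb⟩ := hasDerivAt_line q w
  have hnn : HasDerivAt (fun t : ℝ => ‖dirFun (q + t • w)‖ ^ 2) (2 * inner ℝ (dirFun q) (dirFun w)) 0 := by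
    simpa using hn.norm_sq
  have hbb : HasDerivAt (fun t : ℝ => ‖spaceFun (q + t • w)‖ ^ 2)
      (2 * inner ℝ (spaceFun q) (spaceFun w)) 0 := by simpa using hb.norm_sq
  fin_cases i
  · refine (((hm.fun_pow 2).fun_add hnn).sub_const 1).congr_deriv ?_
    simp [faceDeriv]
  · refine ((((ha.fun_pow 4).fun_add (hbb.fun_pow 2)).fun_add (hθ.fun_pow 2)).sub_const 1).congr_deriv ?_
    simp [faceDeriv]; ring
  · refine ((((hy.fun_pow 2).fun_add ((hr.fun_pow 2).fun_mul hbb)).fun_add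
      (((hr.fun_pow 2).fun_mul hθ).fun_pow 2)).sub_const 1).congr_deriv ?_
    simp [faceDeriv]
  · exact hm
  · exact hr
  · exact ha
  · exact hy
  · refine (((((hr.fun_pow 2).fun_mul (hθ.fun_pow 2)).fun_sub hbb).fun_add
      ((hθ.const_mul (2 * σ)).fun_mul hy))).congr_deriv ?_
    simp [faceDeriv]

theorem fderiv_alignFun_base (σ : ℝ) (n e : Spacetime d) (hw : w.2 = 0) : fderiv ℝ (alignFun σ n e) q w =
    inner ℝ n (flatVelocity σ q) * inner ℝ e (dirFun w) - inner ℝ n (dirFun w) * inner ℝ e (flatVelocity σ q) := by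
  refine fderiv_apply_eq (contDiff_alignFun σ n e) ?_
  obtain ⟨-, hn, -⟩ := hasDerivAt_line q w
  have hv : ∀ t : ℝ, flatVelocity σ (q + t • w) = flatVelocity σ q := fun t => by
    have : (q + t • w).2 = q.2 := by rw [Prod.snd_add, Prod.smul_snd, hw, smul_zero, add_zero]
    simp only [flatVelocity, nfFun, pfFun, timeFun, dfFun, spaceFun, this]
  have h1 : HasDerivAt (fun t : ℝ => inner ℝ e (dirFun (q + t • w))) (inner ℝ e (dirFun w)) 0 := by
    simpa using (hasDerivAt_const (0 : ℝ) e).inner ℝ hn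
  have h2 : HasDerivAt (fun t : ℝ => inner ℝ n (dirFun (q + t • w))) (inner ℝ n (dirFun w)) 0 := by
    simpa using (hasDerivAt_const (0 : ℝ) n).inner ℝ hn
  simp only [alignFun, hv]
  exact (h1.const_mul _).sub (h2.mul_const _)

end Line

section Radial

variable {σ ς : ℝ} {q : Ambient d}

theorem flatVelocity_of_mem_radialLocus (hσ : σ ^ 2 = 1) (hς : ς ^ 2 = 1) (hq : q ∈ radialLocus σ ς) :
    flatVelocity σ q = (ς * σ * ‖flatVelocity σ q‖) • dirFun q := by
  rw [mul_smul, hq.2.2.2.2, smul_smul, show ς * σ * (ς * σ) = ς ^ 2 * σ ^ 2 by ring, hς, hσ, one_mul, one_smul]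

/-- The differentials of the functions that define the radial set are independent. -/
theorem faceFun_alignFun_independent (hσ : σ ^ 2 = 1) (hς : ς ^ 2 = 1) (hq : q ∈ radialLocus σ ς)
    {k : ℕ} {e : Fin k → Spacetime d} (he : Orthonormal ℝ e) (hen : ∀ i, inner ℝ (e i) (dirFun q) = (0 : ℝ))
    (c : Fin 8 ⊕ Fin k → ℝ)
    (h0 : ∀ i, c i * (Sum.elim (faceFun σ) (fun i => alignFun σ (dirFun q) (e i)) i) q = 0)
    (h1 : ∑ i, c i • fderiv ℝ (Sum.elim (faceFun σ) (fun i => alignFun σ (dirFun q) (e i)) i) q = 0)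
    (i : Fin 8 ⊕ Fin k) : c i = 0 := by
  obtain ⟨hqX, hm, hflat, hE, hdir⟩ := hq
  have hv0 := norm_pos_iff.2 (flatVelocity_ne_zero hσ hqX hflat hE)
  have hE' := energyFun_pos hσ hqX hflat hE
  have hv := flatVelocity_of_mem_radialLocus hσ hς ⟨hqX, hm, hflat, hE, hdir⟩
  have hn := dirFun_norm hqX hm
  have hsph := phaseSpace_sphere hqX
  have hblow := hqX.2.2.2.2.2.1
  set s := ς * σ * ‖flatVelocity σ q‖ with hs
  have hs0 : s ≠ 0 := by
    refine mul_ne_zero (mul_ne_zero ?_ ?_) hv0.ne' <;> rintro rfl <;> norm_num at *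
  have key : ∀ w : Ambient d, ∑ i, c (Sum.inl i) * faceDeriv q w σ i +
      ∑ i, c (Sum.inr i) * fderiv ℝ (alignFun σ (dirFun q) (e i)) q w = 0 := fun w => by
    have := congrArg (fun L : Ambient d →L[ℝ] ℝ => L w) h1
    simpa [Fintype.sum_sum_type, sum_apply, fderiv_faceFun] using this
  -- Test vectors along the base isolate the coefficients of m, of the base sphere and of the
  -- alignments. Because `e i` is orthogonal to n, the alignment differentials reduce to `s * inner
  -- (e i)`.
  have keyb : ∀ μ : BaseAmbient d, c (Sum.inl 0) * (2 * inner ℝ (dirFun q) μ.2) + c (Sum.inl 3) * μ.1 +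
      ∑ i, c (Sum.inr i) * (s * inner ℝ (e i) μ.2) = 0 := fun μ => by
    have := key (μ, (0, 0, 0, 0, 0))
    rw [Fin.sum_univ_eight] at this
    have h2 : ∀ i, fderiv ℝ (alignFun σ (dirFun q) (e i)) q (μ, (0, 0, 0, 0, 0)) = s * inner ℝ (e i) μ.2 := fun i => by
      rw [fderiv_alignFun_base _ _ _ _ _ rfl, hv, inner_smul_right, inner_smul_right, hen i,
        real_inner_self_eq_norm_sq, hn]
      simp
    simp only [h2] at this
    rw [← this]
    simp [faceDeriv, hm]
  have hc3 : c (Sum.inl 3) = 0 := by simpa using keyb (1, 0)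
  have hc0 : c (Sum.inl 0) = 0 := by
    have := keyb (0, dirFun q)
    simpa [hen, hn] using this
  have hcr : ∀ j, c (Sum.inr j) = 0 := fun j => by
    have := keyb (0, e j)
    simpa [hc0, orthonormal_iff_ite.1 he, hs0] using this
  have keyf : ∀ w : Ambient d, c (Sum.inl 1) * faceDeriv q w σ 1 + c (Sum.inl 2) * faceDeriv q w σ 2 +
      c (Sum.inl 4) * pfFun w + c (Sum.inl 5) * nfFun w + c (Sum.inl 6) * dfFun w +
      c (Sum.inl 7) * faceDeriv q w σ 7 = 0 := fun w => by
    have := key w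
    simpa [Fin.sum_univ_eight, hcr, hc0, hc3, show faceDeriv q w σ 4 = pfFun w from rfl,
      show faceDeriv q w σ 5 = nfFun w from rfl, show faceDeriv q w σ 6 = dfFun w from rfl] using this
  have s4 : c (Sum.inl 4) * pfFun q = 0 := h0 (Sum.inl 4)
  have s5 : c (Sum.inl 5) * nfFun q = 0 := h0 (Sum.inl 5)
  have s6 : c (Sum.inl 6) * dfFun q = 0 := h0 (Sum.inl 6)
  have hflat' := hflat
  rw [flatSymbol] at hflat'
  have hc1 : c (Sum.inl 1) = 0 := by
    -- The generator of the parabolic scaling: it fixes ra, rb, r²θ and so annihilates the equation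
    -- of the compactified frequency, changes the blowup equation at rate 4, and multiplies the
    -- symbol, which is zero here.
    have := keyf (0, (-pfFun q, nfFun q, 0, 2 * timeFun q, spaceFun q))
    simp only [faceDeriv] at this
    simp at this
    linear_combination 4⁻¹ * this - c (Sum.inl 1) * hblow + 4⁻¹ * s4 - 4⁻¹ * s5 - 2⁻¹ * c (Sum.inl 7) * hflat'
  have hc2 : c (Sum.inl 2) = 0 := by
    -- The scaling of y, θ, b changes the second sphere equation at rate 2 and again multiplies the
    -- symbol.
    have := keyf (0, (0, 0, dfFun q, timeFun q, spaceFun q))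
    simp only [faceDeriv, hc1] at this
    simp at this
    linear_combination 2⁻¹ * this - c (Sum.inl 2) * hsph - 2⁻¹ * s6 - c (Sum.inl 7) * hflat'
  have hc7 : c (Sum.inl 7) = 0 := by
    -- The θ-derivative of the symbol is 2σE, which is nonzero on the good sheet.
    have := keyf (0, (0, 0, 0, 1, 0))
    simp only [faceDeriv, hc1, hc2] at this
    simp at this
    refine this.resolve_right fun h => hE'.ne' ?_
    rw [energyFun]
    linear_combination 2⁻¹ * σ * h - dfFun q * hσ
  have hc4 : c (Sum.inl 4) = 0 := by simpa [hc1, hc2, hc7] using keyf (0, (1, 0, 0, 0, 0))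
  have hc5 : c (Sum.inl 5) = 0 := by simpa [hc1, hc2, hc7] using keyf (0, (0, 1, 0, 0, 0))
  have hc6 : c (Sum.inl 6) = 0 := by simpa [hc1, hc2, hc7] using keyf (0, (0, 0, 1, 0, 0))
  rcases i with i | i
  · fin_cases i <;> assumption
  · exact hcr i

/-- Near a point of the radial set, it is given by the vanishing of the alignment functions. -/
theorem exists_alignFun (hσ : σ ^ 2 = 1) (hς : ς ^ 2 = 1) (hq : q ∈ radialLocus σ ς) :
    ∃ (k : ℕ) (e : Fin k → Spacetime d) (U : Set (Ambient d)), IsOpen U ∧ q ∈ U ∧ Orthonormal ℝ e ∧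
      (∀ i, inner ℝ (e i) (dirFun q) = (0 : ℝ)) ∧
      (∀ u ∈ U, pfFun u * nfFun u < 1 ∧ 0 < energyFun σ u) ∧
      ∀ u ∈ U, u ∈ radialLocus σ ς ↔ u ∈ phaseSpace d ∧ bfFun u = 0 ∧ flatSymbol σ u = 0 ∧
        ∀ i, alignFun σ (dirFun q) (e i) u = 0 := by
  have hE' := energyFun_pos hσ hq.1 hq.2.2.1 hq.2.2.2.1
  have hv0 := norm_pos_iff.2 (flatVelocity_ne_zero hσ hq.1 hq.2.2.1 hq.2.2.2.1)
  have hv := flatVelocity_of_mem_radialLocus hσ hς hq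
  have hn := dirFun_norm hq.1 hq.2.1
  set n := dirFun q with hn_def
  let b := stdOrthonormalBasis ℝ (ℝ ∙ n)ᗮ
  have hςσ : (ς * σ) * (ς * σ) = 1 := by linear_combination hς * σ ^ 2 + hσ
  have hvc := (contDiff_flatVelocity (d := d) σ).continuous
  have hnc := (contDiff_dirFun (d := d)).continuous
  have hni : Continuous fun u : Ambient d => inner ℝ n (dirFun u) := (innerSL ℝ n).continuous.comp hnc
  have hvi : Continuous fun u : Ambient d => inner ℝ n (flatVelocity σ u) := (innerSL ℝ n).continuous.comp hvc
  have hbe : ∀ i, inner ℝ ((b i : (ℝ ∙ n)ᗮ) : Spacetime d) n = (0 : ℝ) := fun i => by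
    rw [real_inner_comm]; exact Submodule.mem_orthogonal_singleton_iff_inner_right.1 (b i).2
  -- The alignment functions cannot tell v/|v| from -v/|v|. The last two conditions on the
  -- neighbourhood select the sign belonging to ς.
  refine ⟨_, fun i => ((b i : (ℝ ∙ n)ᗮ) : Spacetime d), {u | pfFun u * nfFun u < 1 ∧ 0 < energyFun σ u ∧
    0 < inner ℝ n (dirFun u) ∧ 0 < ς * σ * inner ℝ n (flatVelocity σ u)}, ?_, ?_, ?_, hbe, ?_, ?_⟩
  · have h1 : IsOpen {u : Ambient d | pfFun u * nfFun u < 1} :=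
      isOpen_lt (contDiff_pfFun.continuous.mul contDiff_nfFun.continuous) continuous_const
    have h2 : IsOpen {u : Ambient d | 0 < energyFun σ u} := isOpen_lt continuous_const (continuous_energyFun σ)
    have h3 : IsOpen {u : Ambient d | 0 < inner ℝ n (dirFun u)} := isOpen_lt continuous_const hni
    have h4 : IsOpen {u : Ambient d | 0 < ς * σ * inner ℝ n (flatVelocity σ u)} :=
      isOpen_lt continuous_const (continuous_const.mul hvi)
    exact h1.inter (h2.inter (h3.inter h4))
  · refine ⟨hq.1.2.2.2.2.1, hE', ?_, ?_⟩
    · rw [← hn_def, real_inner_self_eq_norm_sq, hn]; norm_num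
    · rw [hv, inner_smul_right, real_inner_self_eq_norm_sq, hn]
      rw [show ς * σ * (ς * σ * ‖flatVelocity σ q‖ * 1 ^ 2) = ‖flatVelocity σ q‖ by
        linear_combination ‖flatVelocity σ q‖ * hςσ]
      exact hv0
  · exact b.orthonormal.comp_linearIsometry (Submodule.subtypeₗᵢ _)
  · exact fun u hu => ⟨hu.1, hu.2.1⟩
  · rintro u ⟨hu1, hu2, hu3, hu4⟩
    constructor
    · intro h
      refine ⟨h.1, h.2.1, h.2.2.1, fun i => ?_⟩
      rw [alignFun, flatVelocity_of_mem_radialLocus hσ hς h, inner_smul_right, inner_smul_right]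
      ring
    · rintro ⟨h1, h2, h3, h4⟩
      refine ⟨h1, h2, h3, hu2.le, ?_⟩
      -- This vector is orthogonal to n by construction, and to the basis of the complement of n by
      -- the vanishing of the alignment functions.
      have hpar : inner ℝ n (flatVelocity σ u) • dirFun u - inner ℝ n (dirFun u) • flatVelocity σ u = 0 := by
        set x := inner ℝ n (flatVelocity σ u) • dirFun u - inner ℝ n (dirFun u) • flatVelocity σ u with hx
        have hxn : inner ℝ n x = (0 : ℝ) := by
          rw [hx, inner_sub_right, inner_smul_right, inner_smul_right]; ring
        let x' : (ℝ ∙ n)ᗮ := ⟨x, Submodule.mem_orthogonal_singleton_iff_inner_right.2 hxn⟩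
        have : x' = 0 := by
          refine InnerProductSpace.ext_inner_left_basis b.toBasis fun i => ?_
          rw [inner_zero_right, OrthonormalBasis.coe_toBasis, Submodule.coe_inner]
          change inner ℝ ((b i : (ℝ ∙ n)ᗮ) : Spacetime d) x = 0
          rw [hx, inner_sub_right, inner_smul_right, inner_smul_right]
          exact h4 i
        exact congrArg Subtype.val this
      have hun := dirFun_norm h1 h2
      set c := inner ℝ n (dirFun u) with hc
      set l := inner ℝ n (flatVelocity σ u) with hl
      have hvu : flatVelocity σ u = (c⁻¹ * l) • dirFun u := by
        rw [mul_smul, sub_eq_zero.1 hpar, inv_smul_smul₀ hu3.ne']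
      have hnorm : ‖flatVelocity σ u‖ = ς * σ * (c⁻¹ * l) := by
        rw [hvu, norm_smul, hun, mul_one, Real.norm_eq_abs, ← abs_of_pos (show 0 < ς * σ * (c⁻¹ * l) by
          rw [show ς * σ * (c⁻¹ * l) = c⁻¹ * (ς * σ * l) by ring]
          exact mul_pos (inv_pos.2 hu3) hu4), abs_mul (ς * σ), show |ς * σ| = 1 from
            abs_eq_one_of_sq (by rw [sq, hςσ]), one_mul]
      rw [hnorm, mul_smul, ← hvu]

theorem radialLocus_isPSubmanifold (hσ : σ ^ 2 = 1) (hς : ς ^ 2 = 1) :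
    IsPSubmanifold (phaseSpace d) (radialLocus σ ς) := by
  refine isPSubmanifold_of_local (fun q hq => hq.1) fun q hq => ?_
  obtain ⟨k, e, U, hU, hqU, he, hen, hU1, hU2⟩ := exists_alignFun hσ hς hq
  refine ⟨Fin 8 ⊕ Fin k, inferInstance, Sum.elim (faceFun σ) fun i => alignFun σ (dirFun q) (e i),
    {Sum.inl 0, Sum.inl 1, Sum.inl 2}, {Sum.inl 3, Sum.inl 4, Sum.inl 5, Sum.inl 6},
    {Sum.inl 3, Sum.inl 7} ∪ range Sum.inr, U, hU, hqU, ?_, ?_, ?_,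
    faceFun_alignFun_independent hσ hς hq he hen⟩
  · rintro (i | i)
    · exact (contDiff_faceFun σ i).contDiffOn
    · exact (contDiff_alignFun σ _ _).contDiffOn
  · intro u hu
    rw [mem_phaseSpace_iff (σ := σ) (hU1 u hu).1]
    simp
  · intro u hu
    rw [hU2 u hu]
    simp [or_imp, forall_and, faceFun, and_assoc]

/-- The same functions serve as for the phase space; only m and the flat symbol change from
equations of the submanifold to equations of the surrounding set. -/
theorem radialLocus_isPSubmanifold_of_eq (hσ : σ ^ 2 = 1) (hς : ς ^ 2 = 1) {X : Set (Ambient d)}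
    (hX : ∀ u, 0 < energyFun σ u → (u ∈ X ↔ u ∈ phaseSpace d ∧ bfFun u = 0 ∧ flatSymbol σ u = 0)) :
    IsPSubmanifold X (radialLocus σ ς) := by
  refine isPSubmanifold_of_local (fun q hq => (hX q (energyFun_pos hσ hq.1 hq.2.2.1 hq.2.2.2.1)).2
    ⟨hq.1, hq.2.1, hq.2.2.1⟩) fun q hq => ?_
  obtain ⟨k, e, U, hU, hqU, he, hen, hU1, hU2⟩ := exists_alignFun hσ hς hq
  refine ⟨Fin 8 ⊕ Fin k, inferInstance, Sum.elim (faceFun σ) fun i => alignFun σ (dirFun q) (e i),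
    {Sum.inl 0, Sum.inl 1, Sum.inl 2, Sum.inl 3, Sum.inl 7}, {Sum.inl 4, Sum.inl 5, Sum.inl 6},
    range Sum.inr, U, hU, hqU, ?_, ?_, ?_, faceFun_alignFun_independent hσ hς hq he hen⟩
  · rintro (i | i)
    · exact (contDiff_faceFun σ i).contDiffOn
    · exact (contDiff_alignFun σ _ _).contDiffOn
  · intro u hu
    rw [hX u (hU1 u hu).2, mem_phaseSpace_iff (σ := σ) (hU1 u hu).1]
    simp only [mem_insert_iff, mem_singleton_iff, forall_eq_or_imp, forall_eq, Sum.elim_inl]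
    have h3 : faceFun σ 3 u = bfFun u := rfl
    have h7 : faceFun σ 7 u = flatSymbol σ u := rfl
    rw [h3, h7]
    exact ⟨fun h => ⟨⟨h.1.1.1, h.1.1.2.1, h.1.1.2.2, h.2⟩, h.1.2.2⟩, fun h =>
      ⟨⟨⟨h.1.1, h.1.2.1, h.1.2.2.1⟩, h.1.2.2.2.1.ge, h.2⟩, h.1.2.2.2⟩⟩
  · intro u hu
    rw [hU2 u hu, hX u (hU1 u hu).2]
    simp [and_assoc]

end Radial

end NonrelKG
end

noncomputable section
namespace NonrelKG

variable {d : ℕ}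

/-! ### Invariance of the characteristic set -/

section Invariance

variable {N : ℝ × BaseAmbient d → Matrix (Fin (d + 1)) (Fin (d + 1)) ℝ}

@[simp] theorem bfFun_resField (σ : ℝ) (q : Ambient d) : bfFun (resField N σ q) =
    -(bfFun q * inner ℝ (velocity N σ q) (dirFun q)) := rfl
@[simp] theorem dirFun_resField (σ : ℝ) (q : Ambient d) : dirFun (resField N σ q) =
    velocity N σ q - inner ℝ (velocity N σ q) (dirFun q) • dirFun q := rfl
@[simp] theorem pfFun_resField (σ : ℝ) (q : Ambient d) : pfFun (resField N σ q) =
    bfFun q * (pfFun q * radialRate q (natForce N q)) := rfl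
@[simp] theorem nfFun_resField (σ : ℝ) (q : Ambient d) : nfFun (resField N σ q) =
    bfFun q * -(nfFun q * radialRate q (natForce N q)) := rfl
@[simp] theorem dfFun_resField (σ : ℝ) (q : Ambient d) : dfFun (resField N σ q) =
    bfFun q * -(dfFun q * (pfFun q ^ 4 * power q (natForce N q))) := rfl
@[simp] theorem timeFun_resField (σ : ℝ) (q : Ambient d) : timeFun (resField N σ q) =
    bfFun q * (pfFun q * (natForce N q 0 - pfFun q ^ 3 * timeFun q * power q (natForce N q))
      - 2 * timeFun q * radialRate q (natForce N q)) := rfl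
@[simp] theorem spaceFun_resField (σ : ℝ) (q : Ambient d) : spaceFun (resField N σ q) =
    bfFun q • (pfFun q ^ 2 • (spatial (natForce N q) - (pfFun q ^ 2 * power q (natForce N q)) • spaceFun q)
      - radialRate q (natForce N q) • spaceFun q) := rfl

theorem power_eq (q : Ambient d) (φ : Spacetime d) : power q φ = pfFun q * timeFun q * φ 0 +
    inner ℝ (spaceFun q) (spatial φ) := by
  rw [power, inner_spacetime, blowFreq, spacetimeVec_zero, spatial_spacetimeVec]

variable (N) in
/-- The logarithmic rates of `faceFun` along the rescaled flow. -/
def faceRate (σ : ℝ) (q : Ambient d) : Fin 7 → ℝ :=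
  ![-2 * inner ℝ (velocity N σ q) (dirFun q), -4 * (bfFun q * radialRate q (natForce N q)),
    -2 * (bfFun q * (pfFun q ^ 4 * power q (natForce N q))), -inner ℝ (velocity N σ q) (dirFun q),
    bfFun q * radialRate q (natForce N q), -(bfFun q * radialRate q (natForce N q)),
    -(bfFun q * (pfFun q ^ 4 * power q (natForce N q)))]

/-- The rates hold as identities on the whole ambient space and not only on the phase space. This is
what turns tangency to the faces and spheres into a linear equation that preserves zeros and signs.
-/
theorem faceDeriv_resField (σ : ℝ) (q : Ambient d) (i : Fin 7) :
    faceDeriv q (resField N σ q) σ i.castSucc = faceRate N σ q i * faceFun σ i.castSucc q := by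
  have hp := power_eq q (natForce N q)
  have hρ := radialRate.eq_1 q (natForce N q)
  fin_cases i
  · simp [faceDeriv, faceRate, faceFun, inner_sub_right, inner_smul_right,
      real_inner_comm (velocity N σ q)]
    ring
  · simp [faceDeriv, faceRate, faceFun, inner_sub_right, inner_smul_right]
    linear_combination -4 * bfFun q * hρ
  · simp [faceDeriv, faceRate, faceFun, inner_sub_right, inner_smul_right]
    linear_combination -2 * bfFun q * pfFun q ^ 4 * hp
  · simp [faceDeriv, faceRate, faceFun]; ring
  · simp [faceDeriv, faceRate, faceFun]; ring
  · simp [faceDeriv, faceRate, faceFun]; ring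
  · simp [faceDeriv, faceRate, faceFun]; ring

theorem hasFDerivAt_resSymbol {Ω : Set (ℝ × BaseAmbient d)} (hΩ : IsOpen Ω)
    (hN : ∀ i j, ContDiffOn ℝ ∞ (fun x => N x i j) Ω) (σ : ℝ) {q : Ambient d} (hq : q ∈ metricDomain Ω) :
    HasFDerivAt (resSymbol N σ) (fderiv ℝ (resSymbol N σ) q) q :=
  (((contDiffOn_resSymbol hN σ).contDiffAt ((isOpen_metricDomain hΩ).mem_nhds hq)).differentiableAt
    (by simp)).hasFDerivAt

theorem fderiv_resSymbol_base {Ω : Set (ℝ × BaseAmbient d)} (hΩ : IsOpen Ω)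
    (hN : ∀ i j, ContDiffOn ℝ ∞ (fun x => N x i j) Ω) (σ : ℝ) {q : Ambient d} (hq : q ∈ metricDomain Ω)
    (v : Spacetime d) : fderiv ℝ (resSymbol N σ) q (sphereField q.1 v, 0) =
      -((pfFun q * nfFun q) ^ 2 * (bfFun q * (2 * forceForm N (metricArg q) (blowFreq q) v))) := by
  have hm : HasDerivAt (fun t : ℝ => q.1 + t • sphereField q.1 v) (sphereField q.1 v) 0 := by
    simpa using ((hasDerivAt_id (0 : ℝ)).smul_const (sphereField q.1 v)).const_add q.1
  let f : ℝ → Ambient d := fun t => (q.1 + t • sphereField q.1 v, q.2)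
  have hf : HasDerivAt f (sphereField q.1 v, 0) 0 := hm.prodMk (hasDerivAt_const 0 q.2)
  have hF : HasFDerivAt (resSymbol N σ) (fderiv ℝ (resSymbol N σ) q) (f 0) := by
    rw [show f 0 = q by simp [f]]; exact hasFDerivAt_resSymbol hΩ hN σ hq
  have h1 : HasDerivAt (fun t : ℝ => resSymbol N σ (f t))
      (fderiv ℝ (resSymbol N σ) q (sphereField q.1 v, 0)) 0 := hF.comp_hasDerivAt (0 : ℝ) hf
  refine h1.unique ?_
  have h2 := hasDerivAt_pertQuad (N := N) (h := pfFun q * nfFun q)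
    (m := fun t : ℝ => q.1 + t • sphereField q.1 v) (v := v) (u := blowFreq q) (s := univ) (t := 0)
    (fun i j => by
      simp only [zero_smul, add_zero]
      exact ((hN i j).contDiffAt (hΩ.mem_nhds hq)).differentiableAt (by simp))
    (hm.congr_deriv (by simp)).hasDerivWithinAt
  have h3 := ((((h2.hasDerivAt univ_mem).const_mul ((pfFun q * nfFun q) ^ 2)).const_add
    (∑ i, minkowskiSign i * blowFreq q i ^ 2)).fun_neg).add_const (2 * σ * timeFun q * dfFun q)
  refine (h3.congr_deriv ?_).congr_of_eventuallyEq (Eventually.of_forall fun t => ?_)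
  · simp only [zero_smul, add_zero]; rfl
  · change -((∑ i, minkowskiSign i * blowFreq q i ^ 2) + (pfFun q * nfFun q) ^ 2 * _ * _) + _ = _
    rw [mul_assoc]; rfl

/-- The tangent vectors considered keep h = ra fixed. The coefficients of the metric then do not
move, and only the quadratic form has to be differentiated. -/
theorem fderiv_resSymbol_freq (hsymm : ∀ x i j, N x i j = N x j i) {Ω : Set (ℝ × BaseAmbient d)}
    (hΩ : IsOpen Ω) (hN : ∀ i j, ContDiffOn ℝ ∞ (fun x => N x i j) Ω) (σ : ℝ) {q : Ambient d}
    (hq : q ∈ metricDomain Ω) (ρ y θ : ℝ) (b : EuclideanSpace ℝ (Fin d)) :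
    fderiv ℝ (resSymbol N σ) q (0, (pfFun q * ρ, -(nfFun q * ρ), y, θ, b)) =
      -(2 * inner ℝ (raise N (metricArg q) (blowFreq q))
        (spacetimeVec (pfFun q * ρ * timeFun q + pfFun q * θ) b))
      + 2 * σ * (θ * dfFun q + timeFun q * y) := by
  have he : ∀ c : ℝ, HasDerivAt (fun t : ℝ => Real.exp (c * t)) c 0 := fun c => by
    simpa using ((hasDerivAt_id (0 : ℝ)).const_mul c).exp
  have hr : HasDerivAt (fun t : ℝ => pfFun q * Real.exp (ρ * t)) (pfFun q * ρ) 0 := (he ρ).const_mul _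
  have ha : HasDerivAt (fun t : ℝ => nfFun q * Real.exp (-ρ * t)) (-(nfFun q * ρ)) 0 := by
    simpa using (he (-ρ)).const_mul (nfFun q)
  have hl : ∀ {G : Type} [NormedAddCommGroup G] [NormedSpace ℝ G] (x y : G),
      HasDerivAt (fun t : ℝ => x + t • y) y 0 := fun x y => by
    simpa using ((hasDerivAt_id (0 : ℝ)).smul_const y).const_add x
  -- Opposite exponentials in r and a keep ra constant exactly, not only to first order.
  let f : ℝ → Ambient d := fun t => (q.1, (pfFun q * Real.exp (ρ * t), nfFun q * Real.exp (-ρ * t),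
    dfFun q + t • y, timeFun q + t • θ, spaceFun q + t • b))
  have hf : HasDerivAt f (0, (pfFun q * ρ, -(nfFun q * ρ), y, θ, b)) 0 :=
    (hasDerivAt_const 0 q.1).prodMk (hr.prodMk (ha.prodMk ((hl _ _).prodMk ((hl _ _).prodMk (hl _ _)))))
  have hf0 : f 0 = q := by
    simp only [f, mul_zero, Real.exp_zero, mul_one, zero_smul, add_zero]; rfl
  have hM : ∀ t, metricArg (f t) = metricArg q := fun t => by
    refine Prod.ext ?_ rfl
    change pfFun q * Real.exp (ρ * t) * (nfFun q * Real.exp (-ρ * t)) = pfFun q * nfFun q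
    have : Real.exp (ρ * t) * Real.exp (-ρ * t) = 1 := by rw [← Real.exp_add]; simp
    linear_combination pfFun q * nfFun q * this
  have hu : HasDerivAt (fun t => blowFreq (f t))
      (spacetimeVec (pfFun q * ρ * timeFun q + pfFun q * θ) b) 0 := by
    have h1 : HasDerivAt (fun t : ℝ => (pfFun q * Real.exp (ρ * t) * (timeFun q + t • θ), spaceFun q + t • b))
        (pfFun q * ρ * timeFun q + pfFun q * θ, b) 0 := by
      refine (((hr.fun_mul (hl (timeFun q) θ)).prodMk (hl (spaceFun q) b))).congr_deriv ?_
      simp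
    exact (spacetimeVecCLM d).hasFDerivAt.comp_hasDerivAt 0 h1
  have hF : HasFDerivAt (resSymbol N σ) (fderiv ℝ (resSymbol N σ) q) (f 0) := by
    rw [hf0]; exact hasFDerivAt_resSymbol hΩ hN σ hq
  have h1 : HasDerivAt (fun t : ℝ => resSymbol N σ (f t))
      (fderiv ℝ (resSymbol N σ) q (0, (pfFun q * ρ, -(nfFun q * ρ), y, θ, b))) 0 :=
    hF.comp_hasDerivAt (0 : ℝ) hf
  refine h1.unique ?_
  have h2 := (hasDerivAt_quadratic hsymm (metricArg q) (hu.hasDerivWithinAt (s := univ))).hasDerivAt univ_mem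
  have h3 := h2.fun_neg.fun_add (((hl (timeFun q) θ).fun_mul (hl (dfFun q) y)).const_mul (2 * σ))
  refine (h3.congr_deriv ?_).congr_of_eventuallyEq (Eventually.of_forall fun t => ?_)
  · rw [hf0]; simp
  · change resSymbol N σ (f t) = -((∑ i, minkowskiSign i * blowFreq (f t) i ^ 2) +
      (pfFun q * nfFun q) ^ 2 * bfFun q * pertQuad N (metricArg q) (blowFreq (f t))) +
        2 * σ * (timeFun (f t) * dfFun (f t))
    have hM1 : pfFun (f t) * nfFun (f t) = pfFun q * nfFun q := congrArg Prod.fst (hM t)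
    rw [resSymbol, hM, hM1]
    change _ + 2 * σ * timeFun (f t) * dfFun (f t) = _
    rw [mul_assoc (2 * σ)]; rfl

/-- The rescaled symbol is multiplied by a factor along the rescaled flow. -/
theorem fderiv_resSymbol_resField (hsymm : ∀ x i j, N x i j = N x j i) {Ω : Set (ℝ × BaseAmbient d)}
    (hΩ : IsOpen Ω) (hN : ∀ i j, ContDiffOn ℝ ∞ (fun x => N x i j) Ω) (σ : ℝ) {q : Ambient d}
    (hq : q ∈ metricDomain Ω) : fderiv ℝ (resSymbol N σ) q (resField N σ q) =
      -2 * (bfFun q * (pfFun q ^ 4 * power q (natForce N q) + radialRate q (natForce N q))) *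
        resSymbol N σ q := by
  -- Since H_p p = 0, only the prefactor y²a² of the symbol contributes: y and a have the
  -- logarithmic rates -m r⁴ `power` and -m `radialRate`. The identity is checked directly in
  -- coordinates, as it is needed on the boundary and off the phase space too.
  set φ := natForce N q with hφ
  set w := raise N (metricArg q) (blowFreq q) with hw
  set F := force N (metricArg q) (blowFreq q) with hF
  have hsplit : resField N σ q = (sphereField q.1 (velocity N σ q), 0) +
      bfFun q • ((0, (pfFun q * radialRate q φ, -(nfFun q * radialRate q φ),
        -(dfFun q * (pfFun q ^ 4 * power q φ)),
        pfFun q * (φ 0 - pfFun q ^ 3 * timeFun q * power q φ) - 2 * timeFun q * radialRate q φ,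
        pfFun q ^ 2 • (spatial φ - (pfFun q ^ 2 * power q φ) • spaceFun q) -
          radialRate q φ • spaceFun q)) : Ambient d) := by
    refine Prod.ext ?_ ?_
    · simp [resField]
    · simp only [resField, Prod.snd_add, Prod.smul_snd, zero_add]; rfl
  rw [hsplit, map_add, map_smul, fderiv_resSymbol_base hΩ hN σ hq, fderiv_resSymbol_freq hsymm hΩ hN σ hq,
    forceForm_eq_inner]
  have hQ : inner ℝ w (blowFreq q) = (∑ i, minkowskiSign i * blowFreq q i ^ 2) +
      (pfFun q * nfFun q) ^ 2 * bfFun q * pertQuad N (metricArg q) (blowFreq q) := by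
    rw [hw, inner_raise]
    congr 1
    · exact Finset.sum_congr rfl fun i _ => by ring
  have hres : resSymbol N σ q = -inner ℝ w (blowFreq q) + 2 * σ * timeFun q * dfFun q := by rw [hQ]; rfl
  -- The motion of `blowFreq`: the force r²φ, minus the component that renormalizes it.
  have hvec : spacetimeVec (pfFun q * radialRate q φ * timeFun q + pfFun q *
      (pfFun q * (φ 0 - pfFun q ^ 3 * timeFun q * power q φ) - 2 * timeFun q * radialRate q φ))
      (pfFun q ^ 2 • (spatial φ - (pfFun q ^ 2 * power q φ) • spaceFun q) - radialRate q φ • spaceFun q) =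
      pfFun q ^ 2 • φ - (pfFun q ^ 4 * power q φ + radialRate q φ) • blowFreq q := by
    refine spacetime_ext ?_ ?_
    · simp [blowFreq]; ring
    · ext j; simp [blowFreq]; ring
  have hwφ : inner ℝ w φ = nfFun q ^ 2 * (pfFun q * nfFun q * (w 0 * F 0) + inner ℝ (spatial w) (spatial F)) := by
    rw [inner_spacetime, hφ, natForce, spacetimeVec_zero, spatial_spacetimeVec, inner_smul_right]; ring
  have hFv : inner ℝ F (velocity N σ q) = nfFun q * (σ * dfFun q - pfFun q * w 0) * F 0 -
      inner ℝ (spatial w) (spatial F) := by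
    rw [inner_spacetime, velocity, spacetimeVec_zero, spatial_spacetimeVec, inner_neg_right,
      real_inner_comm (spatial w)]; ring
  have hφ0 : φ 0 = nfFun q ^ 2 * (pfFun q * nfFun q * F 0) := rfl
  rw [hvec, inner_sub_right, inner_smul_right, inner_smul_right, hwφ, hFv, hres, smul_eq_mul]
  linear_combination 2 * σ * bfFun q * pfFun q * dfFun q * hφ0

variable {Ω : Set (ℝ × BaseAmbient d)}

theorem continuousOn_rates (hΩ : IsOpen Ω) (hN : ∀ i j, ContDiffOn ℝ ∞ (fun x => N x i j) Ω) (σ : ℝ) :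
    ContinuousOn (fun q : Ambient d => inner ℝ (velocity N σ q) (dirFun q)) (metricDomain Ω) ∧
    ContinuousOn (fun q => radialRate q (natForce N q)) (metricDomain Ω) ∧
    ContinuousOn (fun q => power q (natForce N q)) (metricDomain Ω) := by
  have hφ := contDiffOn_natForce hΩ hN
  have hv := (contDiffOn_velocity hN σ).continuousOn
  have hr : ContinuousOn (pfFun : Ambient d → ℝ) (metricDomain Ω) := contDiff_pfFun.continuous.continuousOn
  have hθ : ContinuousOn (timeFun : Ambient d → ℝ) (metricDomain Ω) :=
    contDiff_timeFun.continuous.continuousOn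
  have hb : ContinuousOn (spaceFun : Ambient d → _) (metricDomain Ω) :=
    contDiff_spaceFun.continuous.continuousOn
  have hp : ContinuousOn (fun q => power q (natForce N q)) (metricDomain Ω) :=
    (contDiff_blowFreq.contDiffOn.inner ℝ hφ).continuousOn
  have hi : ContinuousOn (fun q => inner ℝ (spaceFun q) (spatial (natForce N q))) (metricDomain Ω) :=
    (contDiff_spaceFun.contDiffOn.inner ℝ (ContDiffOn.spatial hφ)).continuousOn
  have h0 := (ContDiffOn.spacetime_apply hφ 0).continuousOn
  refine ⟨((contDiffOn_velocity hN σ).inner ℝ contDiff_dirFun.contDiffOn).continuousOn, ?_, hp⟩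
  unfold radialRate
  exact (((hr.pow 2).mul (hb.norm.pow 2)).mul (hi.sub (((hr.pow 2).mul hp).mul (hb.norm.pow 2)))).add
    (continuousOn_const.mul ((hr.mul hθ).mul (h0.sub (((hr.pow 3).mul hθ).mul hp))))

theorem continuousOn_faceRate (hΩ : IsOpen Ω) (hN : ∀ i j, ContDiffOn ℝ ∞ (fun x => N x i j) Ω) (σ : ℝ)
    (i : Fin 7) : ContinuousOn (fun q => faceRate N σ q i) (metricDomain Ω) := by
  obtain ⟨hs, hρ, hp⟩ := continuousOn_rates hΩ hN σ
  have hm : ContinuousOn (bfFun : Ambient d → ℝ) (metricDomain Ω) := contDiff_bfFun.continuous.continuousOn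
  have hr : ContinuousOn (pfFun : Ambient d → ℝ) (metricDomain Ω) := contDiff_pfFun.continuous.continuousOn
  have h1 := hm.mul hρ
  have h2 := hm.mul ((hr.pow 4).mul hp)
  fin_cases i
  · exact continuousOn_const.mul hs
  · exact continuousOn_const.mul h1
  · exact continuousOn_const.mul h2
  · exact hs.neg
  · exact h1
  · exact h1.neg
  · exact h2.neg

/-- Along a trajectory, a function that solves a linear equation keeps its sign. -/
theorem exists_pos_eq_mul_of_trajectory {σ : ℝ} {c : Ambient d → ℝ} {U : Set (Ambient d)}
    (hc : ContinuousOn c U) {G lam : Ambient d → ℝ} (hlam : ContinuousOn lam U)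
    (hG : ∀ q ∈ U, ∃ G' : Ambient d →L[ℝ] ℝ, HasFDerivAt G G' q ∧ G' (resField N σ q) = lam q * G q)
    {T : ℝ} {γ : ℝ → Ambient d} (hT : 0 ≤ T)
    (hγ : ∀ t ∈ Icc 0 T, γ t ∈ U ∧ HasDerivWithinAt γ (c (γ t) • resField N σ (γ t)) (Icc 0 T) t) :
    ∃ e, 0 < e ∧ G (γ T) = e * G (γ 0) := by
  have hγc : ContinuousOn γ (Icc 0 T) := fun t ht => (hγ t ht).2.continuousWithinAt
  refine exists_pos_eq_mul_of_hasDerivWithinAt (G := fun t => G (γ t)) (c := fun t => c (γ t) * lam (γ t)) hT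
    ((hc.mul hlam).comp hγc fun t ht => (hγ t ht).1) fun t ht => ?_
  obtain ⟨G', h1, h2⟩ := hG _ (hγ t ht).1
  refine (h1.comp_hasDerivWithinAt t (hγ t ht).2).congr_deriv ?_
  rw [map_smul, h2, smul_eq_mul, mul_assoc]

/-- Each defining function is multiplied by a positive number along the trajectory, by
`exists_pos_eq_mul_of_trajectory`. The factor `c` may have either sign, which covers changes of
boundary-defining functions and the reversed flow. -/
theorem trajectory_mem {σ : ℝ} (hsymm : ∀ x i j, N x i j = N x j i) (hΩ : IsOpen Ω)
    (hN : ∀ i j, ContDiffOn ℝ ∞ (fun x => N x i j) Ω)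
    {c : Ambient d → ℝ} {U : Set (Ambient d)} (hc : ContinuousOn c U) (hU : U ⊆ metricDomain Ω)
    (hU1 : ∀ q ∈ U, pfFun q * nfFun q < 1) {T : ℝ} {γ : ℝ → Ambient d} (hT : 0 ≤ T)
    (hγ : ∀ t ∈ Icc 0 T, γ t ∈ U ∧ HasDerivWithinAt γ (c (γ t) • resField N σ (γ t)) (Icc 0 T) t)
    (h0 : γ 0 ∈ phaseSpace d) (hP : resSymbol N σ (γ 0) = 0) :
    γ T ∈ phaseSpace d ∧ resSymbol N σ (γ T) = 0 ∧ (bfFun (γ 0) = 0 → bfFun (γ T) = 0) ∧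
      (nfFun (γ 0) = 0 → nfFun (γ T) = 0) ∧ (dfFun (γ 0) = 0 → dfFun (γ T) = 0) := by
  obtain ⟨hs, hρ, hp⟩ := continuousOn_rates hΩ hN σ
  have hface : ∀ i : Fin 7, ∃ e, 0 < e ∧ faceFun σ i.castSucc (γ T) = e * faceFun σ i.castSucc (γ 0) := by
    intro i
    refine exists_pos_eq_mul_of_trajectory hc ((continuousOn_faceRate hΩ hN σ i).mono hU) (fun q _ => ?_) hT hγ
    exact ⟨_, ((contDiff_faceFun σ i.castSucc).differentiable (by simp) q).hasFDerivAt, by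
      rw [fderiv_faceFun, faceDeriv_resField]⟩
  have hres : ∃ e, 0 < e ∧ resSymbol N σ (γ T) = e * resSymbol N σ (γ 0) := by
    have hm : ContinuousOn (bfFun : Ambient d → ℝ) (metricDomain Ω) := contDiff_bfFun.continuous.continuousOn
    have hr : ContinuousOn (pfFun : Ambient d → ℝ) (metricDomain Ω) := contDiff_pfFun.continuous.continuousOn
    refine exists_pos_eq_mul_of_trajectory (lam := fun q => -2 * (bfFun q * (pfFun q ^ 4 *
      power q (natForce N q) + radialRate q (natForce N q)))) hc ((continuousOn_const.mul
      (hm.mul (((hr.pow 4).mul hp).add hρ))).mono hU) (fun q hq => ?_) hT hγ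
    exact ⟨_, hasFDerivAt_resSymbol hΩ hN σ (hU hq), fderiv_resSymbol_resField hsymm hΩ hN σ (hU hq)⟩
  have hz : ∀ i : Fin 7, faceFun σ i.castSucc (γ 0) = 0 → faceFun σ i.castSucc (γ T) = 0 := fun i h => by
    obtain ⟨e, -, h1⟩ := hface i
    rw [h1, h, mul_zero]
  have hnn : ∀ i : Fin 7, 0 ≤ faceFun σ i.castSucc (γ 0) → 0 ≤ faceFun σ i.castSucc (γ T) := fun i h => by
    obtain ⟨e, he, h1⟩ := hface i
    rw [h1]; exact mul_nonneg he.le h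
  obtain ⟨⟨e0, e1, e2⟩, e3, e4, e5, e6⟩ :=
    (mem_phaseSpace_iff (σ := σ) (hU1 _ (hγ 0 ⟨le_rfl, hT⟩).1)).1 h0
  refine ⟨(mem_phaseSpace_iff (σ := σ) (hU1 _ (hγ T ⟨hT, le_rfl⟩).1)).2
    ⟨⟨hz 0 e0, hz 1 e1, hz 2 e2⟩, hnn 3 e3, hnn 4 e4, hnn 5 e5, hnn 6 e6⟩, ?_, hz 3, hz 5, hz 6⟩
  obtain ⟨e, -, h1⟩ := hres
  rw [h1, hP, mul_zero]

end Invariance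

end NonrelKG
end

noncomputable section
namespace NonrelKG

variable {d : ℕ}

/-! ### The radial sets as sinks -/

/-- The component of the velocity orthogonal to the direction. -/
def misalign (σ : ℝ) (q : Ambient d) : Spacetime d :=
  flatVelocity σ q - inner ℝ (flatVelocity σ q) (dirFun q) • dirFun q

theorem contDiff_misalign (σ : ℝ) : ContDiff ℝ ∞ (misalign σ : Ambient d → Spacetime d) :=
  (contDiff_flatVelocity σ).sub (((contDiff_flatVelocity σ).inner ℝ contDiff_dirFun).smul contDiff_dirFun)

theorem fderiv_misalign_base (σ : ℝ) (q : Ambient d) (μ : BaseAmbient d) :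
    fderiv ℝ (misalign σ) q (μ, 0) = -(inner ℝ (flatVelocity σ q) μ.2 • dirFun q +
      inner ℝ (flatVelocity σ q) (dirFun q) • μ.2) := by
  refine fderiv_apply_eq (contDiff_misalign σ) ?_
  obtain ⟨-, hn, -⟩ := hasDerivAt_line q (μ, 0)
  have hv : ∀ t : ℝ, flatVelocity σ (q + t • ((μ, 0) : Ambient d)) = flatVelocity σ q := fun t => by
    have : (q + t • ((μ, 0) : Ambient d)).2 = q.2 := by
      rw [Prod.snd_add, Prod.smul_snd, smul_zero, add_zero]
    simp only [flatVelocity, nfFun, pfFun, timeFun, dfFun, spaceFun, this]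
  have h1 : HasDerivAt (fun t : ℝ => inner ℝ (flatVelocity σ q) (dirFun (q + t • ((μ, 0) : Ambient d))))
      (inner ℝ (flatVelocity σ q) μ.2) 0 := by
    simpa using (hasDerivAt_const (0 : ℝ) (flatVelocity σ q)).inner ℝ hn
  simp only [misalign, hv]
  refine ((h1.fun_smul hn).const_sub (flatVelocity σ q)).congr_deriv ?_
  simp [add_comm]

section Sink

variable {N : ℝ × BaseAmbient d → Matrix (Fin (d + 1)) (Fin (d + 1)) ℝ}

variable (N) in
/-- The contribution of the metric perturbation to the velocity. -/
def pertVelocity (q : Ambient d) : Spacetime d :=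
  spacetimeVec (nfFun q * pfFun q * pertVec N q 0) (spatial (pertVec N q))

variable (N) in
/-- The part of the rescaled field that vanishes at `bf`, divided by `bfFun`. -/
def interiorField (σ : ℝ) (q : Ambient d) : Ambient d :=
  ((-inner ℝ (velocity N σ q) (dirFun q),
    -((pfFun q * nfFun q) ^ 2 • (pertVelocity N q - inner ℝ (pertVelocity N q) (dirFun q) • dirFun q))),
    freqField q (natForce N q))

/-- The flat flow of the direction is split off; all the rest has a factor m, whether it comes from
the metric or from the motion of the frequencies. -/
theorem resField_eq (σ : ℝ) (q : Ambient d) :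
    resField N σ q = ((0, misalign σ q), 0) + bfFun q • interiorField N σ q := by
  refine Prod.ext (Prod.ext ?_ ?_) ?_
  · change -(bfFun q * inner ℝ (velocity N σ q) (dirFun q)) =
      0 + bfFun q * -inner ℝ (velocity N σ q) (dirFun q)
    ring
  · change velocity N σ q - inner ℝ (velocity N σ q) (dirFun q) • dirFun q = misalign σ q + bfFun q •
      -((pfFun q * nfFun q) ^ 2 • (pertVelocity N q - inner ℝ (pertVelocity N q) (dirFun q) • dirFun q))
    rw [velocity_eq, ← pertVelocity, misalign, inner_sub_left, inner_smul_left]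
    simp only [RCLike.conj_to_real]
    module
  · simp [resField, interiorField]

theorem contDiffOn_interiorField {Ω : Set (ℝ × BaseAmbient d)} (hΩ : IsOpen Ω)
    (hN : ∀ i j, ContDiffOn ℝ ∞ (fun x => N x i j) Ω) (σ : ℝ) :
    ContDiffOn ℝ ∞ (interiorField N σ) (metricDomain Ω) := by
  have hb := fun i => ContDiffOn.spacetime_apply (contDiff_blowFreq (d := d)).contDiffOn
    (U := metricDomain Ω) i
  have hn : ContDiffOn ℝ ∞ (dirFun : Ambient d → _) (metricDomain Ω) := contDiff_dirFun.contDiffOn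
  have hp : ContDiffOn ℝ ∞ (pertVec N) (metricDomain Ω) := contDiffOn_euclidean.2 fun i => by
    have : ContDiffOn ℝ ∞ (fun q => ∑ j, N (metricArg q) i j * blowFreq q j) (metricDomain Ω) :=
      ContDiffOn.sum fun j _ => (contDiffOn_coeff hN i j).mul (hb j)
    exact this
  have hra : ContDiff ℝ ∞ fun q : Ambient d => nfFun q * pfFun q := by fun_prop
  have hra2 : ContDiff ℝ ∞ fun q : Ambient d => (pfFun q * nfFun q) ^ 2 := by fun_prop
  have hpv : ContDiffOn ℝ ∞ (pertVelocity N) (metricDomain Ω) := ContDiffOn.spacetimeVec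
    (hra.contDiffOn.mul (ContDiffOn.spacetime_apply hp 0)) (ContDiffOn.spatial hp)
  exact ((((contDiffOn_velocity hN σ).inner ℝ hn).neg).prodMk
    ((hra2.contDiffOn.smul (hpv.sub ((hpv.inner ℝ hn).smul hn))).neg)).prodMk
    (ContDiffOn.freqField (contDiffOn_natForce hΩ hN))

/-- The derivative of the misalignment along the rescaled flow. -/
theorem inner_misalign_fderiv (σ : ℝ) {q : Ambient d} (hq : q ∈ phaseSpace d) :
    inner ℝ (misalign σ q) (fderiv ℝ (misalign σ) q (resField N σ q)) =
      -(inner ℝ (flatVelocity σ q) (dirFun q) * ‖misalign σ q‖ ^ 2) -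
      bfFun q ^ 2 * (inner ℝ (flatVelocity σ q) (misalign σ q) * inner ℝ (flatVelocity σ q) (dirFun q)) +
      bfFun q * inner ℝ (misalign σ q) (fderiv ℝ (misalign σ) q (interiorField N σ q)) := by
  have h1 : bfFun q ^ 2 + ‖dirFun q‖ ^ 2 = 1 := hq.1.2
  -- Off bf n is not a unit vector: |n|² = 1 - m², so the misalignment is orthogonal to n only up to
  -- O(m²).
  have h2 : inner ℝ (misalign σ q) (dirFun q) = inner ℝ (flatVelocity σ q) (dirFun q) * bfFun q ^ 2 := by
    rw [misalign, inner_sub_left, inner_smul_left, real_inner_self_eq_norm_sq]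
    simp only [RCLike.conj_to_real]
    linear_combination -inner ℝ (flatVelocity σ q) (dirFun q) * h1
  rw [resField_eq, map_add, map_smul, fderiv_misalign_base, inner_add_right, inner_smul_right, inner_neg_right,
    inner_add_right, inner_smul_right, inner_smul_right, h2, real_inner_self_eq_norm_sq]
  ring

/-- The phase space is not closed in its ambient space because of h < 1, so that bound at the limit
point is a separate hypothesis; all other conditions are closed. -/
theorem closure_subset_of_flat {Ω : Set (ℝ × BaseAmbient d)} (hΩ : IsOpen Ω)
    (hN : ∀ i j, ContDiffOn ℝ ∞ (fun x => N x i j) Ω) (σ : ℝ) {S : Set (Ambient d)}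
    (hS : ∀ q ∈ S, q ∈ phaseSpace d ∧ resSymbol N σ q = 0) {q : Ambient d} (hq : q ∈ closure S)
    (hqΩ : q ∈ metricDomain Ω) (hra : pfFun q * nfFun q < 1) :
    q ∈ phaseSpace d ∧ resSymbol N σ q = 0 := by
  have hc := fun i => (contDiff_faceFun (d := d) σ i).continuous
  have hz : ∀ i, (∀ u ∈ S, faceFun σ i u = 0) → faceFun σ i q = 0 := fun i h =>
    closure_minimal (t := {u | faceFun σ i u = 0}) h (isClosed_eq (hc i) continuous_const) hq
  have hnn : ∀ i, (∀ u ∈ S, 0 ≤ faceFun σ i u) → 0 ≤ faceFun σ i q := fun i h =>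
    closure_minimal (t := {u | 0 ≤ faceFun σ i u}) h (isClosed_le continuous_const (hc i)) hq
  have hX := fun u hu => (mem_phaseSpace_iff (σ := σ) (hS u hu).1.2.2.2.2.1).1 (hS u hu).1
  refine ⟨(mem_phaseSpace_iff (σ := σ) hra).2 ⟨⟨hz 0 fun u hu => (hX u hu).1.1,
    hz 1 fun u hu => (hX u hu).1.2.1, hz 2 fun u hu => (hX u hu).1.2.2⟩, hnn 3 fun u hu => (hX u hu).2.1,
    hnn 4 fun u hu => (hX u hu).2.2.1, hnn 5 fun u hu => (hX u hu).2.2.2.1,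
    hnn 6 fun u hu => (hX u hu).2.2.2.2⟩, ?_⟩
  have h1 : ContinuousWithinAt (resSymbol N σ) S q :=
    (hasFDerivAt_resSymbol hΩ hN σ hqΩ).continuousAt.continuousWithinAt
  have h2 := h1.mem_closure_image hq
  have h3 : resSymbol N σ '' S ⊆ {0} := by
    rintro _ ⟨u, hu, rfl⟩; exact (hS u hu).2
  simpa using closure_mono h3 h2

/-- Here m is `bfFun`, e the size of the misalignment, and x, y are the error coefficients. The
cross term is absorbed by 2|m|M₂e ≤ (M₂²/s₀)m² + s₀e², and the weight K is chosen so that s₀K = s₀ +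
2M₁ + M₂²/s₀ pays for all errors in m². -/
theorem lyapunov_decay {s₀ M₁ M₂ m e cs cs' x y : ℝ} (hs₀ : 0 < s₀)
    (h1 : s₀ ≤ cs) (h2 : s₀ ≤ cs') (hx : |x| ≤ M₁) (hy : |y| ≤ M₂ * e) :
    (1 + (2 * M₁ + M₂ ^ 2 / s₀) / s₀) * (2 * m * -(cs * m)) + 2 * (-(cs' * e ^ 2) - m ^ 2 * x + m * y) ≤
      -s₀ * ((1 + (2 * M₁ + M₂ ^ 2 / s₀) / s₀) * m ^ 2 + e ^ 2) := by
  have hM₁ : 0 ≤ M₁ := (abs_nonneg x).trans hx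
  set K := 1 + (2 * M₁ + M₂ ^ 2 / s₀) / s₀ with hK
  have hK0 : 0 ≤ K := by positivity
  have hKs : s₀ * K = s₀ + 2 * M₁ + M₂ ^ 2 / s₀ := by rw [hK]; field_simp; ring
  have a1 : K * m ^ 2 * s₀ ≤ K * m ^ 2 * cs := mul_le_mul_of_nonneg_left h1 (by positivity)
  have a2 : e ^ 2 * s₀ ≤ e ^ 2 * cs' := mul_le_mul_of_nonneg_left h2 (by positivity)
  have a3 : -(m ^ 2 * x) ≤ m ^ 2 * M₁ := by
    rw [← mul_neg]; exact mul_le_mul_of_nonneg_left ((neg_le_abs x).trans hx) (by positivity)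
  have a4 : m * y ≤ |m| * (M₂ * e) :=
    (le_abs_self _).trans ((abs_mul m y).le.trans (mul_le_mul_of_nonneg_left hy (abs_nonneg m)))
  have a5 : 2 * (|m| * (M₂ * e)) ≤ M₂ ^ 2 / s₀ * m ^ 2 + s₀ * e ^ 2 := by
    have h := div_nonneg (sq_nonneg (M₂ * |m| - s₀ * e)) hs₀.le
    have h' : (M₂ * |m| - s₀ * e) ^ 2 / s₀ = M₂ ^ 2 / s₀ * m ^ 2 + s₀ * e ^ 2 - 2 * (|m| * (M₂ * e)) := by
      rw [← sq_abs m]; field_simp; ring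
    linarith
  have a6 : s₀ * K * m ^ 2 = s₀ * m ^ 2 + 2 * M₁ * m ^ 2 + M₂ ^ 2 / s₀ * m ^ 2 := by rw [hKs]; ring
  have a7 := mul_nonneg hs₀.le (sq_nonneg m)
  linarith

/-- Zero misalignment gives v = ⟨v, n⟩n with |n| = 1, and the sign of ⟨v, n⟩ decides between the two
radial sets. -/
theorem mem_radialLocus_of_misalign_eq_zero {σ ς : ℝ} (hσ : σ ^ 2 = 1) (hς : ς ^ 2 = 1) {q : Ambient d}
    (hqX : q ∈ phaseSpace d) (hm : bfFun q = 0) (hflat : flatSymbol σ q = 0) (he : 0 ≤ energyFun σ q)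
    (hmis : misalign σ q = 0) (hpos : 0 < ς * σ * inner ℝ (flatVelocity σ q) (dirFun q)) :
    q ∈ radialLocus σ ς := by
  have hvq := sub_eq_zero.1 hmis
  set l : ℝ := inner ℝ (flatVelocity σ q) (dirFun q) with hl
  have hςσ : |ς * σ| = 1 := abs_eq_one_of_sq (by rw [mul_pow, hς, hσ, one_mul])
  have hnorm : ‖flatVelocity σ q‖ = ς * σ * l := by
    rw [hvq, norm_smul, dirFun_norm hqX hm, mul_one, Real.norm_eq_abs, ← abs_of_pos hpos, abs_mul (ς * σ),
      hςσ, one_mul]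
  exact ⟨hqX, hm, hflat, he, by rw [hnorm, mul_smul, ← hvq]⟩

set_option maxHeartbeats 400000 in
-- One statement for sinks and sources, on both invariant sets: with ε = ςσ the product of the
-- factor ε f and ⟨v, n⟩ is positive on the locus. The set `S` enters only through `hinv`, which
-- asks that it be determined near the locus by the zero set and the faces.
theorem isSink_radialLocus (hsymm : ∀ x i j, N x i j = N x j i) {Ω : Set (ℝ × BaseAmbient d)}
    (hΩ : IsOpen Ω) (hN : ∀ i j, ContDiffOn ℝ ∞ (fun x => N x i j) Ω) (hX : phaseSpace d ⊆ metricDomain Ω)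
    {σ ς ε : ℝ} (hσ : σ ^ 2 = 1) (hς : ς ^ 2 = 1) (hε : ε * (ς * σ) = 1)
    {f : Ambient d → ℝ} {Uf : Set (Ambient d)} (hUf : IsOpen Uf) (hXf : phaseSpace d ⊆ Uf)
    (hf : ContDiffOn ℝ ∞ f Uf) (hfpos : ∀ q ∈ phaseSpace d, 0 < f q)
    {V : Ambient d → Ambient d} {S : Set (Ambient d)}
    (hS : ∀ q ∈ S, q ∈ phaseSpace d ∧ resSymbol N σ q = 0)
    (hV : ∀ q ∈ S, V q = (ε * f q) • resField N σ q)
    (hinv : ∀ q ∈ S, ∀ q' ∈ phaseSpace d, resSymbol N σ q' = 0 → 0 < energyFun σ q' →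
      (bfFun q = 0 → bfFun q' = 0) → (nfFun q = 0 → nfFun q' = 0) → (dfFun q = 0 → dfFun q' = 0) → q' ∈ S) :
    IsSink V S (radialLocus σ ς) := by
  refine isSink_of_lyapunov fun q₀ hq₀ => ?_
  have hq₀X := hq₀.1
  have hE := energyFun_pos hσ hq₀.1 hq₀.2.2.1 hq₀.2.2.2.1
  have hv0 := norm_pos_iff.2 (flatVelocity_ne_zero hσ hq₀.1 hq₀.2.2.1 hq₀.2.2.2.1)
  have hv := flatVelocity_of_mem_radialLocus hσ hς hq₀
  have hn := dirFun_norm hq₀.1 hq₀.2.1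
  have hvel : velocity N σ q₀ = flatVelocity σ q₀ :=
    velocity_eq_flatVelocity (by rw [hq₀.2.1, mul_zero])
  have hinner : inner ℝ (flatVelocity σ q₀) (dirFun q₀) = ς * σ * ‖flatVelocity σ q₀‖ := by
    nth_rw 1 [hv]; rw [inner_smul_left, real_inner_self_eq_norm_sq, hn]; simp
  have hmis : misalign σ q₀ = 0 := by
    rw [misalign, hinner]; nth_rw 1 [hv]; exact sub_self _
  have hf0 := hfpos q₀ hq₀X
  set c : Ambient d → ℝ := fun q => ε * f q with hc_def
  -- Half of the contraction rate at `q₀`; by continuity it bounds the rates of both m and the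
  -- misalignment from below nearby.
  set s₀ : ℝ := f q₀ * ‖flatVelocity σ q₀‖ / 2 with hs₀_def
  have hs₀ : 0 < s₀ := by positivity
  have hcs : s₀ < c q₀ * inner ℝ (flatVelocity σ q₀) (dirFun q₀) := by
    rw [hinner, hc_def, show ε * f q₀ * (ς * σ * ‖flatVelocity σ q₀‖) =
      ε * (ς * σ) * (f q₀ * ‖flatVelocity σ q₀‖) by ring, hε]
    linarith
  have hςs : 0 < ς * σ * inner ℝ (flatVelocity σ q₀) (dirFun q₀) := by
    rw [hinner, show ς * σ * (ς * σ * ‖flatVelocity σ q₀‖) = ς ^ 2 * σ ^ 2 * ‖flatVelocity σ q₀‖ by ring,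
      hς, hσ]
    linarith
  have hmd := (isOpen_metricDomain hΩ).mem_nhds (hX hq₀X)
  have hcc : ContDiffOn ℝ ∞ c Uf := contDiffOn_const.mul hf
  have hca : ContinuousAt c q₀ := hcc.continuousOn.continuousAt (hUf.mem_nhds (hXf hq₀X))
  have hva : ContinuousAt (flatVelocity σ) q₀ := (contDiff_flatVelocity σ).continuous.continuousAt
  have hna : ContinuousAt (dirFun : Ambient d → _) q₀ := contDiff_dirFun.continuous.continuousAt
  have hia : ContinuousAt (fun q => inner ℝ (flatVelocity σ q) (dirFun q)) q₀ := hva.inner hna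
  have hsa : ContinuousAt (fun q => inner ℝ (velocity N σ q) (dirFun q)) q₀ :=
    (((contDiffOn_velocity hN σ).continuousOn.continuousAt hmd)).inner hna
  have hBa : ContinuousAt (interiorField N σ) q₀ :=
    (contDiffOn_interiorField hΩ hN σ).continuousOn.continuousAt hmd
  have hea : ContinuousAt (misalign σ : Ambient d → _) q₀ := (contDiff_misalign σ).continuous.continuousAt
  have hDa : ContinuousAt (fun q => c q • fderiv ℝ (misalign σ) q (interiorField N σ q)) q₀ :=
    hca.smul ((((contDiff_misalign σ).continuous_fderiv (by simp)).continuousAt).clm_apply hBa)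
  have hxa : ContinuousAt (fun q => c q * (inner ℝ (flatVelocity σ q) (misalign σ q) *
      inner ℝ (flatVelocity σ q) (dirFun q))) q₀ := hca.mul ((hva.inner hea).mul hia)
  have hcs' : s₀ < c q₀ * inner ℝ (velocity N σ q₀) (dirFun q₀) := by rw [hvel]; exact hcs
  have hraa : ContinuousAt (fun q : Ambient d => pfFun q * nfFun q) q₀ :=
    (contDiff_pfFun.continuous.mul contDiff_nfFun.continuous).continuousAt
  obtain ⟨U, hU, hUo, hq₀U⟩ := mem_nhds_iff.1 (show ∀ᶠ q in 𝓝 q₀, q ∈ metricDomain Ω ∧ q ∈ Uf ∧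
      pfFun q * nfFun q < 1 ∧ 0 < energyFun σ q ∧ s₀ < c q * inner ℝ (flatVelocity σ q) (dirFun q) ∧
      s₀ < c q * inner ℝ (velocity N σ q) (dirFun q) ∧
      0 < ς * σ * inner ℝ (flatVelocity σ q) (dirFun q) ∧ |c q| < |c q₀| + 1 ∧
      ‖interiorField N σ q‖ < ‖interiorField N σ q₀‖ + 1 ∧ ‖c q • fderiv ℝ (misalign σ) q (interiorField N σ q)‖ <
        ‖c q₀ • fderiv ℝ (misalign σ) q₀ (interiorField N σ q₀)‖ + 1 ∧
      |c q * (inner ℝ (flatVelocity σ q) (misalign σ q) * inner ℝ (flatVelocity σ q) (dirFun q))| <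
        |c q₀ * (inner ℝ (flatVelocity σ q₀) (misalign σ q₀) * inner ℝ (flatVelocity σ q₀) (dirFun q₀))| + 1
      from by
    filter_upwards [hmd, hUf.mem_nhds (hXf hq₀X), hraa.eventually (gt_mem_nhds hq₀X.2.2.2.2.1),
      (continuous_energyFun σ).continuousAt.eventually (lt_mem_nhds hE),
      (hca.mul hia).eventually (lt_mem_nhds hcs),
      (hca.mul hsa).eventually (lt_mem_nhds hcs'),
      (continuousAt_const.mul hia).eventually (lt_mem_nhds hςs),
      hca.abs.eventually (gt_mem_nhds (lt_add_one _)), hBa.norm.eventually (gt_mem_nhds (lt_add_one _)),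
      hDa.norm.eventually (gt_mem_nhds (lt_add_one _)), hxa.abs.eventually (gt_mem_nhds (lt_add_one _))]
      with q a1 a2 a3 a4 a5 a6 a7 a8 a9 a10 a11
    exact ⟨a1, a2, a3, a4, a5, a6, a7, a8, a9, a10, a11⟩)
  generalize |c q₀| + 1 = M₀ at hU
  generalize ‖interiorField N σ q₀‖ + 1 = MB at hU
  generalize ‖c q₀ • fderiv ℝ (misalign σ) q₀ (interiorField N σ q₀)‖ + 1 = M₂ at hU
  generalize |c q₀ * (inner ℝ (flatVelocity σ q₀) (misalign σ q₀) *
    inner ℝ (flatVelocity σ q₀) (dirFun q₀))| + 1 = M₁ at hU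
  have hM₀ : 0 ≤ M₀ := (abs_nonneg _).trans (hU hq₀U).2.2.2.2.2.2.2.1.le
  have hMB : 0 ≤ MB := (norm_nonneg _).trans (hU hq₀U).2.2.2.2.2.2.2.2.1.le
  have hM₂ : 0 ≤ M₂ := (norm_nonneg _).trans (hU hq₀U).2.2.2.2.2.2.2.2.2.1.le
  have hM₁ : 0 ≤ M₁ := (abs_nonneg _).trans (hU hq₀U).2.2.2.2.2.2.2.2.2.2.le
  set K : ℝ := 1 + (2 * M₁ + M₂ ^ 2 / s₀) / s₀ with hK
  have hK1 : 1 ≤ K := by rw [hK]; have : 0 ≤ (2 * M₁ + M₂ ^ 2 / s₀) / s₀ := by positivity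
                         linarith
  have hΛc : Continuous fun q : Ambient d => K * bfFun q ^ 2 + ‖misalign σ q‖ ^ 2 :=
    (continuous_const.mul (contDiff_bfFun.continuous.pow 2)).add ((contDiff_misalign σ).continuous.norm.pow 2)
  -- The speed is at most |c| (|misalignment| + |m| `MB`), and both terms are controlled by √Λ since
  -- K ≥ 1. The rate is `s₀ / 2` because the criterion asks for decay of Λ at rate 2κ.
  refine ⟨fun q => c q • resField N σ q, U, fun q => K * bfFun q ^ 2 + ‖misalign σ q‖ ^ 2,
    M₀ * (1 + MB), s₀ / 2, hUo, hq₀U, ?_, half_pos hs₀, by positivity, hΛc.continuousOn, ?_,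
    fun q hq => hV q hq.2, fun q _ => by positivity, ?_, ?_, ?_, ?_⟩
  · exact ((hcc.mono fun q hq => (hU hq).2.1).smul
      ((contDiffOn_resField hΩ hN σ).mono fun q hq => (hU hq).1)).of_le (by simp)
  · simp only [hq₀.2.1, hmis]; simp
  · rintro q ⟨hqU, -⟩
    obtain ⟨-, -, -, -, -, -, -, a8, a9, -⟩ := hU hqU
    set Λ := K * bfFun q ^ 2 + ‖misalign σ q‖ ^ 2 with hΛ
    have h1 : ‖misalign σ q‖ ≤ √Λ := Real.le_sqrt_of_sq_le (by rw [hΛ]; nlinarith [sq_nonneg (bfFun q)])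
    have h2 : |bfFun q| ≤ √Λ := Real.abs_le_sqrt (by
      rw [hΛ]; nlinarith [sq_nonneg (bfFun q), sq_nonneg ‖misalign σ q‖])
    have h3 : ‖(((0, misalign σ q), 0) : Ambient d)‖ = ‖misalign σ q‖ := by simp [Prod.norm_def]
    rw [norm_smul, Real.norm_eq_abs, resField_eq, mul_assoc]
    refine mul_le_mul a8.le ((norm_add_le _ _).trans ?_) (norm_nonneg _) hM₀
    rw [h3, norm_smul, Real.norm_eq_abs, add_mul, one_mul, mul_comm MB]
    exact add_le_add h1 (mul_le_mul h2 a9.le (norm_nonneg _) (Real.sqrt_nonneg _))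
  · intro T γ hT hγ h0
    obtain ⟨b1, b2, b3, b4, b5⟩ := trajectory_mem hsymm hΩ hN (hcc.continuousOn.mono fun q hq => (hU hq).2.1)
      (fun q hq => (hU hq).1) (fun q hq => (hU hq).2.2.1) hT hγ (hS _ h0).1 (hS _ h0).2
    exact hinv _ h0 _ b1 b2 (hU (hγ T ⟨hT, le_rfl⟩).1).2.2.2.1 b3 b4 b5
  · rintro s γ t ⟨htU, htS⟩ hγ
    obtain ⟨-, -, -, -, a5, a6, -, -, -, a10, a11⟩ := hU htU
    let L : Ambient d →L[ℝ] ℝ := (ContinuousLinearMap.fst ℝ ℝ (Spacetime d)).comp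
      (ContinuousLinearMap.fst ℝ (BaseAmbient d) (ℝ × ℝ × ℝ × ℝ × EuclideanSpace ℝ (Fin d)))
    have d1 : HasDerivWithinAt (fun t => bfFun (γ t)) (bfFun (c (γ t) • resField N σ (γ t))) s t :=
      L.hasFDerivAt.comp_hasDerivWithinAt t hγ
    have d2 : HasDerivWithinAt (fun t => misalign σ (γ t))
        (fderiv ℝ (misalign σ) (γ t) (c (γ t) • resField N σ (γ t))) s t :=
      (((contDiff_misalign σ).differentiable (by simp) (γ t)).hasFDerivAt).comp_hasDerivWithinAt t hγ
    refine ⟨_, ((d1.fun_pow 2).const_mul K).fun_add d2.norm_sq, ?_⟩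
    have e1 : bfFun (c (γ t) • resField N σ (γ t)) =
        -(c (γ t) * inner ℝ (velocity N σ (γ t)) (dirFun (γ t)) * bfFun (γ t)) := by
      change c (γ t) * bfFun (resField N σ (γ t)) = _
      rw [bfFun_resField]; ring
    have e2 : inner ℝ (misalign σ (γ t)) (fderiv ℝ (misalign σ) (γ t) (c (γ t) • resField N σ (γ t))) =
        -(c (γ t) * inner ℝ (flatVelocity σ (γ t)) (dirFun (γ t)) * ‖misalign σ (γ t)‖ ^ 2) -
        bfFun (γ t) ^ 2 * (c (γ t) * (inner ℝ (flatVelocity σ (γ t)) (misalign σ (γ t)) *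
          inner ℝ (flatVelocity σ (γ t)) (dirFun (γ t)))) +
        bfFun (γ t) * inner ℝ (misalign σ (γ t))
          (c (γ t) • fderiv ℝ (misalign σ) (γ t) (interiorField N σ (γ t))) := by
      rw [map_smul, inner_smul_right, inner_smul_right, inner_misalign_fderiv σ (hS _ htS).1]; ring
    have h := lyapunov_decay (m := bfFun (γ t)) (M₂ := M₂) (e := ‖misalign σ (γ t)‖) hs₀ a6.le a5.le a11.le
      ((abs_real_inner_le_norm (misalign σ (γ t))
        (c (γ t) • fderiv ℝ (misalign σ) (γ t) (interiorField N σ (γ t)))).trans (by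
          rw [mul_comm]; exact mul_le_mul_of_nonneg_right a10.le (norm_nonneg _)))
    rw [e1, e2]
    refine (Eq.le ?_).trans (h.trans (Eq.le ?_))
    · push_cast; ring
    · ring
  · intro q hqU hqS hΛ
    obtain ⟨a1, -, a3, a4, -, -, a7, -⟩ := hU hqU
    obtain ⟨hqX, hqP⟩ := closure_subset_of_flat hΩ hN σ hS hqS a1 a3
    have hΛ : K * bfFun q ^ 2 + ‖misalign σ q‖ ^ 2 = 0 := hΛ
    have hK0 : 0 < K := by linarith
    have hm : bfFun q = 0 := by
      have : K * bfFun q ^ 2 = 0 := le_antisymm (by linarith [sq_nonneg ‖misalign σ q‖]) (by positivity)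
      simpa [hK0.ne'] using this
    refine mem_radialLocus_of_misalign_eq_zero hσ hς hqX hm ?_ a4.le (by simpa [hm] using hΛ) a7
    rw [← hqP]; exact (resSymbol_eq_flatSymbol (by rw [hm, mul_zero])).symm

end Sink

end NonrelKG
end

noncomputable section
namespace NonrelKG

variable {d : ℕ}

/-! ### The characteristic set -/

/-- For E > 0 the closure condition in the definition of Σ is automatic, so near the radial sets Σ
is described by equations alone. -/
theorem mem_goodSheet_iff {N : ℝ × BaseAmbient d → Matrix (Fin (d + 1)) (Fin (d + 1)) ℝ} {σ : ℝ}
    {P : Ambient d → ℝ} (hP : ∀ q ∈ phaseSpace d, P q = 0 ↔ resSymbol N σ q = 0) {q : Ambient d}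
    (he : 0 < energyFun σ q) : q ∈ goodSheet σ P ↔
      q ∈ phaseSpace d ∧ resSymbol N σ q = 0 ∧ (dfFun q = 0 ∨ bfFun q = 0 ∨ nfFun q = 0) := by
  constructor
  · rintro ⟨⟨⟨h1, h2⟩, h3⟩, -⟩
    refine ⟨h1, (hP q h1).1 h2, ?_⟩
    rcases h3 with (h3 | h3) | h3
    · exact Or.inl h3.2
    · exact Or.inr (Or.inl h3.2)
    · exact Or.inr (Or.inr h3.2)
  · rintro ⟨h1, h2, h3⟩
    refine ⟨⟨⟨h1, (hP q h1).2 h2⟩, ?_⟩, mem_closure_of_energyFun_pos h1 he⟩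
    rcases h3 with h3 | h3 | h3
    · exact Or.inl (Or.inl ⟨h1, h3⟩)
    · exact Or.inl (Or.inr ⟨h1, h3⟩)
    · exact Or.inr ⟨h1, h3⟩

theorem goodSheet_spec {N : ℝ × BaseAmbient d → Matrix (Fin (d + 1)) (Fin (d + 1)) ℝ} {σ : ℝ}
    {P : Ambient d → ℝ} (hP : ∀ q ∈ phaseSpace d, P q = 0 ↔ resSymbol N σ q = 0) {q : Ambient d}
    (hq : q ∈ goodSheet σ P) : q ∈ phaseSpace d ∧ resSymbol N σ q = 0 ∧
      (dfFun q = 0 ∨ bfFun q = 0 ∨ nfFun q = 0) ∧ 0 ≤ energyFun σ q := by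
  obtain ⟨⟨⟨h1, h2⟩, h3⟩, h4⟩ := hq
  refine ⟨h1, (hP q h1).1 h2, ?_, energyFun_nonneg_of_mem_closure h4⟩
  rcases h3 with (h3 | h3) | h3
  · exact Or.inl h3.2
  · exact Or.inr (Or.inl h3.2)
  · exact Or.inr (Or.inr h3.2)

theorem radialSet_eq {N : ℝ × BaseAmbient d → Matrix (Fin (d + 1)) (Fin (d + 1)) ℝ} {σ : ℝ}
    (hσ : σ = 1 ∨ σ = -1)
    (hN : ∀ x ∈ Ico (0 : ℝ) 1 ×ˢ baseSpace d, ∀ u : Fin (d + 1) → ℝ,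
      (∀ i, minkowskiSign i * u i + x.1 ^ 2 * x.2.1 * ∑ j, N x i j * u j = 0) → u = 0)
    {P : Ambient d → ℝ} (hP : ∀ q ∈ phaseSpace d, P q = 0 ↔ resSymbol N σ q = 0)
    {V : Ambient d → Ambient d} (hV : ∀ q ∈ phaseSpace d, V q = 0 ↔ resField N σ q = 0) :
    radialSet σ P V = radialLocus σ (-1) ∪ radialLocus σ 1 := by
  have hσ2 : σ ^ 2 = 1 := by rcases hσ with h | h <;> simp [h]
  refine Subset.antisymm ?_ (union_subset ?_ ?_)
  · rintro q ⟨hq, hVq⟩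
    obtain ⟨h1, h2, h3, h4⟩ := goodSheet_spec hP hq
    exact mem_radialLocus_of_resField_eq_zero hσ hN h1 h2 h3 h4 ((hV q h1).1 hVq)
  all_goals
    intro q hq
    refine ⟨(mem_goodSheet_iff hP (energyFun_pos hσ2 hq.1 hq.2.2.1 hq.2.2.2.1)).2
      ⟨hq.1, ?_, Or.inr (Or.inl hq.2.1)⟩, (hV q hq.1).2
        (resField_eq_zero_of_mem_radialLocus hσ2 (by norm_num) hq)⟩
    rw [resSymbol_eq_flatSymbol (by rw [hq.2.1, mul_zero]), hq.2.2.1]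

/-- The smooth extension stays positive near the set, so reciprocals of such factors are smooth on a
neighbourhood as well. -/
theorem SmoothOnSet.exists_pos {E : Type*} [NormedAddCommGroup E] [NormedSpace ℝ E] {X : Set E} {u : E → ℝ}
    (hu : SmoothOnSet X u) (hpos : ∀ q ∈ X, 0 < u q) : ∃ (U : Set E) (u' : E → ℝ), IsOpen U ∧ X ⊆ U ∧
      ContDiffOn ℝ ∞ u' U ∧ (∀ q ∈ U, 0 < u' q) ∧ EqOn u u' X := by
  obtain ⟨U, u', hU, hXU, hu', he⟩ := hu
  refine ⟨U ∩ u' ⁻¹' Ioi 0, u', hu'.continuousOn.isOpen_inter_preimage hU isOpen_Ioi, fun q hq =>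
    ⟨hXU hq, ?_⟩, hu'.mono inter_subset_left, fun q hq => hq.2, he⟩
  change 0 < u' q
  rw [← he hq]; exact hpos q hq

end NonrelKG
end

/-! ### Arbitrary boundary-defining functions and the final assembly. -/

open NonrelKG
theorem mainTheorem7 (d : ℕ) (hd : 1 ≤ d)
    (α : ℝ → Spacetime d → ℝ) (w : Fin d → ℝ → Spacetime d → ℝ)
    (k : Fin d → Fin d → ℝ → Spacetime d → ℝ)
    (hα : IsClassicalFamily α) (hw : ∀ j, IsClassicalFamily (w j))
    (hk : ∀ i j, IsClassicalFamily (k i j)) (hsymm : ∀ i j, k i j = k j i)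
    (hLor : ∀ h ∈ Ioo (0 : ℝ) 1, ∀ z : Spacetime d, IsLorentzian (metricMatrix α w k h z))
    (σ : ℝ) (hσ : σ = 1 ∨ σ = -1)
    (ρdf ρbf ρnf : Ambient d → ℝ)
    (hdf : IsBoundaryDefining (phaseSpace d) dfFun ρdf)
    (hbf : IsBoundaryDefining (phaseSpace d) bfFun ρbf)
    (hnf : IsBoundaryDefining (phaseSpace d) nfFun ρnf) :
    ∃ (P : Ambient d → ℝ) (V : Ambient d → Ambient d),
      IsRescaledSymbol (symbol (metricMatrix α w k) σ) ρdf ρnf P ∧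
      IsRescaledHamiltonian (symbol (metricMatrix α w k) σ) ρdf ρbf ρnf V ∧
      radialSet σ P V = radialComponent σ (-1) ∪ radialComponent σ 1 ∧
      Disjoint (radialComponent σ (-1) : Set (Ambient d)) (radialComponent σ 1) ∧
      (∀ ς : ℝ, ς = -1 ∨ ς = 1 →
        IsConnected (radialComponent σ ς : Set (Ambient d)) ∧
        radialComponent σ ς ⊆ bf d ∧
        IsPSubmanifold (phaseSpace d) (radialComponent σ ς) ∧
        IsPSubmanifold (goodSheet σ P ∩ bf d) (radialComponent σ ς)) ∧
      IsSink V (goodSheet σ P) (radialComponent σ σ) ∧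
      IsSource V (goodSheet σ P) (radialComponent σ (-σ)) ∧
      IsSink V (zeroSet P) (radialComponent σ σ) ∧
      IsSource V (zeroSet P) (radialComponent σ (-σ)) := by
  have hσ2 : σ ^ 2 = 1 := by rcases hσ with h | h <;> simp [h]
  obtain ⟨N, Ω, hΩ, hXΩ, hN, hNs, hNd, hp⟩ := exists_inverse_metric hα hw hk hsymm hLor σ
  have hX := phaseSpace_subset_metricDomain hXΩ
  obtain ⟨u₁, hu₁, hu₁p, hu₁e⟩ := hdf
  obtain ⟨u₂, hu₂, hu₂p, hu₂e⟩ := hbf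
  obtain ⟨u₃, hu₃, hu₃p, hu₃e⟩ := hnf
  obtain ⟨U₁, v₁, hU₁, hXU₁, hv₁, hv₁p, e₁⟩ := SmoothOnSet.exists_pos hu₁ hu₁p
  obtain ⟨U₂, v₂, hU₂, hXU₂, hv₂, hv₂p, e₂⟩ := SmoothOnSet.exists_pos hu₂ hu₂p
  obtain ⟨U₃, v₃, hU₃, hXU₃, hv₃, hv₃p, e₃⟩ := SmoothOnSet.exists_pos hu₃ hu₃p
  set Uf := U₁ ∩ (U₂ ∩ U₃) with hUf_def
  have hUf : IsOpen Uf := hU₁.inter (hU₂.inter hU₃)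
  have hXf : phaseSpace d ⊆ Uf := fun q hq => ⟨hXU₁ hq, hXU₂ hq, hXU₃ hq⟩
  have hv₁' : ContDiffOn ℝ ∞ v₁ Uf := hv₁.mono fun q hq => hq.1
  have hv₂' : ContDiffOn ℝ ∞ v₂ Uf := hv₂.mono fun q hq => hq.2.1
  have hv₃' : ContDiffOn ℝ ∞ v₃ Uf := hv₃.mono fun q hq => hq.2.2
  -- A change of boundary-defining functions multiplies symbol and field by smooth positive factors.
  -- These affect neither the zeros nor the sink and source properties.
  set f : Ambient d → ℝ := fun q => v₁ q * (v₂ q)⁻¹ * v₃ q with hf_def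
  have hf : ContDiffOn ℝ ∞ f Uf := (hv₁'.mul (hv₂'.inv fun q hq => (hv₂p q hq.2.1).ne')).mul hv₃'
  have hfpos : ∀ q ∈ phaseSpace d, 0 < f q := fun q hq =>
    mul_pos (mul_pos (hv₁p q (hXU₁ hq)) (inv_pos.2 (hv₂p q (hXU₂ hq)))) (hv₃p q (hXU₃ hq))
  set P : Ambient d → ℝ := fun q => v₁ q ^ 2 * v₃ q ^ 2 * resSymbol N σ q with hP_def
  set V : Ambient d → Ambient d := fun q => f q • resField N σ q with hV_def
  have hP0 : ∀ q ∈ phaseSpace d, P q = 0 ↔ resSymbol N σ q = 0 := fun q hq => by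
    have h1 := (hv₁p q (hXU₁ hq)).ne'
    have h3 := (hv₃p q (hXU₃ hq)).ne'
    simp [hP_def, h1, h3]
  have hopen : IsOpen (Uf ∩ metricDomain Ω) := hUf.inter (isOpen_metricDomain hΩ)
  have hsub : phaseSpace d ⊆ Uf ∩ metricDomain Ω := fun q hq => ⟨hXf hq, hX hq⟩
  have hS1 : ∀ q ∈ goodSheet σ P, q ∈ phaseSpace d ∧ resSymbol N σ q = 0 := fun q hq =>
    ⟨(goodSheet_spec hP0 hq).1, (goodSheet_spec hP0 hq).2.1⟩
  have hS2 : ∀ q ∈ zeroSet P, q ∈ phaseSpace d ∧ resSymbol N σ q = 0 := fun q hq =>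
    ⟨hq.1, (hP0 q hq.1).1 hq.2⟩
  -- A trajectory in Σ remains in whichever of the three faces it started in, and this keeps it in
  -- Σ.
  have hI1 : ∀ q ∈ goodSheet σ P, ∀ q' ∈ phaseSpace d, resSymbol N σ q' = 0 → 0 < energyFun σ q' →
      (bfFun q = 0 → bfFun q' = 0) → (nfFun q = 0 → nfFun q' = 0) → (dfFun q = 0 → dfFun q' = 0) →
      q' ∈ goodSheet σ P := fun q hq q' h1 h2 h3 h4 h5 h6 => by
    have := (goodSheet_spec hP0 hq).2.2.1
    exact (mem_goodSheet_iff hP0 h3).2 ⟨h1, h2, this.imp h6 (Or.imp h4 h5)⟩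
  have hI2 : ∀ q ∈ zeroSet P, ∀ q' ∈ phaseSpace d, resSymbol N σ q' = 0 → 0 < energyFun σ q' →
      (bfFun q = 0 → bfFun q' = 0) → (nfFun q = 0 → nfFun q' = 0) → (dfFun q = 0 → dfFun q' = 0) →
      q' ∈ zeroSet P := fun q _ q' h1 h2 _ _ _ _ => ⟨h1, (hP0 q' h1).2 h2⟩
  have hςσ : ∀ ς : ℝ, ς = -1 ∨ ς = 1 → ς ^ 2 = 1 := fun ς h => by rcases h with h | h <;> simp [h]
  have hlocus : ∀ ς : ℝ, ς = -1 ∨ ς = 1 → (radialComponent σ ς : Set (Ambient d)) = radialLocus σ ς :=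
    fun ς h => radialComponent_eq_radialLocus hσ2 (hςσ ς h)
  have hσ' : σ = -1 ∨ σ = 1 := hσ.symm
  have hnσ' : -σ = -1 ∨ -σ = 1 := by rcases hσ with h | h <;> simp [h]
  have hmn : (-σ) ^ 2 = 1 := by rw [neg_sq, hσ2]
  refine ⟨P, V, ⟨⟨_, P, hopen, hsub, ?_, fun q _ => rfl⟩, ?_⟩, ⟨⟨_, V, hopen, hsub, ?_, fun q _ => rfl⟩, ?_⟩,
    ?_, ?_, ?_, ?_, ?_, ?_, ?_⟩
  · exact (((hv₁'.pow 2).mul (hv₃'.pow 2)).mono inter_subset_left).mul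
      ((contDiffOn_resSymbol hN σ).mono inter_subset_right)
  · intro h hh z ζ
    have hq := phaseEmbed_mem z ζ hh.1 hh.2
    rw [hp h hh z ζ, hu₁e _ hq, hu₃e _ hq, e₁ hq, e₃ hq]
    have h1 := resSymbol_phaseEmbed (N := N) hh.1 σ z ζ
    simp only [hP_def, h1, normalSymbol, pertQuad]
    ring
  · exact (hf.mono inter_subset_left).smul ((contDiffOn_resField hΩ hN σ).mono inter_subset_right)
  · intro h hh z ζ
    have hq := phaseEmbed_mem z ζ hh.1 hh.2
    have hsym : symbol (metricMatrix α w k) σ h = normalSymbol N σ h := by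
      funext z ζ; exact hp h hh z ζ
    have h1 := resField_phaseEmbed hNs hh.1 σ z ζ fun i j =>
      ((hN i j).contDiffAt (hΩ.mem_nhds (hXΩ ⟨⟨hh.1.le, hh.2⟩, baseEmbed_mem z⟩))).differentiableAt (by simp)
    rw [hsym]
    simp only [hV_def]
    rw [h1, smul_smul, hu₁e _ hq, hu₂e _ hq, hu₃e _ hq, e₁ hq, e₂ hq, e₃ hq]
    congr 1
    rw [mul_inv]
    simp only [hf_def]
    ring
  · rw [hlocus _ (Or.inl rfl), hlocus _ (Or.inr rfl)]
    refine radialSet_eq hσ hNd hP0 fun q hq => ?_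
    simp only [hV_def, smul_eq_zero, (hfpos q hq).ne', false_or]
  · rw [hlocus _ (Or.inl rfl), hlocus _ (Or.inr rfl)]
    exact disjoint_radialLocus hσ2
  · intro ς hς
    refine ⟨isConnected_radialComponent σ (hςσ ς hς), ?_, ?_, ?_⟩ <;> rw [hlocus ς hς]
    · exact fun q hq => ⟨hq.1, hq.2.1⟩
    · exact radialLocus_isPSubmanifold hσ2 (hςσ ς hς)
    · refine radialLocus_isPSubmanifold_of_eq hσ2 (hςσ ς hς) fun u hu => ?_
      rw [mem_inter_iff, mem_goodSheet_iff hP0 hu]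
      constructor
      · rintro ⟨⟨h1, h2, -⟩, h3⟩
        refine ⟨h1, h3.2, ?_⟩
        rw [← h2]; exact (resSymbol_eq_flatSymbol (by rw [h3.2, mul_zero])).symm
      · rintro ⟨h1, h2, h3⟩
        refine ⟨⟨h1, ?_, Or.inr (Or.inl h2)⟩, h1, h2⟩
        rw [resSymbol_eq_flatSymbol (by rw [h2, mul_zero]), h3]
  · rw [hlocus σ hσ']
    exact isSink_radialLocus hNs hΩ hN hX (ε := 1) hσ2 hσ2 (by linear_combination hσ2) hUf hXf hf hfpos hS1
      (fun q _ => by rw [one_mul]) hI1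
  -- For the source the flow is reversed, and ε = -1 compensates ς = -σ.
  · rw [hlocus (-σ) hnσ']
    exact isSink_radialLocus hNs hΩ hN hX (ε := -1) hσ2 hmn (by linear_combination hσ2) hUf hXf hf hfpos hS1
      (fun q _ => by rw [neg_one_mul, neg_smul]) hI1
  · rw [hlocus σ hσ']
    exact isSink_radialLocus hNs hΩ hN hX (ε := 1) hσ2 hσ2 (by linear_combination hσ2) hUf hXf hf hfpos hS2
      (fun q _ => by rw [one_mul]) hI2
  · rw [hlocus (-σ) hnσ']
    exact isSink_radialLocus hNs hΩ hN hX (ε := -1) hσ2 hmn (by linear_combination hσ2) hUf hXf hf hfpos hS2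
      (fun q _ => by rw [neg_one_mul, neg_smul]) hI2
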